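/- Let $M$ be a smooth $3$-manifold with a co-oriented contact sub-Riemannian structure $(\mathcal D,\mathbf g)$: $\mathcal D$ is a smooth rank-$2$ distribution with $\mathcal D+[\mathcal D,\mathcal D]=TM$ that is globally the kernel of a smooth $1$-form, and $\mathbf g$ is a smooth family of inner products on the planes of $\mathcal D$. Let $S$ be a closed (compact, connected, without boundary) orientable surface smoothly embedded in $M$, and let $\Sigma(S)=\{q\in S: T_qS=\mathcal D_q\}$. Suppose that the characteristic foliation of $S$ is driven by the smooth vector field $X$ on $S$, i.e. $X=0$ on $\Sigma(S)$ and $T_qS\cap\mathcal D_q=\operatorname{span}_{\mathbb R}X(q)$ for all $q\in S\setminus\Sigma(S)$. Suppose moreover that $X$ is Morse–Smale, that is: - $X$ has finitely many critical points and finitely many closed orbits, all of which are non-degenerate (the linearization of $X$ at each critical point is invertible; the derivative of the Poincaré return map of each closed orbit is different from $1$); - the $\alpha$-limit set and the $\omega$-limit set of every trajectory of $X$ are each either a single critical point or a closed orbit; - there are no saddle connections: no non-constant trajectory of $X$ tends to saddles (possibly the same one) both as $t\to+\infty$ and as $t\to-\infty$. For $p,q\in S$ let the induced distance be $$d_S(p,q)=\inf\Big\{\int_0^T\sqrt{\mathbf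 g(\dot\gamma(t),\dot\gamma(t))}\,dt\Big\}\in[0,\infty],$$ where the infimum is over all $T>0$ and all Lipschitz curves $\gamma:[0,T]\to S$ with $\gamma(0)=p$, $\gamma(T)=q$ and $\dot\gamma(t)\in\mathcal D_{\gamma(t)}$ for almost every $t$ (it is $\infty$ if there is no such curve). Then $d_S(p,q)<\infty$ for all $p,q\in S$ if and only if $X$ has no closed orbits (images of non-constant periodic trajectories). -/

import Mathlib

open Set Filter Topology MeasureTheory Manifold Bundle
open scoped ContDiff ENNReal NNReal

noncomputable section

/-- The model space of surfaces. -/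
abbrev Plane : Type := EuclideanSpace ℝ (Fin 2)

/-- The model space of three-dimensional manifolds. -/
abbrev Space : Type := EuclideanSpace ℝ (Fin 3)

/-! ### Three-dimensional contact sub-Riemannian manifolds -/

section SubRiemannian

variable (M : Type*) [TopologicalSpace M] [ChartedSpace Space M] [IsManifold (𝓡 3) ∞ M]

/-- A field of subspaces of the tangent spaces of `M`. -/
abbrev PlaneField : Type _ := (x : M) → Submodule ℝ (TangentSpace (𝓡 3) x)

variable {M}

/-- The vector field `V`, a section of the plane field `D`, is smooth on `U`. -/
def PlaneField.SmoothSectionOn (D : PlaneField M) (V : (x : M) → D x) (U : Set M) : Prop :=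
  ContMDiffOn (𝓡 3) (𝓡 3).tangent ∞
    (fun x ↦ (⟨x, (V x : TangentSpace (𝓡 3) x)⟩ : TangentBundle (𝓡 3) M)) U

/-- `D` is a smooth distribution of rank two: near every point it is spanned by two smooth,
pointwise linearly independent vector fields. -/
def PlaneField.IsSmoothOfRankTwo (D : PlaneField M) : Prop :=
  ∀ p : M, ∃ U : Set M, IsOpen U ∧ p ∈ U ∧ ∃ F₁ F₂ : (x : M) → D x,
    D.SmoothSectionOn F₁ U ∧ D.SmoothSectionOn F₂ U ∧
      ∀ x ∈ U, LinearIndependent ℝ ![F₁ x, F₂ x] ∧ Submodule.span ℝ {F₁ x, F₂ x} = ⊤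

/-- The values at `p` of the Lie brackets `[V, W]`, where `V` and `W` are smooth sections of `D`
over some neighbourhood of `p`. -/
def PlaneField.bracketsAt (D : PlaneField M) (p : M) : Set (TangentSpace (𝓡 3) p) :=
  {v | ∃ U : Set M, IsOpen U ∧ p ∈ U ∧ ∃ V W : (x : M) → D x,
    D.SmoothSectionOn V U ∧ D.SmoothSectionOn W U ∧
      v = VectorField.mlieBracket (𝓡 3) (fun x ↦ (V x : TangentSpace (𝓡 3) x))
        (fun x ↦ (W x : TangentSpace (𝓡 3) x)) p}

variable (M) in
/-- A three-dimensional contact sub-Riemannian structure on `M`: a smooth distribution `D` of rank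
two with `D + [D, D] = TM`, and a smooth family of inner products on the planes of `D`. -/
structure ContactSubRiemannian where
  D : PlaneField M
  rank_two : D.IsSmoothOfRankTwo
  contact : ∀ p : M, D p ⊔ Submodule.span ℝ (D.bracketsAt p) = ⊤
  metric : (x : M) → D x →ₗ[ℝ] D x →ₗ[ℝ] ℝ
  metric_symm : ∀ (x : M) (v w : D x), metric x v w = metric x w v
  metric_pos : ∀ (x : M) (v : D x), v ≠ 0 → 0 < metric x v v
  metric_smooth : ∀ (U : Set M), IsOpen U → ∀ V W : (x : M) → D x,
    D.SmoothSectionOn V U → D.SmoothSectionOn W U →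
      ContMDiffOn (𝓡 3) 𝓘(ℝ, ℝ) ∞ (fun x ↦ metric x (V x) (W x)) U

/-- `D` is, globally, the kernel of a smooth 1-form `α`. -/
def ContactSubRiemannian.CoOrientable (𝓜 : ContactSubRiemannian M) : Prop :=
  ∃ α : (x : M) → TangentSpace (𝓡 3) x →L[ℝ] Trivial M ℝ x,
    ContMDiff (𝓡 3) ((𝓡 3).prod 𝓘(ℝ, Space →L[ℝ] ℝ)) ∞
      (fun x ↦ TotalSpace.mk' (Space →L[ℝ] ℝ)
        (E := fun x ↦ TangentSpace (𝓡 3) x →L[ℝ] Trivial M ℝ x) x (α x)) ∧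
    ∀ (x : M) (v : TangentSpace (𝓡 3) x), v ∈ 𝓜.D x ↔ α x v = 0

open Classical in
/-- The length of a tangent vector `v` at `x`: it is `√(g(v, v))` for `v ∈ D x`, which is the only
case that matters, and `∞` for the other vectors. -/
def ContactSubRiemannian.vectorLength (𝓜 : ContactSubRiemannian M) (x : M)
    (v : TangentSpace (𝓡 3) x) : ℝ≥0∞ :=
  if h : v ∈ 𝓜.D x then ENNReal.ofReal (√(𝓜.metric x ⟨v, h⟩ ⟨v, h⟩)) else ⊤

end SubRiemannian

/-! ### Surfaces, curves on them, and the induced distance -/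

section Surface

variable {S : Type*} [TopologicalSpace S] [ChartedSpace Plane S] [IsManifold (𝓡 2) ∞ S]

variable (S) in
/-- `S` is orientable: it is covered by smooth charts all of whose coordinate changes have
positive Jacobian determinant. -/
def IsOrientableSurface : Prop :=
  ∃ A ⊆ IsManifold.maximalAtlas (𝓡 2) ∞ S, (∀ q : S, ∃ e ∈ A, q ∈ e.source) ∧
    ∀ e ∈ A, ∀ e' ∈ A, ∀ q ∈ e.source ∩ e'.source,
      0 < (fderiv ℝ (e' ∘ e.symm) (e q)).det

/-- The curve `γ`, restricted to `[0, T]`, is Lipschitz: it is continuous, and Lipschitz in charts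
near every time. By compactness of `[0, T]` this is the same as being Lipschitz for the distance
of any Riemannian metric. -/
def IsLipschitzCurve (γ : ℝ → S) (T : ℝ) : Prop :=
  ContinuousOn γ (Icc 0 T) ∧
    ∀ t₀ ∈ Icc 0 T, ∃ u ∈ 𝓝[Icc 0 T] t₀, ∃ K : ℝ≥0,
      LipschitzOnWith K (fun t ↦ extChartAt (𝓡 2) (γ t₀) (γ t)) u

/-- The velocity of a curve on `S` (at times where it is differentiable). -/
def velocity (γ : ℝ → S) (t : ℝ) : TangentSpace (𝓡 2) (γ t) :=
  mfderiv 𝓘(ℝ, ℝ) (𝓡 2) γ t (1 : ℝ)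

variable {M : Type*} [TopologicalSpace M] [ChartedSpace Space M] [IsManifold (𝓡 3) ∞ M]

/-- The subspace `T_qS ∩ D_q` of `T_qS`, for the surface parametrized by `ι : S → M`. -/
def ContactSubRiemannian.traceAt (𝓜 : ContactSubRiemannian M) (ι : S → M) (q : S) :
    Submodule ℝ (TangentSpace (𝓡 2) q) :=
  (𝓜.D (ι q)).comap (mfderiv (𝓡 2) (𝓡 3) ι q).toLinearMap

/-- The set `Σ(S)` of characteristic points: the points `q` with `T_qS = D_q`. -/
def ContactSubRiemannian.characteristicSet (𝓜 : ContactSubRiemannian M) (ι : S → M) : Set S :=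
  {q | LinearMap.range (mfderiv (𝓡 2) (𝓡 3) ι q).toLinearMap = 𝓜.D (ι q)}

/-- `X` is a characteristic vector field of the surface: it drives the characteristic foliation,
that is, it is smooth, vanishes at the characteristic points and spans `T_qS ∩ D_q` at the others.
-/
structure ContactSubRiemannian.IsCharacteristicVectorField (𝓜 : ContactSubRiemannian M)
    (ι : S → M) (X : (q : S) → TangentSpace (𝓡 2) q) : Prop where
  smooth : ContMDiff (𝓡 2) (𝓡 2).tangent ∞ (fun q ↦ (⟨q, X q⟩ : TangentBundle (𝓡 2) S))
  eq_zero : ∀ q ∈ 𝓜.characteristicSet ι, X q = 0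
  span_eq : ∀ q ∉ 𝓜.characteristicSet ι, 𝓜.traceAt ι q = Submodule.span ℝ {X q}

/-- The curve `γ : [0, T] → S` is admissible: it is Lipschitz, and `γ'(t) ∈ D` for almost every
`t ∈ [0, T]`. -/
def ContactSubRiemannian.IsAdmissible (𝓜 : ContactSubRiemannian M) (ι : S → M)
    (γ : ℝ → S) (T : ℝ) : Prop :=
  0 < T ∧ IsLipschitzCurve γ T ∧
    ∀ᵐ t ∂(volume.restrict (Icc 0 T)), MDifferentiableAt 𝓘(ℝ, ℝ) (𝓡 2) γ t ∧
      mfderiv (𝓡 2) (𝓡 3) ι (γ t) (velocity γ t) ∈ 𝓜.D (ι (γ t))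

/-- The length `∫₀ᵀ √(g(γ', γ')) dt`. -/
def ContactSubRiemannian.curveLength (𝓜 : ContactSubRiemannian M) (ι : S → M)
    (γ : ℝ → S) (T : ℝ) : ℝ≥0∞ :=
  ∫⁻ t in Icc 0 T, 𝓜.vectorLength (ι (γ t)) (mfderiv (𝓡 2) (𝓡 3) ι (γ t) (velocity γ t))

/-- The induced distance `d_S`: the infimum of the lengths of the admissible curves on the surface
from `p` to `q`, which is `∞` when there is none. -/
def ContactSubRiemannian.inducedDist (𝓜 : ContactSubRiemannian M) (ι : S → M) (p q : S) : ℝ≥0∞ :=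
  ⨅ (γ : ℝ → S) (T : ℝ) (_ : 𝓜.IsAdmissible ι γ T ∧ γ 0 = p ∧ γ T = q), 𝓜.curveLength ι γ T

/-- The induced distance is finite for every pair of points. -/
def ContactSubRiemannian.InducedDistFinite (𝓜 : ContactSubRiemannian M) (ι : S → M) : Prop :=
  ∀ p q : S, 𝓜.inducedDist ι p q < ⊤

end Surface

/-! ### Morse–Smale vector fields on surfaces -/

section MorseSmale

variable {S : Type*} [TopologicalSpace S] [ChartedSpace Plane S] [IsManifold (𝓡 2) ∞ S]
  (X : (q : S) → TangentSpace (𝓡 2) q)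

/-- The flow of `X`: `t ↦ flow X t x` is the integral curve of `X` starting at `x`, provided that
it is defined for all times, as it is for smooth `X` on compact `S`. -/
def flow (t : ℝ) (x : S) : S :=
  haveI : Nonempty (ℝ → S) := ⟨fun _ ↦ x⟩
  Classical.epsilon (fun γ : ℝ → S ↦ γ 0 = x ∧ IsMIntegralCurve (I := 𝓡 2) γ X) t

/-- The differential of `X` at `q`, computed in the chart at `q`; at a zero of `X` it is the
intrinsic linearization `T_qS → T_qS`. -/
def linearization (q : S) : Plane →L[ℝ] Plane :=
  fderiv ℝ (fun y : Plane ↦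
      (mfderiv (𝓡 2) 𝓘(ℝ, Plane) (extChartAt (𝓡 2) q) ((extChartAt (𝓡 2) q).symm y)
        (X ((extChartAt (𝓡 2) q).symm y)) : Plane))
    (extChartAt (𝓡 2) q q)

/-- A critical point of `X`. -/
def IsCriticalPoint (q : S) : Prop := X q = 0

/-- A critical point is non-degenerate if the linearization there is invertible. For a
characteristic vector field of a surface in a contact manifold the trace of the linearization is
then nonzero as well, so that such a point is hyperbolic. -/
def IsNondegenerateCriticalPoint (q : S) : Prop :=
  IsCriticalPoint X q ∧ (linearization X q).det ≠ 0

/-- A saddle (hyperbolic point): the linearization has two real eigenvalues of opposite signs. -/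
def IsSaddle (q : S) : Prop :=
  IsCriticalPoint X q ∧ (linearization X q).det < 0

/-- `γ` is a nonconstant integral curve of `X` with period `T > 0`. -/
def IsPeriodicTrajectory (γ : ℝ → S) (T : ℝ) : Prop :=
  IsMIntegralCurve (I := 𝓡 2) γ X ∧ (∀ t, X (γ t) ≠ 0) ∧ 0 < T ∧ Function.Periodic γ T

/-- `C` is a closed orbit of `X`: the image of a nonconstant periodic integral curve. -/
def IsClosedOrbit (C : Set S) : Prop :=
  ∃ (γ : ℝ → S) (T : ℝ), IsPeriodicTrajectory X γ T ∧ range γ = C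

/-- `C` is a non-degenerate closed orbit: if `T` is its minimal period and `p ∈ C`, then the
differential at `p` of the Poincaré return map, which is the map that the differential at `p` of
the time-`T` flow (which fixes `p`) induces on `T_pS / ℝ X(p)`, does not have the eigenvalue `1`. -/
def IsNondegenerateClosedOrbit (C : Set S) : Prop :=
  IsClosedOrbit X C ∧
    ∀ (γ : ℝ → S) (T : ℝ), IsPeriodicTrajectory X γ T → range γ = C →
      (∀ T' : ℝ, IsPeriodicTrajectory X γ T' → T ≤ T') →
      let P : Plane →L[ℝ] Plane := mfderiv (𝓡 2) (𝓡 2) (flow X T) (γ 0)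
      let L : Submodule ℝ Plane := Submodule.span ℝ {(X (γ 0) : Plane)}
      ∀ v : Plane, P v - v ∈ L → v ∈ L

/-- `γ` is a saddle connection: a nonconstant trajectory that tends to saddles, possibly to the same
one, in both time directions. -/
def IsSaddleConnection (γ : ℝ → S) : Prop :=
  IsMIntegralCurve (I := 𝓡 2) γ X ∧ (∀ t, X (γ t) ≠ 0) ∧
    ∃ p q : S, IsSaddle X p ∧ IsSaddle X q ∧ Tendsto γ atBot (𝓝 p) ∧ Tendsto γ atTop (𝓝 q)

/-- The set `A` is a critical point or a closed orbit of `X`. -/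
def IsCriticalElement (A : Set S) : Prop :=
  (∃ q, IsCriticalPoint X q ∧ A = {q}) ∨ IsClosedOrbit X A

/-- Morse–Smale vector fields on a closed surface. -/
structure IsMorseSmale : Prop where
  smooth : ContMDiff (𝓡 2) (𝓡 2).tangent ∞ (fun q ↦ (⟨q, X q⟩ : TangentBundle (𝓡 2) S))
  finite_criticalPoints : {q : S | IsCriticalPoint X q}.Finite
  nondegenerate_criticalPoints : ∀ q, IsCriticalPoint X q → IsNondegenerateCriticalPoint X q
  finite_closedOrbits : {C : Set S | IsClosedOrbit X C}.Finite
  nondegenerate_closedOrbits : ∀ C, IsClosedOrbit X C → IsNondegenerateClosedOrbit X C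
  omegaLimit_eq : ∀ x : S, IsCriticalElement X (omegaLimit atTop (flow X) {x})
  alphaLimit_eq : ∀ x : S, IsCriticalElement X (omegaLimit atBot (flow X) {x})
  no_saddleConnection : ∀ γ : ℝ → S, ¬ IsSaddleConnection X γ

end MorseSmale

end

/-! An admissible curve has finite length, because it is Lipschitz on a compact interval. So `d_S(p,
q)` is finite exactly when some admissible curve joins `p` to `q` (`inducedDist_lt_top_iff`), and
being joined is an equivalence relation. The theorem asks when it has a single class.

A closed orbit is an obstruction. Away from the zeros of `X` an admissible curve has velocity
proportional to `X` almost everywhere, so it only moves along one trajectory, possibly back and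
forth (`exists_eq_integralCurve_of_ae_tangent`). A closed orbit is compact and contains no zero,
hence cannot be left (`IsClosedOrbit.mem_of_joined`), and a trajectory, having dimension at most
one, is not the whole surface (`range_ne_univ`).

Without closed orbits every trajectory tends to a zero of `X` in both time directions. The contact
condition makes each zero a sink, a source or a saddle. Indeed the pulled-back contact form vanishes
at the zero and annihilates `X`; if the linearization were invertible with trace zero, the form
would be closed there, so `dα` would vanish on the contact plane (`planeTrace_ne_zero`). Convergence
to a sink is exponential, and so is convergence along a suitable trajectory to a saddle. Such a
trajectory becomes, after a logarithmic change of time, a Lipschitz curve that reaches the zero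
(`joined_of_tendsto`).

Since there are no saddle connections, every point other than a saddle lies in the basin of a sink
or, backwards, of a source. Basins are open, so nearby points lie in the same class
(`eventually_joined`). A small punctured disc around a saddle is connected and contains no other
saddle, so it lies in one class, and one trajectory tending to the saddle puts the saddle in it as
well (`eventually_joined_saddle`). The classes are therefore open, and `S` is connected. One such
trajectory suffices, so a limit of orbit segments replaces the stable manifold theorem
(`exists_trajectory_to_saddle`). -/

open scoped InnerProductSpace

noncomputable section

/-! ### Vector fields and curves read in charts -/

section ChartCoordinates

variable {E : Type*} [NormedAddCommGroup E] [NormedSpace ℝ E]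
  {N : Type*} [TopologicalSpace N] [ChartedSpace E N]

/-- The differential at `x` of the chart at `q`, as an endomorphism of the model space. -/
def chartDiff (q x : N) : E →L[ℝ] E :=
  mfderiv 𝓘(ℝ, E) 𝓘(ℝ, E) (extChartAt 𝓘(ℝ, E) q) x

/-- The differential at `y` of the inverse of the chart at `q`, as an endomorphism of the model
space. -/
def chartSymmDiff (q : N) (y : E) : E →L[ℝ] E :=
  mfderiv 𝓘(ℝ, E) 𝓘(ℝ, E) (extChartAt 𝓘(ℝ, E) q).symm y

/-- The vector field `X` read in the chart at `q`. -/
def coordField (X : (x : N) → TangentSpace 𝓘(ℝ, E) x) (q : N) (y : E) : E :=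
  chartDiff (E := E) q ((extChartAt 𝓘(ℝ, E) q).symm y) (X ((extChartAt 𝓘(ℝ, E) q).symm y))

theorem coordField_extChartAt (X : (x : N) → TangentSpace 𝓘(ℝ, E) x) {q x : N}
    (hx : x ∈ (extChartAt 𝓘(ℝ, E) q).source) :
    coordField X q (extChartAt 𝓘(ℝ, E) q x) = chartDiff (E := E) q x (X x) := by
  unfold coordField
  rw [(extChartAt 𝓘(ℝ, E) q).left_inv hx]

variable [IsManifold 𝓘(ℝ, E) ∞ N]

theorem mdifferentiableAt_chart {q x : N} (hx : x ∈ (extChartAt 𝓘(ℝ, E) q).source) :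
    MDifferentiableAt 𝓘(ℝ, E) 𝓘(ℝ, E) (extChartAt 𝓘(ℝ, E) q) x :=
  mdifferentiableAt_extChartAt (by simpa using hx)

theorem mdifferentiableAt_chart_symm {q : N} {y : E} (hy : y ∈ (extChartAt 𝓘(ℝ, E) q).target) :
    MDifferentiableAt 𝓘(ℝ, E) 𝓘(ℝ, E) (extChartAt 𝓘(ℝ, E) q).symm y :=
  ((contMDiffOn_extChartAt_symm (I := 𝓘(ℝ, E)) (n := ∞) q).contMDiffAt
    ((isOpen_extChartAt_target q).mem_nhds hy)).mdifferentiableAt (by simp)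

theorem chartSymmDiff_chartDiff {q x : N}
    (hx : x ∈ (extChartAt 𝓘(ℝ, E) q).source) (v : E) :
    chartSymmDiff q (extChartAt 𝓘(ℝ, E) q x) (chartDiff q x v) = v := by
  have := mfderivWithin_extChartAt_symm_comp_mfderiv_extChartAt' (I := 𝓘(ℝ, E)) hx
  have h := congrArg (fun L ↦ L v) this
  simp only [ModelWithCorners.range_eq_univ, mfderivWithin_univ] at h
  exact h

theorem chartDiff_chartSymmDiff {q : N} {y : E}
    (hy : y ∈ (extChartAt 𝓘(ℝ, E) q).target) (v : E) :
    chartDiff q ((extChartAt 𝓘(ℝ, E) q).symm y) (chartSymmDiff q y v) = v := by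
  have := mfderiv_extChartAt_comp_mfderivWithin_extChartAt_symm (I := 𝓘(ℝ, E)) hy
  have h := congrArg (fun L ↦ L v) this
  simp only [ModelWithCorners.range_eq_univ, mfderivWithin_univ] at h
  exact h

theorem chartDiff_eq_zero_iff {q x : N} (hx : x ∈ (extChartAt 𝓘(ℝ, E) q).source)
    (v : E) : chartDiff q x v = 0 ↔ v = 0 := by
  constructor
  · intro h
    rw [← chartSymmDiff_chartDiff hx v, h, map_zero]
  · rintro rfl
    exact map_zero _

theorem hasDerivAt_chart_comp {γ : ℝ → N} {t : ℝ} {w : E}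
    (hγ : HasMFDerivAt 𝓘(ℝ, ℝ) 𝓘(ℝ, E) γ t ((1 : ℝ →L[ℝ] ℝ).smulRight w)) {q : N}
    (hq : γ t ∈ (extChartAt 𝓘(ℝ, E) q).source) :
    HasDerivAt (fun s ↦ extChartAt 𝓘(ℝ, E) q (γ s)) (chartDiff q (γ t) w) t := by
  have h := (mdifferentiableAt_chart hq).hasMFDerivAt.comp t hγ
  have h2 : HasFDerivAt (fun s ↦ extChartAt 𝓘(ℝ, E) q (γ s))
      ((chartDiff q (γ t)).comp ((1 : ℝ →L[ℝ] ℝ).smulRight w)) t := hasMFDerivAt_iff_hasFDerivAt.mp h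
  simpa using h2.hasDerivAt

theorem IsMIntegralCurve.hasDerivAt_chart {X : (x : N) → TangentSpace 𝓘(ℝ, E) x} {γ : ℝ → N}
    (hγ : IsMIntegralCurve (I := 𝓘(ℝ, E)) γ X) {q : N} {t : ℝ}
    (hq : γ t ∈ (extChartAt 𝓘(ℝ, E) q).source) :
    HasDerivAt (fun s ↦ extChartAt 𝓘(ℝ, E) q (γ s))
      (coordField X q (extChartAt 𝓘(ℝ, E) q (γ t))) t := by
  rw [coordField_extChartAt X hq]
  exact hasDerivAt_chart_comp (hγ t) hq

theorem hasMFDerivAt_chart_symm_comp {u : ℝ → E} {u' : E} {t : ℝ} (hu : HasDerivAt u u' t) {q : N}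
    (hq : u t ∈ (extChartAt 𝓘(ℝ, E) q).target) :
    HasMFDerivAt 𝓘(ℝ, ℝ) 𝓘(ℝ, E) (fun s ↦ (extChartAt 𝓘(ℝ, E) q).symm (u s)) t
      ((1 : ℝ →L[ℝ] ℝ).smulRight (chartSymmDiff q (u t) u')) := by
  have h := (mdifferentiableAt_chart_symm hq).hasMFDerivAt.comp t
    (hasMFDerivAt_iff_hasFDerivAt.mpr hu.hasFDerivAt)
  have e : (chartSymmDiff q (u t)).comp (ContinuousLinearMap.toSpanSingleton ℝ u') =
      (1 : ℝ →L[ℝ] ℝ).smulRight (chartSymmDiff q (u t) u') := by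
    ext; simp
  exact h.congr_mfderiv e

theorem isMIntegralCurveOn_chart_symm_comp {X : (x : N) → TangentSpace 𝓘(ℝ, E) x} {q : N}
    {u : ℝ → E} {s : Set ℝ} (hu : ∀ t ∈ s, HasDerivAt u (coordField X q (u t)) t)
    (hq : ∀ t ∈ s, u t ∈ (extChartAt 𝓘(ℝ, E) q).target) :
    IsMIntegralCurveOn (I := 𝓘(ℝ, E)) (fun t ↦ (extChartAt 𝓘(ℝ, E) q).symm (u t)) X s := by
  intro t ht
  have h := (hasMFDerivAt_chart_symm_comp (hu t ht) (hq t ht)).hasMFDerivWithinAt (s := s)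
  have h2 : chartSymmDiff q (u t) (coordField X q (u t)) =
      X ((extChartAt 𝓘(ℝ, E) q).symm (u t)) := by
    have := chartSymmDiff_chartDiff
      ((extChartAt 𝓘(ℝ, E) q).map_target (hq t ht)) (X ((extChartAt 𝓘(ℝ, E) q).symm (u t)))
    rwa [(extChartAt 𝓘(ℝ, E) q).right_inv (hq t ht)] at this
  rw [h2] at h
  exact h

theorem contDiffOn_coordField_of_contMDiffOn {X : (x : N) → TangentSpace 𝓘(ℝ, E) x} {U : Set N}
    (hU : IsOpen U)
    (hX : ContMDiffOn 𝓘(ℝ, E) 𝓘(ℝ, E).tangent ∞ (fun x ↦ (⟨x, X x⟩ : TangentBundle 𝓘(ℝ, E) N)) U)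
    (q : N) :
    ContDiffOn ℝ ∞ (coordField X q)
      ((extChartAt 𝓘(ℝ, E) q).target ∩ (extChartAt 𝓘(ℝ, E) q).symm ⁻¹' U) := by
  have h1 : ContMDiffOn 𝓘(ℝ, E) 𝓘(ℝ, E) ∞ (fun x ↦ chartDiff (E := E) q x (X x))
      ((extChartAt 𝓘(ℝ, E) q).source ∩ U) := by
    have h := ((trivializationAt E (TangentSpace 𝓘(ℝ, E)) q).contMDiffOn_section_iff (IB := 𝓘(ℝ, E)) (n := ∞)
      (a := (extChartAt 𝓘(ℝ, E) q).source ∩ U) (s := X) ?_ ?_).1 (hX.mono inter_subset_right)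
    · refine h.congr fun x hx ↦ ?_
      have := TangentBundle.continuousLinearMapAt_trivializationAt (I := 𝓘(ℝ, E)) (x₀ := q) (x := x)
        (by simpa using hx.1)
      have hb : x ∈ (trivializationAt E (TangentSpace 𝓘(ℝ, E)) q).baseSet := by simpa using hx.1
      have h3 := congrFun ((trivializationAt E (TangentSpace 𝓘(ℝ, E)) q).coe_linearMapAt_of_mem
        (R := ℝ) hb) (X x)
      exact (congrArg (fun L ↦ L (X x)) this).symm.trans h3
    · exact (isOpen_extChartAt_source q).inter hU
    · intro x hx
      simpa using hx.1
  have h2 : ContMDiffOn 𝓘(ℝ, E) 𝓘(ℝ, E) ∞ (coordField X q)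
      ((extChartAt 𝓘(ℝ, E) q).target ∩ (extChartAt 𝓘(ℝ, E) q).symm ⁻¹' U) :=
    h1.comp ((contMDiffOn_extChartAt_symm q).mono inter_subset_left) fun y hy ↦
      ⟨(extChartAt 𝓘(ℝ, E) q).map_target hy.1, hy.2⟩
  exact contMDiffOn_iff_contDiffOn.mp h2

end ChartCoordinates

/-! ### The global flow on a compact surface -/

section Flow

variable {S : Type*} [TopologicalSpace S] [ChartedSpace Plane S] [IsManifold (𝓡 2) ∞ S]
  {X : (q : S) → TangentSpace (𝓡 2) q}

/-- Smoothness of a vector field on a surface. -/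
def IsSmoothField (X : (q : S) → TangentSpace (𝓡 2) q) : Prop :=
  ContMDiff (𝓡 2) (𝓡 2).tangent ∞ (fun q ↦ (⟨q, X q⟩ : TangentBundle (𝓡 2) S))

theorem IsSmoothField.contDiffOn_coordField (hX : IsSmoothField X) (q : S) :
    ContDiffOn ℝ ∞ (coordField X q) (extChartAt (𝓡 2) q).target := by
  simpa using contDiffOn_coordField_of_contMDiffOn isOpen_univ hX.contMDiffOn q

theorem IsSmoothField.contDiffAt_coordField (hX : IsSmoothField X) {q : S} {y : Plane}
    (hy : y ∈ (extChartAt (𝓡 2) q).target) : ContDiffAt ℝ ∞ (coordField X q) y :=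
  (hX.contDiffOn_coordField q).contDiffAt ((isOpen_extChartAt_target q).mem_nhds hy)

theorem IsSmoothField.contMDiff_one (hX : IsSmoothField X) :
    ContMDiff (𝓡 2) (𝓡 2).tangent 1 (fun q ↦ (⟨q, X q⟩ : TangentBundle (𝓡 2) S)) :=
  ContMDiff.of_le hX (by simp)

/-- A smooth vector field has a continuous local flow. -/
theorem IsSmoothField.exists_local_flow (hX : IsSmoothField X) (p : S) :
    ∃ U ∈ 𝓝 p, ∃ ε > 0, ∃ β : S → ℝ → S,
      (∀ x ∈ U, β x 0 = x ∧ IsMIntegralCurveOn (I := 𝓡 2) (β x) X (Ioo (-ε) ε)) ∧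
      ∀ t ∈ Ioo (-ε) ε, ContinuousOn (fun x ↦ β x t) U := by
  set φ := extChartAt (𝓡 2) p with hφ
  have hp : φ p ∈ φ.target := mem_extChartAt_target p
  obtain ⟨ε, hε, a, r, L, K, hr, hPL⟩ := IsPicardLindelof.of_contDiffAt_one
    ((hX.contDiffAt_coordField hp).of_le (by simp))
  obtain ⟨α, hα, hαc⟩ := (hPL 0).exists_forall_mem_closedBall_eq_hasDerivWithinAt_continuousOn
  have hr' : (0 : ℝ) < r := hr
  have h0 : α (φ p, 0) = φ p := (hα _ (Metric.mem_closedBall_self hr'.le)).1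
  have hnhds : Metric.closedBall (φ p) r ×ˢ Icc (0 - ε) (0 + ε) ∈ 𝓝 (φ p, (0 : ℝ)) :=
    prod_mem_nhds (Metric.closedBall_mem_nhds _ hr') (Icc_mem_nhds (by linarith) (by linarith))
  have hev : ∀ᶠ z in 𝓝 (φ p, (0 : ℝ)), α z ∈ φ.target :=
    (hαc.continuousAt hnhds).eventually_mem
      ((isOpen_extChartAt_target (I := 𝓡 2) p).mem_nhds (by rw [h0]; exact hp))
  rw [nhds_prod_eq] at hev
  obtain ⟨V, hV, W, hW, hVW⟩ := eventually_prod_iff.1 hev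
  obtain ⟨δ, hδ, hδW⟩ := Metric.eventually_nhds_iff_ball.1 hW
  set η := min δ ε with hη
  have hη0 : 0 < η := lt_min hδ hε
  have hηε : η ≤ ε := min_le_right _ _
  have htgt : ∀ y, V y → ∀ t ∈ Ioo (-η) η, α (y, t) ∈ φ.target := fun y hy t ht ↦
    hVW hy (hδW t (by
      rw [Metric.mem_ball, Real.dist_eq, sub_zero, abs_lt]
      exact ⟨by linarith [ht.1, min_le_left δ ε], by linarith [ht.2, min_le_left δ ε]⟩))
  refine ⟨φ.source ∩ φ ⁻¹' ({y | V y} ∩ Metric.closedBall (φ p) r), ?_, η, hη0,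
    fun x t ↦ φ.symm (α (φ x, t)), ?_, ?_⟩
  · exact inter_mem (extChartAt_source_mem_nhds p) ((continuousAt_extChartAt p).preimage_mem_nhds
      (inter_mem hV (Metric.closedBall_mem_nhds _ hr')))
  · rintro x ⟨hxs, hxV, hxr⟩
    refine ⟨?_, isMIntegralCurveOn_chart_symm_comp (fun t ht ↦ ?_) (htgt _ hxV)⟩
    · simp only
      rw [(hα _ hxr).1, φ.left_inv hxs]
    · refine ((hα _ hxr).2 t ⟨by linarith [ht.1], by linarith [ht.2]⟩).hasDerivAt ?_
      exact Icc_mem_nhds (by linarith [ht.1]) (by linarith [ht.2])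
  · intro t ht
    have h1 : ContinuousOn (fun x ↦ α (φ x, t))
        (φ.source ∩ φ ⁻¹' ({y | V y} ∩ Metric.closedBall (φ p) r)) :=
      hαc.comp (((continuousOn_extChartAt p).mono inter_subset_left).prodMk continuousOn_const)
        fun x hx ↦ ⟨hx.2.2, by linarith [ht.1], by linarith [ht.2]⟩
    exact (continuousOn_extChartAt_symm p).comp h1 fun x hx ↦ htgt _ hx.2.1 t ht

variable [T2Space S] [CompactSpace S]

omit [T2Space S] in
-- Finitely many of the local flow neighbourhoods cover the compact surface, and the smallest of
-- their existence times serves everywhere. A uniform time is what makes trajectories global.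
theorem IsSmoothField.exists_uniform_local_flow (hX : IsSmoothField X) :
    ∃ ε > 0, ∀ p : S, ∃ U ∈ 𝓝 p, ∃ β : S → ℝ → S,
      (∀ x ∈ U, β x 0 = x ∧ IsMIntegralCurveOn (I := 𝓡 2) (β x) X (Ioo (-ε) ε)) ∧
      ∀ t ∈ Ioo (-ε) ε, ContinuousOn (fun x ↦ β x t) U := by
  choose U hU ε hε β hβ hβc using hX.exists_local_flow
  obtain ⟨s, hs⟩ := CompactSpace.elim_nhds_subcover (fun p ↦ interior (U p))
    fun p ↦ interior_mem_nhds.2 (hU p)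
  rcases s.eq_empty_or_nonempty with rfl | hne
  · refine ⟨1, one_pos, fun p ↦ ?_⟩
    have : p ∈ (⊤ : Set S) := mem_univ p
    rw [← hs] at this
    simp at this
  refine ⟨s.inf' hne ε, (Finset.lt_inf'_iff hne).2 fun p _ ↦ hε p, fun p ↦ ?_⟩
  have : p ∈ ⋃ x ∈ s, interior (U x) := by rw [hs]; trivial
  simp only [mem_iUnion] at this
  obtain ⟨x, hxs, hpx⟩ := this
  have hsub : Ioo (-s.inf' hne ε) (s.inf' hne ε) ⊆ Ioo (-ε x) (ε x) :=
    Ioo_subset_Ioo (neg_le_neg (Finset.inf'_le _ hxs)) (Finset.inf'_le _ hxs)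
  exact ⟨U x, mem_interior_iff_mem_nhds.1 hpx, β x,
    fun y hy ↦ ⟨(hβ x y hy).1, (hβ x y hy).2.mono hsub⟩, fun t ht ↦ hβc x t (hsub ht)⟩

theorem IsSmoothField.exists_isMIntegralCurve (hX : IsSmoothField X) (x : S) :
    ∃ γ : ℝ → S, γ 0 = x ∧ IsMIntegralCurve (I := 𝓡 2) γ X := by
  obtain ⟨ε, hε, h⟩ := hX.exists_uniform_local_flow
  refine exists_isMIntegralCurve_of_isMIntegralCurveOn hX.contMDiff_one hε (fun p ↦ ?_) x
  obtain ⟨U, hU, β, hβ, -⟩ := h p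
  exact ⟨β p, hβ p (mem_of_mem_nhds hU)⟩

theorem IsSmoothField.flow_spec (hX : IsSmoothField X) (x : S) :
    flow X 0 x = x ∧ IsMIntegralCurve (I := 𝓡 2) (fun t ↦ flow X t x) X :=
  Classical.epsilon_spec (hX.exists_isMIntegralCurve x)

theorem IsSmoothField.flow_zero (hX : IsSmoothField X) (x : S) : flow X 0 x = x :=
  (hX.flow_spec x).1

theorem IsSmoothField.isMIntegralCurve_flow (hX : IsSmoothField X) (x : S) :
    IsMIntegralCurve (I := 𝓡 2) (fun t ↦ flow X t x) X :=
  (hX.flow_spec x).2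

omit [CompactSpace S] in
theorem IsSmoothField.integralCurve_eq (hX : IsSmoothField X) {γ γ' : ℝ → S}
    (hγ : IsMIntegralCurve (I := 𝓡 2) γ X) (hγ' : IsMIntegralCurve (I := 𝓡 2) γ' X) {t : ℝ}
    (h : γ t = γ' t) : γ = γ' :=
  isMIntegralCurve_Ioo_eq_of_contMDiff_boundaryless hX.contMDiff_one hγ hγ' h

theorem IsSmoothField.eq_flow (hX : IsSmoothField X) {γ : ℝ → S}
    (hγ : IsMIntegralCurve (I := 𝓡 2) γ X) (t : ℝ) : γ t = flow X t (γ 0) :=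
  congrFun (hX.integralCurve_eq hγ (hX.isMIntegralCurve_flow (γ 0)) (hX.flow_zero _).symm) t

theorem IsSmoothField.flow_add (hX : IsSmoothField X) (s t : ℝ) (x : S) :
    flow X (s + t) x = flow X s (flow X t x) := by
  have h := hX.eq_flow ((hX.isMIntegralCurve_flow x).comp_add t) s
  simpa using h

/-- For short times the flow agrees with a local flow, by uniqueness of integral curves; a longer
time is cut into equal short steps. Continuity at a fixed time is enough to pull back neighbourhoods
and to pass to limits of orbits. -/
theorem IsSmoothField.continuous_flow (hX : IsSmoothField X) (t : ℝ) : Continuous (flow X t) := by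
  obtain ⟨ε, hε, h⟩ := hX.exists_uniform_local_flow
  have hsmall : ∀ s ∈ Ioo (-ε) ε, Continuous (flow X s) := by
    intro s hs
    refine continuous_iff_continuousAt.2 fun p ↦ ?_
    obtain ⟨U, hU, β, hβ, hβc⟩ := h p
    refine ((hβc s hs).continuousAt hU).congr ?_
    filter_upwards [hU] with x hx
    refine isMIntegralCurveOn_Ioo_eqOn_of_contMDiff_boundaryless (t₀ := 0) ⟨by linarith, hε⟩
      hX.contMDiff_one (hβ x hx).2 ((hX.isMIntegralCurve_flow x).isMIntegralCurveOn _) ?_ hs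
    rw [(hβ x hx).1, hX.flow_zero]
  have hiter : ∀ (n : ℕ) (s : ℝ), s ∈ Ioo (-ε) ε → Continuous (flow X (n * s)) := by
    intro n s hs
    induction n with
    | zero =>
      have : flow X ((0 : ℕ) * s) = id := by
        funext x; simp [hX.flow_zero]
      rw [this]; exact continuous_id
    | succ n ih =>
      have : flow X ((n + 1 : ℕ) * s) = flow X s ∘ flow X (n * s) := by
        funext x
        simp only [Function.comp_apply]
        rw [← hX.flow_add]
        congr 1
        push_cast
        ring
      rw [this]
      exact (hsmall s hs).comp ih
  obtain ⟨n, hn⟩ := exists_nat_gt (|t| / ε)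
  have hn0 : (0 : ℝ) < n := lt_of_le_of_lt (by positivity) hn
  have := hiter n (t / n) (by
    rw [mem_Ioo, ← abs_lt, abs_div, abs_of_pos hn0, div_lt_iff₀ hn0]
    rw [div_lt_iff₀ hε] at hn
    linarith)
  rwa [mul_div_cancel₀ _ hn0.ne'] at this

omit [T2Space S] [CompactSpace S] in
theorem IsSmoothField.neg (hX : IsSmoothField X) : IsSmoothField (fun q ↦ -X q) :=
  ContMDiff.neg_section hX

omit [IsManifold (𝓡 2) ∞ S] [T2Space S] [CompactSpace S] in
theorem IsMIntegralCurve.neg {γ : ℝ → S} (hγ : IsMIntegralCurve (I := 𝓡 2) γ X) :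
    IsMIntegralCurve (I := 𝓡 2) (fun t ↦ γ (-t)) (fun q ↦ -X q) := by
  have h := hγ.comp_mul (-1)
  have e1 : γ ∘ (· * (-1)) = fun t ↦ γ (-t) := by funext t; simp
  have e2 : ((-1 : ℝ) • X) = fun q ↦ -X q := by funext q; simp
  rwa [e1, e2] at h

end Flow

/-! ### Quadratic estimates near linear sinks and saddles -/

section PlaneLinearAlgebra

/-- The trace of an endomorphism of the plane. -/
def planeTrace (A : Plane →L[ℝ] Plane) : ℝ := LinearMap.trace ℝ Plane A.toLinearMap

theorem plane_cayley_hamilton (A : Plane →L[ℝ] Plane) (v : Plane) :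
    A (A v) = planeTrace A • A v - A.det • v := by
  let b := (EuclideanSpace.basisFun (Fin 2) ℝ).toBasis
  set m := LinearMap.toMatrix b b A.toLinearMap with hm
  have hdet : A.det = m.det := (LinearMap.det_toMatrix b A.toLinearMap).symm
  have htr : planeTrace A = m.trace := LinearMap.trace_eq_matrix_trace ℝ b A.toLinearMap
  have hmm : m * m = m.trace • m - m.det • 1 := by
    ext i j
    fin_cases i <;> fin_cases j <;>
      simp [Matrix.mul_apply, Matrix.trace_fin_two, Matrix.det_fin_two] <;> ring
  have h : A.toLinearMap ∘ₗ A.toLinearMap =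
      planeTrace A • A.toLinearMap - A.det • LinearMap.id := by
    apply (LinearMap.toMatrix b b).injective
    rw [LinearMap.toMatrix_comp b b b, map_sub, map_smul, map_smul, LinearMap.toMatrix_id, hdet,
      htr, ← hm, hmm]
  simpa using congrArg (fun L ↦ L v) h

/-- A quadratic function which decreases along the trajectories of `A`, if `A` has positive
determinant and negative trace. -/
def lyapunov (A : Plane →L[ℝ] Plane) (v : Plane) : ℝ :=
  A.det * ‖v‖ ^ 2 + ‖planeTrace A • v - A v‖ ^ 2

/-- The derivative of `lyapunov A` at `v` in the direction `w`. -/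
def lyapunovDeriv (A : Plane →L[ℝ] Plane) (v w : Plane) : ℝ :=
  A.det * (2 * ⟪v, w⟫_ℝ) + 2 * ⟪planeTrace A • v - A v, planeTrace A • w - A w⟫_ℝ

theorem hasDerivAt_lyapunov (A : Plane →L[ℝ] Plane) {u : ℝ → Plane} {u' : Plane} {t : ℝ}
    (hu : HasDerivAt u u' t) :
    HasDerivAt (fun s ↦ lyapunov A (u s)) (lyapunovDeriv A (u t) u') t := by
  have h2 : HasDerivAt (fun s ↦ planeTrace A • u s - A (u s)) (planeTrace A • u' - A u') t :=
    (hu.fun_const_smul _).fun_sub (A.hasFDerivAt.comp_hasDerivAt t hu)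
  exact (hu.norm_sq.const_mul _).add h2.norm_sq

/-- By Cayley–Hamilton, `tr A - A` is the adjugate of `A` and sends `A v` to `det A • v`. The terms
in `⟪v, A v⟫`, whose sign is unknown, then cancel; this is why `lyapunov` has its form. -/
theorem lyapunovDeriv_apply_self (A : Plane →L[ℝ] Plane) (v : Plane) :
    lyapunovDeriv A v (A v) = 2 * A.det * planeTrace A * ‖v‖ ^ 2 := by
  have h : planeTrace A • A v - A (A v) = A.det • v := by
    rw [plane_cayley_hamilton]; abel
  rw [lyapunovDeriv, h, inner_smul_right, inner_sub_left, inner_smul_left,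
    real_inner_self_eq_norm_sq, real_inner_comm v (A v)]
  simp only [conj_trivial]
  ring

theorem lyapunovDeriv_add (A : Plane →L[ℝ] Plane) (v w e : Plane) :
    lyapunovDeriv A v (w + e) = lyapunovDeriv A v w + lyapunovDeriv A v e := by
  have h : planeTrace A • (w + e) - A (w + e) =
      (planeTrace A • w - A w) + (planeTrace A • e - A e) := by
    rw [smul_add, map_add]; abel
  simp only [lyapunovDeriv, h, inner_add_right]
  ring

theorem norm_trace_smul_sub_le (A : Plane →L[ℝ] Plane) (v : Plane) :
    ‖planeTrace A • v - A v‖ ≤ (|planeTrace A| + ‖A‖) * ‖v‖ := by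
  calc _ ≤ ‖planeTrace A • v‖ + ‖A v‖ := norm_sub_le _ _
    _ ≤ |planeTrace A| * ‖v‖ + ‖A‖ * ‖v‖ := by
      rw [norm_smul, Real.norm_eq_abs]; gcongr; exact A.le_opNorm v
    _ = _ := by ring

/-- If `A` has positive determinant and negative trace, then `lyapunov A` decreases exponentially
along the trajectories of the vector fields which are close to `A`. -/
theorem exists_lyapunovDeriv_le {A : Plane →L[ℝ] Plane} (hdet : 0 < A.det)
    (htr : planeTrace A < 0) :
    ∃ ε > 0, ∃ m > 0, ∃ K > 0, ∀ v, A.det * ‖v‖ ^ 2 ≤ lyapunov A v ∧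
      lyapunov A v ≤ K * ‖v‖ ^ 2 ∧
      ∀ w, ‖w - A v‖ ≤ ε * ‖v‖ → lyapunovDeriv A v w ≤ -m * lyapunov A v := by
  set R := |planeTrace A| + ‖A‖ with hR
  have hR0 : 0 < R := by have := abs_pos.2 htr.ne; positivity
  set K := A.det + R ^ 2 with hK
  have hK0 : 0 < K := by positivity
  set d := A.det * (-planeTrace A) with hd
  have hd0 : 0 < d := mul_pos hdet (by linarith)
  have hup : ∀ v, lyapunov A v ≤ K * ‖v‖ ^ 2 := fun v ↦ by
    have h := norm_trace_smul_sub_le A v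
    have h2 : ‖planeTrace A • v - A v‖ ^ 2 ≤ (R * ‖v‖) ^ 2 := by gcongr
    rw [lyapunov, hK]; nlinarith
  -- The linear part contributes `-2 d ‖v‖ ^ 2`. An error of size `d / (2 K) ‖v‖` costs at most half
  -- of that, and the remaining `d ‖v‖ ^ 2` is at least `d / K` times `lyapunov A v`.
  refine ⟨d / (2 * K), by positivity, d / K, by positivity, K, hK0, fun v ↦ ⟨?_, hup v, ?_⟩⟩
  · rw [lyapunov]; nlinarith [sq_nonneg ‖planeTrace A • v - A v‖]
  · intro w hw
    obtain ⟨e, rfl⟩ : ∃ e, w = A v + e := ⟨w - A v, by abel⟩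
    rw [add_sub_cancel_left] at hw
    have he : lyapunovDeriv A v e ≤ 2 * K * (‖v‖ * ‖e‖) := by
      have h1 : ⟪v, e⟫_ℝ ≤ ‖v‖ * ‖e‖ := real_inner_le_norm v e
      have h2 : ⟪planeTrace A • v - A v, planeTrace A • e - A e⟫_ℝ ≤ R * ‖v‖ * (R * ‖e‖) :=
        (real_inner_le_norm _ _).trans (mul_le_mul (norm_trace_smul_sub_le A v)
          (norm_trace_smul_sub_le A e) (norm_nonneg _) (by positivity))
      rw [lyapunovDeriv, hK]; nlinarith [mul_le_mul_of_nonneg_left h1 hdet.le]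
    have he2 : 2 * K * (‖v‖ * ‖e‖) ≤ d * ‖v‖ ^ 2 := by
      calc 2 * K * (‖v‖ * ‖e‖) ≤ 2 * K * (‖v‖ * (d / (2 * K) * ‖v‖)) := by gcongr
        _ = d * ‖v‖ ^ 2 := by field_simp
    have h3 : d / K * lyapunov A v ≤ d * ‖v‖ ^ 2 := by
      calc d / K * lyapunov A v ≤ d / K * (K * ‖v‖ ^ 2) := by gcongr; exact hup v
        _ = d * ‖v‖ ^ 2 := by field_simp
    rw [lyapunovDeriv_add, lyapunovDeriv_apply_self]
    have : 2 * A.det * planeTrace A * ‖v‖ ^ 2 = -2 * (d * ‖v‖ ^ 2) := by rw [hd]; ring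
    linarith

/-- If `A` has negative determinant, then the plane splits into a contracted and an expanded line
of `A`; here `Y` and `Z` are the projections onto them. -/
theorem exists_saddle_splitting {A : Plane →L[ℝ] Plane} (hdet : A.det < 0) :
    ∃ (Y Z : Plane →L[ℝ] Plane) (a b : ℝ), 0 < a ∧ 0 < b ∧ (∀ v, Y v + Z v = v) ∧
      (∀ v, Y (A v) = -a • Y v) ∧ (∀ v, Z (A v) = b • Z v) ∧ ∃ e, e ≠ 0 ∧ Y e = e ∧ Z e = 0 := by
  set τ := planeTrace A
  set D := √(τ ^ 2 - 4 * A.det) with hD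
  have hD2 : D ^ 2 = τ ^ 2 - 4 * A.det := Real.sq_sqrt (by nlinarith [sq_nonneg τ])
  have hDτ : |τ| < D := Real.lt_sqrt_of_sq_lt (by rw [sq_abs]; linarith)
  obtain ⟨h1, h2⟩ := abs_lt.1 hDτ
  -- The eigenvalues are `-a` and `b`; a negative determinant gives `D > |τ|`, so both `a` and `b`
  -- are positive.
  set a := (D - τ) / 2 with ha
  set b := (D + τ) / 2 with hb
  have ha0 : 0 < a := by rw [ha]; linarith
  have hb0 : 0 < b := by rw [hb]; linarith
  have hτ : τ = b - a := by rw [ha, hb]; ring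
  have hδ : A.det = -(a * b) := by rw [ha, hb]; nlinarith
  have hCH : ∀ v, A (A v) = (b - a) • A v + (a * b) • v := fun v ↦ by
    rw [plane_cayley_hamilton, hδ, ← hτ, neg_smul, sub_neg_eq_add]
  have hab : a + b ≠ 0 := by positivity
  -- The spectral projections, as polynomials in `A`.
  let Y : Plane →L[ℝ] Plane := (a + b)⁻¹ • (b • ContinuousLinearMap.id ℝ Plane - A)
  let Z : Plane →L[ℝ] Plane := (a + b)⁻¹ • (a • ContinuousLinearMap.id ℝ Plane + A)
  have hY : ∀ v, Y v = (a + b)⁻¹ • (b • v - A v) := fun v ↦ rfl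
  have hZ : ∀ v, Z v = (a + b)⁻¹ • (a • v + A v) := fun v ↦ rfl
  have hYA : ∀ v, Y (A v) = -a • Y v := fun v ↦ by
    rw [hY, hY, hCH]; module
  have hsum : ∀ v, Y v + Z v = v := fun v ↦ by
    have : Y v + Z v = ((a + b)⁻¹ * (a + b)) • v := by rw [hY, hZ]; module
    rw [this, inv_mul_cancel₀ hab, one_smul]
  -- If `Y` vanished, `A` would be `b` times the identity and have positive determinant.
  have hYne : ∃ v, Y v ≠ 0 := by
    by_contra! h
    have hA : A = b • ContinuousLinearMap.id ℝ Plane := by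
      ext1 v
      have := h v
      rw [hY, smul_eq_zero_iff_right (inv_ne_zero hab), sub_eq_zero] at this
      exact this.symm
    have : A.det = b ^ 2 := by
      rw [hA, ContinuousLinearMap.det, ContinuousLinearMap.toLinearMap_smul, LinearMap.det_smul]
      simp
    nlinarith
  obtain ⟨v, hv⟩ := hYne
  have hYY : Y (Y v) = Y v := by
    have h1 : Y (Y v) = (a + b)⁻¹ • (b • Y v - Y (A v)) := by
      conv_lhs => rw [hY v]
      rw [map_smul, map_sub, map_smul]
    have h2 : Y (Y v) = ((a + b)⁻¹ * (a + b)) • Y v := by rw [h1, hYA]; module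
    rw [h2, inv_mul_cancel₀ hab, one_smul]
  refine ⟨Y, Z, a, b, ha0, hb0, hsum, hYA, fun v ↦ ?_, Y v, hv, hYY, ?_⟩
  · rw [hZ, hZ, hCH]; module
  · have := hsum (Y v)
    rw [hYY] at this
    simpa using this

/-- Close to a linear saddle, `‖Y v‖ ^ 2 - ‖Z v‖ ^ 2` is decreasing along the trajectories, and
`‖Y v‖` decreases at an exponential rate as long as it dominates `‖Z v‖`. -/
theorem exists_saddle_cone {A : Plane →L[ℝ] Plane} (hdet : A.det < 0) :
    ∃ (Y Z : Plane →L[ℝ] Plane) (ε a b : ℝ), 0 < ε ∧ 0 < a ∧ 0 < b ∧ (∀ v, Y v + Z v = v) ∧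
      (∃ e, e ≠ 0 ∧ Y e = e ∧ Z e = 0) ∧ ∀ v w, ‖w - A v‖ ≤ ε * ‖v‖ →
        2 * ⟪Y v, Y w⟫_ℝ - 2 * ⟪Z v, Z w⟫_ℝ ≤ 0 ∧
        (‖Z v‖ ≤ ‖Y v‖ → -b * ‖Y v‖ ^ 2 ≤ 2 * ⟪Y v, Y w⟫_ℝ ∧
          2 * ⟪Y v, Y w⟫_ℝ ≤ -a * ‖Y v‖ ^ 2) := by
  obtain ⟨Y, Z, a, b, ha, hb, hsum, hYA, hZA, he⟩ := exists_saddle_splitting hdet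
  set K := ‖Y‖ + ‖Z‖ + 1 with hK
  have hK0 : 0 < K := by positivity
  set m := min a b with hm
  have hm0 : 0 < m := lt_min ha hb
  -- With this `ε` both components of the error are at most `m / 4 * (‖Y v‖ + ‖Z v‖)`, hence at most
  -- `a / 2 * ‖Y v‖` in the cone. So `2 ⟪Y v, Y w⟫` differs from `-2 a ‖Y v‖ ^ 2` by at most `a ‖Y
  -- v‖ ^ 2`, whence the rates `a` and `3 a`.
  refine ⟨Y, Z, m / (4 * K), a, 3 * a, by positivity, ha, by positivity, hsum, he, ?_⟩
  intro v w hw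
  obtain ⟨e, rfl⟩ : ∃ e, w = A v + e := ⟨w - A v, by abel⟩
  rw [add_sub_cancel_left] at hw
  have hv : ‖v‖ ≤ ‖Y v‖ + ‖Z v‖ := by
    conv_lhs => rw [← hsum v]
    exact norm_add_le _ _
  have hKe : K * ‖e‖ ≤ m / 4 * (‖Y v‖ + ‖Z v‖) := by
    calc K * ‖e‖ ≤ K * (m / (4 * K) * ‖v‖) := by gcongr
      _ = m / 4 * ‖v‖ := by field_simp
      _ ≤ _ := by gcongr
  have hYe : ‖Y e‖ ≤ m / 4 * (‖Y v‖ + ‖Z v‖) := by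
    refine (Y.le_opNorm e).trans (le_trans ?_ hKe)
    gcongr; rw [hK]; linarith [norm_nonneg Z]
  have hZe : ‖Z e‖ ≤ m / 4 * (‖Y v‖ + ‖Z v‖) := by
    refine (Z.le_opNorm e).trans (le_trans ?_ hKe)
    gcongr; rw [hK]; linarith [norm_nonneg Y]
  have hYi := (abs_real_inner_le_norm (Y v) (Y e)).trans
    (mul_le_mul_of_nonneg_left hYe (norm_nonneg _))
  have hZi := (abs_real_inner_le_norm (Z v) (Z e)).trans
    (mul_le_mul_of_nonneg_left hZe (norm_nonneg _))
  rw [abs_le] at hYi hZi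
  have e1 : ⟪Y v, Y (A v + e)⟫_ℝ = -a * ‖Y v‖ ^ 2 + ⟪Y v, Y e⟫_ℝ := by
    rw [map_add, hYA, inner_add_right, inner_smul_right, real_inner_self_eq_norm_sq]
  have e2 : ⟪Z v, Z (A v + e)⟫_ℝ = b * ‖Z v‖ ^ 2 + ⟪Z v, Z e⟫_ℝ := by
    rw [map_add, hZA, inner_add_right, inner_smul_right, real_inner_self_eq_norm_sq]
  rw [e1, e2]
  have hma : m ≤ a := min_le_left _ _
  have hmb : m ≤ b := min_le_right _ _
  have hy := norm_nonneg (Y v)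
  have hz := norm_nonneg (Z v)
  generalize ‖Y v‖ = y at *
  generalize ‖Z v‖ = z at *
  generalize ⟪Y v, Y e⟫_ℝ = p at *
  generalize ⟪Z v, Z e⟫_ℝ = r at *
  have hay : m * y ^ 2 ≤ a * y ^ 2 := by gcongr
  have hbz : m * z ^ 2 ≤ b * z ^ 2 := by gcongr
  refine ⟨?_, fun hzy ↦ ?_⟩
  · have : (y + z) * (m / 4 * (y + z)) ≤ m * y ^ 2 + m * z ^ 2 := by
      have := mul_nonneg hm0.le (add_nonneg (sq_nonneg (y - z)) (add_nonneg (sq_nonneg y)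
        (sq_nonneg z)))
      linarith
    linarith
  · have : y * (m / 4 * (y + z)) ≤ m / 2 * y ^ 2 := by
      calc y * (m / 4 * (y + z)) ≤ y * (m / 4 * (y + y)) := by gcongr
        _ = m / 2 * y ^ 2 := by ring
    constructor <;> linarith

end PlaneLinearAlgebra

/-! ### Chart balls and exponential convergence to sinks -/

section LocalDynamics

/-- Grönwall: `w t * exp (-m t)` is nonincreasing. Neither `w` nor `m` has a prescribed sign, so
that applying it to `-w` yields lower bounds on growth. -/
theorem le_mul_exp_of_hasDerivAt_le {w w' : ℝ → ℝ} {m T : ℝ}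
    (hw : ∀ t ∈ Icc 0 T, HasDerivAt w (w' t) t) (h : ∀ t ∈ Icc 0 T, w' t ≤ m * w t) :
    ∀ t ∈ Icc 0 T, w t ≤ w 0 * Real.exp (m * t) := by
  intro t ht
  have hd : ∀ s ∈ Icc 0 T, HasDerivAt (fun s ↦ w s * Real.exp (-m * s))
      ((w' s - m * w s) * Real.exp (-m * s)) s := fun s hs ↦ by
    have h1 : HasDerivAt (fun s ↦ Real.exp (-m * s)) (Real.exp (-m * s) * (-m)) s := by
      simpa using ((hasDerivAt_id s).const_mul (-m)).exp
    exact ((hw s hs).fun_mul h1).congr_deriv (by ring)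
  have hanti : AntitoneOn (fun s ↦ w s * Real.exp (-m * s)) (Icc 0 T) := by
    refine antitoneOn_of_deriv_nonpos (convex_Icc 0 T)
      (fun s hs ↦ (hd s hs).continuousAt.continuousWithinAt)
      (fun s hs ↦ (hd s (interior_subset hs)).differentiableAt.differentiableWithinAt)
      fun s hs ↦ ?_
    rw [(hd s (interior_subset hs)).deriv]
    exact mul_nonpos_of_nonpos_of_nonneg (by linarith [h s (interior_subset hs)])
      (Real.exp_pos _).le
  have h2 := hanti ⟨le_rfl, ht.1.trans ht.2⟩ ht ht.1
  simp only [mul_zero, Real.exp_zero, mul_one] at h2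
  have h3 := mul_le_mul_of_nonneg_right h2 (Real.exp_pos (m * t)).le
  rwa [mul_assoc, ← Real.exp_add, neg_mul, neg_add_cancel, Real.exp_zero, mul_one] at h3

variable {S : Type*} [TopologicalSpace S] [ChartedSpace Plane S]

/-- The position of `x` relative to `q` in the chart at `q`. -/
def disp (q x : S) : Plane := extChartAt (𝓡 2) q x - extChartAt (𝓡 2) q q

/-- The open ball of radius `ρ` around `q` in the chart at `q`. -/
def chartBall (q : S) (ρ : ℝ) : Set S := {x | x ∈ (extChartAt (𝓡 2) q).source ∧ ‖disp q x‖ < ρ}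

/-- The closed ball of radius `ρ` around `q` in the chart at `q`. -/
def chartClosedBall (q : S) (ρ : ℝ) : Set S :=
  {x | x ∈ (extChartAt (𝓡 2) q).source ∧ ‖disp q x‖ ≤ ρ}

theorem disp_self (q : S) : disp q q = 0 := sub_self _

theorem continuousOn_disp (q : S) : ContinuousOn (disp q) (extChartAt (𝓡 2) q).source :=
  (continuousOn_extChartAt q).sub continuousOn_const

theorem disp_eq_zero_iff {q x : S} (hx : x ∈ (extChartAt (𝓡 2) q).source) :
    disp q x = 0 ↔ x = q := by
  rw [disp, sub_eq_zero]
  exact (extChartAt (𝓡 2) q).injOn.eq_iff hx (mem_extChartAt_source q)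

theorem isOpen_chartBall (q : S) (ρ : ℝ) : IsOpen (chartBall q ρ) :=
  (continuousOn_disp q).norm.isOpen_inter_preimage (isOpen_extChartAt_source q) isOpen_Iio

theorem chartBall_mem_nhds (q : S) {ρ : ℝ} (hρ : 0 < ρ) : chartBall q ρ ∈ 𝓝 q :=
  (isOpen_chartBall q ρ).mem_nhds ⟨mem_extChartAt_source q, by rwa [disp_self, norm_zero]⟩

theorem chartClosedBall_eq {q : S} {ρ : ℝ}
    (hρ : Metric.closedBall (extChartAt (𝓡 2) q q) ρ ⊆ (extChartAt (𝓡 2) q).target) :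
    chartClosedBall q ρ =
      (extChartAt (𝓡 2) q).symm '' Metric.closedBall (extChartAt (𝓡 2) q q) ρ := by
  ext x
  constructor
  · rintro ⟨hx, hd⟩
    exact ⟨_, by rwa [mem_closedBall_iff_norm], (extChartAt (𝓡 2) q).left_inv hx⟩
  · rintro ⟨y, hy, rfl⟩
    refine ⟨(extChartAt (𝓡 2) q).map_target (hρ hy), ?_⟩
    rw [disp, (extChartAt (𝓡 2) q).right_inv (hρ hy)]
    rwa [mem_closedBall_iff_norm] at hy

/-- It is the image of a compact ball. Closedness keeps a curve inside the domain of the chart at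
the moment when it first leaves the open ball. -/
theorem isClosed_chartClosedBall [T2Space S] {q : S} {ρ : ℝ}
    (hρ : Metric.closedBall (extChartAt (𝓡 2) q q) ρ ⊆ (extChartAt (𝓡 2) q).target) :
    IsClosed (chartClosedBall q ρ) := by
  rw [chartClosedBall_eq hρ]
  exact ((isCompact_closedBall _ _).image_of_continuousOn
    ((continuousOn_extChartAt_symm q).mono hρ)).isClosed

/-- A curve which starts in a chart ball and leaves it, does so through its boundary. -/
theorem exists_exit_time [T2Space S] {q : S} {ρ : ℝ}
    (hρ : Metric.closedBall (extChartAt (𝓡 2) q q) ρ ⊆ (extChartAt (𝓡 2) q).target)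
    {γ : ℝ → S} (hγ : Continuous γ) (h0 : γ 0 ∈ chartBall q ρ) {t₁ : ℝ} (ht₁ : 0 ≤ t₁)
    (h1 : γ t₁ ∉ chartBall q ρ) :
    ∃ τ > 0, (∀ t ∈ Icc 0 τ, γ t ∈ chartClosedBall q ρ) ∧ ‖disp q (γ τ)‖ = ρ := by
  -- The exit time is the least element of this closed set of times.
  set B := {t | 0 ≤ t ∧ γ t ∉ chartBall q ρ} with hB
  have hBc : IsClosed B :=
    isClosed_Ici.inter ((isOpen_chartBall q ρ).isClosed_compl.preimage hγ)
  have hBb : BddBelow B := ⟨0, fun t ht ↦ ht.1⟩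
  have hτB : sInf B ∈ B := hBc.csInf_mem ⟨t₁, ht₁, h1⟩ hBb
  have hτ0 : 0 < sInf B := lt_of_le_of_ne hτB.1 fun h ↦ hτB.2 (h ▸ h0)
  have hlt : ∀ t ∈ Ico 0 (sInf B), γ t ∈ chartBall q ρ := fun t ht ↦ by
    by_contra h
    exact absurd (csInf_le hBb ⟨ht.1, h⟩) (not_le.2 ht.2)
  have hle : ∀ t ∈ Icc 0 (sInf B), γ t ∈ chartClosedBall q ρ := by
    have hsub : closure (Ico 0 (sInf B)) ⊆ γ ⁻¹' chartClosedBall q ρ :=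
      closure_minimal (fun t ht ↦ ⟨(hlt t ht).1, (hlt t ht).2.le⟩)
        ((isClosed_chartClosedBall hρ).preimage hγ)
    rwa [closure_Ico hτ0.ne] at hsub
  refine ⟨sInf B, hτ0, hle, ?_⟩
  have := hle _ ⟨hτ0.le, le_rfl⟩
  exact le_antisymm this.2 (not_lt.1 fun h ↦ hτB.2 ⟨this.1, h⟩)

variable [IsManifold (𝓡 2) ∞ S] {X : (q : S) → TangentSpace (𝓡 2) q}

theorem IsMIntegralCurve.hasDerivAt_disp {γ : ℝ → S} (hγ : IsMIntegralCurve (I := 𝓡 2) γ X) {q : S}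
    {t : ℝ} (hq : γ t ∈ (extChartAt (𝓡 2) q).source) :
    HasDerivAt (fun s ↦ disp q (γ s))
      (coordField X q (extChartAt (𝓡 2) q q + disp q (γ t))) t := by
  have h := (hγ.hasDerivAt_chart hq).sub_const (extChartAt (𝓡 2) q q)
  rwa [disp, add_sub_cancel]

omit [IsManifold (𝓡 2) ∞ S] in
theorem linearization_eq (X : (q : S) → TangentSpace (𝓡 2) q) (q : S) :
    linearization X q = fderiv ℝ (coordField X q) (extChartAt (𝓡 2) q q) := rfl

omit [IsManifold (𝓡 2) ∞ S] in
theorem coordField_eq_zero {q : S} (hq : X q = 0) :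
    coordField X q (extChartAt (𝓡 2) q q) = 0 := by
  rw [coordField_extChartAt X (mem_extChartAt_source q), hq]
  exact map_zero (chartDiff (E := Plane) q q)

theorem IsSmoothField.exists_chartBall_approx (hX : IsSmoothField X) {q : S} (hq : X q = 0) {ε : ℝ}
    (hε : 0 < ε) :
    ∃ ρ > 0, Metric.closedBall (extChartAt (𝓡 2) q q) ρ ⊆ (extChartAt (𝓡 2) q).target ∧
      ∀ v : Plane, ‖v‖ ≤ ρ →
        ‖coordField X q (extChartAt (𝓡 2) q q + v) - linearization X q v‖ ≤ ε * ‖v‖ := by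
  have hd : HasFDerivAt (coordField X q) (linearization X q) (extChartAt (𝓡 2) q q) :=
    ((hX.contDiffAt_coordField (mem_extChartAt_target q)).differentiableAt (by simp)).hasFDerivAt
  rw [hasFDerivAt_iff_isLittleO_nhds_zero] at hd
  have h1 := hd.def hε
  have h2 : ∀ᶠ v in 𝓝 (0 : Plane), extChartAt (𝓡 2) q q + v ∈ (extChartAt (𝓡 2) q).target := by
    refine (continuous_const.add continuous_id).continuousAt.eventually_mem ?_
    exact (isOpen_extChartAt_target q).mem_nhds (by simp)
  obtain ⟨ρ, hρ, h⟩ := Metric.nhds_basis_closedBall.eventually_iff.1 (h1.and h2)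
  refine ⟨ρ, hρ, fun y hy ↦ ?_, fun v hv ↦ ?_⟩
  · have := (h (x := y - extChartAt (𝓡 2) q q) (by
      rw [mem_closedBall_zero_iff]; exact mem_closedBall_iff_norm.1 hy)).2
    rwa [add_sub_cancel] at this
  · have := (h (x := v) (by rwa [mem_closedBall_zero_iff])).1
    rwa [coordField_eq_zero hq, sub_zero] at this

variable [T2Space S]

/-- Trajectories which start close to a sink converge to it at an exponential rate. -/
theorem IsSmoothField.exists_sink_nhds (hX : IsSmoothField X) {q : S} (hq : X q = 0)
    (hdet : 0 < (linearization X q).det) (htr : planeTrace (linearization X q) < 0) :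
    ∃ N ∈ 𝓝 q, ∃ C > 0, ∃ c > 0, ∀ γ : ℝ → S, IsMIntegralCurve (I := 𝓡 2) γ X → γ 0 ∈ N →
      ∀ t ≥ 0, γ t ∈ (extChartAt (𝓡 2) q).source ∧
        ‖disp q (γ t)‖ ≤ C * ‖disp q (γ 0)‖ * Real.exp (-c * t) := by
  set A := linearization X q
  obtain ⟨ε, hε, m, hm, K, hK, hA⟩ := exists_lyapunovDeriv_le hdet htr
  obtain ⟨ρ, hρ, hρt, happ⟩ := hX.exists_chartBall_approx hq hε
  -- Starting within `r`, the Lyapunov function is below `K * r ^ 2 ≤ det A * ρ ^ 2`, its lower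
  -- bound on the sphere of radius `ρ`. As it decreases, that sphere is never reached.
  set r := min ρ (√(A.det / K) * ρ) with hr
  have hr0 : 0 < r := lt_min hρ (by positivity)
  refine ⟨chartBall q r, chartBall_mem_nhds q hr0, √(K / A.det), by positivity, m / 2,
    by positivity, fun γ hγ h0 ↦ ?_⟩
  have hd : ∀ t, γ t ∈ chartClosedBall q ρ → HasDerivAt (fun s ↦ lyapunov A (disp q (γ s)))
      (lyapunovDeriv A (disp q (γ t)) (coordField X q (extChartAt (𝓡 2) q q + disp q (γ t)))) t :=
    fun t ht ↦ hasDerivAt_lyapunov A (hγ.hasDerivAt_disp ht.1)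
  have hdecay : ∀ T, (∀ t ∈ Icc 0 T, γ t ∈ chartClosedBall q ρ) → ∀ t ∈ Icc 0 T,
      lyapunov A (disp q (γ t)) ≤ lyapunov A (disp q (γ 0)) * Real.exp (-m * t) :=
    fun T hT ↦ le_mul_exp_of_hasDerivAt_le (fun t ht ↦ hd t (hT t ht))
      fun t ht ↦ (hA _).2.2 _ (happ _ (hT t ht).2)
  have hlow : ∀ v, 0 ≤ lyapunov A v := fun v ↦ le_trans (by positivity) (hA v).1
  have hin : ∀ t ≥ 0, γ t ∈ chartBall q ρ := by
    by_contra! h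
    obtain ⟨t₁, ht₁, h1⟩ := h
    obtain ⟨τ, hτ, hτin, hτρ⟩ := exists_exit_time hρt hγ.continuous
      ⟨h0.1, h0.2.trans_le (min_le_left _ _)⟩ ht₁ h1
    have h2 := hdecay τ hτin τ ⟨hτ.le, le_rfl⟩
    have h3 : Real.exp (-m * τ) ≤ 1 := Real.exp_le_one_iff.2 (by nlinarith)
    have h4 : lyapunov A (disp q (γ τ)) ≤ lyapunov A (disp q (γ 0)) :=
      h2.trans (mul_le_of_le_one_right (hlow _) h3)
    have h5 := (hA (disp q (γ τ))).1
    have h6 := (hA (disp q (γ 0))).2.1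
    have h7 : ‖disp q (γ 0)‖ ^ 2 < (√(A.det / K) * ρ) ^ 2 := by
      have := h0.2.trans_le (min_le_right ρ (√(A.det / K) * ρ))
      gcongr
    rw [mul_pow, Real.sq_sqrt (by positivity)] at h7
    have h8 := mul_lt_mul_of_pos_left h7 hK
    have h9 : K * (A.det / K * ρ ^ 2) = A.det * ρ ^ 2 := by field_simp
    rw [hτρ] at h5
    linarith
  intro t ht
  refine ⟨(hin t ht).1, ?_⟩
  have h1 := hdecay t (fun s hs ↦ ⟨(hin s hs.1).1, (hin s hs.1).2.le⟩) t ⟨ht, le_rfl⟩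
  -- Comparing `lyapunov` with the squared norm from both sides and taking square roots gives the
  -- factor `√(K / det A)` and halves the rate `m`.
  have h2 : A.det * ‖disp q (γ t)‖ ^ 2 ≤ K * ‖disp q (γ 0)‖ ^ 2 * Real.exp (-m * t) :=
    ((hA _).1.trans h1).trans (mul_le_mul_of_nonneg_right (hA _).2.1 (Real.exp_pos _).le)
  refine le_of_sq_le_sq ?_ (by positivity)
  have h3 : Real.exp (-(m / 2) * t) ^ 2 = Real.exp (-m * t) := by
    rw [← Real.exp_nat_mul]; congr 1; push_cast; ring
  rw [mul_pow, mul_pow, h3, Real.sq_sqrt (by positivity)]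
  have h4 : K / A.det * ‖disp q (γ 0)‖ ^ 2 * Real.exp (-m * t) =
    (K * ‖disp q (γ 0)‖ ^ 2 * Real.exp (-m * t)) / A.det := by ring
  rw [h4, le_div_iff₀ hdet]
  linarith

end LocalDynamics

/-! ### A trajectory converging to a saddle -/

section Saddle

variable {S : Type*} [TopologicalSpace S] [ChartedSpace Plane S] [IsManifold (𝓡 2) ∞ S]
  [T2Space S] {X : (q : S) → TangentSpace (𝓡 2) q}

/-- The trajectory of a point of the contracted line of a saddle, followed backwards until it leaves
a given ball around the saddle. -/
theorem exists_backward_exit {q : S} {ρ : ℝ}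
    (hρt : Metric.closedBall (extChartAt (𝓡 2) q q) ρ ⊆ (extChartAt (𝓡 2) q).target)
    {Y Z : Plane →L[ℝ] Plane} {a b : ℝ} (ha : 0 < a) (hYZ : ∀ v, Y v + Z v = v)
    (hcone : ∀ v, ‖v‖ ≤ ρ → ∀ w, w = coordField X q (extChartAt (𝓡 2) q q + v) →
      2 * ⟪Y v, Y w⟫_ℝ - 2 * ⟪Z v, Z w⟫_ℝ ≤ 0 ∧
        (‖Z v‖ ≤ ‖Y v‖ → -b * ‖Y v‖ ^ 2 ≤ 2 * ⟪Y v, Y w⟫_ℝ ∧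
          2 * ⟪Y v, Y w⟫_ℝ ≤ -a * ‖Y v‖ ^ 2))
    {γ : ℝ → S} (hγ : IsMIntegralCurve (I := 𝓡 2) γ X) (h0 : γ 0 ∈ chartBall q ρ)
    (hne : disp q (γ 0) ≠ 0) (hY0 : Y (disp q (γ 0)) = disp q (γ 0))
    (hZ0 : Z (disp q (γ 0)) = 0) :
    ∃ τ ≥ 0, (∀ t ∈ Icc 0 τ, γ (-t) ∈ chartClosedBall q ρ ∧
        ‖Z (disp q (γ (-t)))‖ ≤ ‖Y (disp q (γ (-t)))‖) ∧
      ‖disp q (γ (-τ))‖ = ρ ∧ ρ ^ 2 ≤ 4 * ‖disp q (γ 0)‖ ^ 2 * Real.exp (b * τ) := by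
  set f : Plane → Plane := fun v ↦ coordField X q (extChartAt (𝓡 2) q q + v) with hf
  set u : ℝ → Plane := fun t ↦ disp q (γ (-t)) with hu
  have hu0 : u 0 = disp q (γ 0) := by simp [hu]
  have hd : ∀ t, γ (-t) ∈ chartClosedBall q ρ → HasDerivAt u (-f (u t)) t := fun t ht ↦ by
    have h := (hγ.hasDerivAt_disp ht.1).scomp t (hasDerivAt_neg t)
    exact h.congr_deriv (by simp [hf, hu])
  have hdL : ∀ (L : Plane →L[ℝ] Plane) (t : ℝ), γ (-t) ∈ chartClosedBall q ρ →
      HasDerivAt (fun s ↦ ‖L (u s)‖ ^ 2) (-(2 * ⟪L (u t), L (f (u t))⟫_ℝ)) t := fun L t ht ↦ by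
    have h := (L.hasFDerivAt.comp_hasDerivAt t (hd t ht)).norm_sq
    rw [map_neg, inner_neg_right] at h
    exact h.congr_deriv (by simp only [Function.comp_apply]; ring)
  -- Backwards in time `‖Z u‖ ^ 2 - ‖Y u‖ ^ 2` does not increase, and it starts nonpositive since
  -- `Z` vanishes at the initial point: the backward orbit stays in the cone.
  have hstay : ∀ T, (∀ t ∈ Icc 0 T, γ (-t) ∈ chartClosedBall q ρ) →
      ∀ t ∈ Icc 0 T, ‖Z (u t)‖ ≤ ‖Y (u t)‖ := by
    intro T hT t ht
    have h := le_mul_exp_of_hasDerivAt_le (m := 0) (T := T)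
      (w := fun s ↦ ‖Z (u s)‖ ^ 2 - ‖Y (u s)‖ ^ 2) (fun s hs ↦ (hdL Z s (hT s hs)).fun_sub
        (hdL Y s (hT s hs))) (fun s hs ↦ by
          have := (hcone (u s) (hT s hs).2 _ rfl).1
          simp only [hf]
          linarith) t ht
    simp only [zero_mul, Real.exp_zero, mul_one, hu0, hZ0, norm_zero] at h
    refine le_of_sq_le_sq ?_ (norm_nonneg _)
    nlinarith [sq_nonneg ‖Y (disp q (γ 0))‖]
  -- In the cone `‖Y u‖ ^ 2` grows backwards at least like `exp (a t)`, which is impossible in a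
  -- bounded ball.
  have hleave : ∃ t ≥ 0, γ (-t) ∉ chartBall q ρ := by
    by_contra! h
    have hT : ∀ t ≥ 0, γ (-t) ∈ chartClosedBall q ρ := fun t ht ↦ ⟨(h t ht).1, (h t ht).2.le⟩
    have hgrow : ∀ t ≥ 0, ‖disp q (γ 0)‖ ^ 2 * Real.exp (a * t) ≤ (‖Y‖ * ρ) ^ 2 := by
      intro t ht
      have h := le_mul_exp_of_hasDerivAt_le (m := a) (T := t)
        (w := fun s ↦ -‖Y (u s)‖ ^ 2) (fun s hs ↦ (hdL Y s (hT s hs.1)).fun_neg) (fun s hs ↦ by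
          have := ((hcone (u s) (hT s hs.1).2 _ rfl).2 (hstay t (fun s hs ↦ hT s hs.1) s hs)).2
          simp only [hf]
          linarith) t ⟨ht, le_rfl⟩
      simp only [hu0, hY0] at h
      have h2 : ‖Y (u t)‖ ^ 2 ≤ (‖Y‖ * ρ) ^ 2 := by
        have := (Y.le_opNorm (u t)).trans (mul_le_mul_of_nonneg_left (hT t ht).2 (norm_nonneg _))
        gcongr
      linarith
    have hpos : 0 < ‖disp q (γ 0)‖ ^ 2 := by positivity
    have htend : Tendsto (fun t ↦ ‖disp q (γ 0)‖ ^ 2 * Real.exp (a * t)) atTop atTop :=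
      (Real.tendsto_exp_atTop.comp (tendsto_id.const_mul_atTop ha)).const_mul_atTop hpos
    obtain ⟨t, ht, ht0⟩ := ((htend.eventually_gt_atTop ((‖Y‖ * ρ) ^ 2)).and
      (eventually_ge_atTop 0)).exists
    linarith [hgrow t ht0]
  obtain ⟨t₁, ht₁, h1⟩ := hleave
  obtain ⟨τ, hτ, hτin, hτρ⟩ := exists_exit_time hρt (γ := fun t ↦ γ (-t))
    (hγ.continuous.comp continuous_neg) (by simpa using h0) ht₁ h1
  refine ⟨τ, hτ.le, fun t ht ↦ ⟨hτin t ht, hstay τ hτin t ht⟩, hτρ, ?_⟩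
  -- The growth is also at most `exp (b t)`, so a starting point close to the saddle takes long to
  -- exit. In the cone `‖u τ‖ ≤ 2 ‖Y (u τ)‖`, whence the factor `4`.
  have h := le_mul_exp_of_hasDerivAt_le (m := b) (T := τ)
    (w := fun s ↦ ‖Y (u s)‖ ^ 2) (fun s hs ↦ hdL Y s (hτin s hs)) (fun s hs ↦ by
      have := ((hcone (u s) (hτin s hs).2 _ rfl).2 (hstay τ hτin s hs)).1
      simp only [hf]
      linarith) τ ⟨hτ.le, le_rfl⟩
  simp only [hu0, hY0] at h
  have h2 : ρ ≤ 2 * ‖Y (u τ)‖ := by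
    have := norm_add_le (Y (u τ)) (Z (u τ))
    rw [hYZ] at this
    linarith [hstay τ hτin τ ⟨hτ.le, le_rfl⟩]
  have hρ0 : 0 ≤ ρ := hτρ ▸ norm_nonneg _
  nlinarith

variable [CompactSpace S]

/-- Some nonconstant trajectory converges to the saddle `q`, at an exponential rate. -/
theorem IsSmoothField.exists_trajectory_to_saddle (hX : IsSmoothField X) {q : S}
    (hq : X q = 0) (hdet : (linearization X q).det < 0) :
    ∃ γ : ℝ → S, IsMIntegralCurve (I := 𝓡 2) γ X ∧ γ 0 ≠ q ∧ ∃ C > 0, ∃ c > 0, ∀ t ≥ 0,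
      γ t ∈ (extChartAt (𝓡 2) q).source ∧ ‖disp q (γ t)‖ ≤ C * Real.exp (-c * t) := by
  obtain ⟨Y, Z, ε, a, b, hε, ha, hb, hYZ, ⟨e, he, hYe, hZe⟩, hA⟩ := exists_saddle_cone hdet
  obtain ⟨ρ, hρ, hρt, happ⟩ := hX.exists_chartBall_approx hq hε
  have hcone : ∀ v, ‖v‖ ≤ ρ → ∀ w, w = coordField X q (extChartAt (𝓡 2) q q + v) →
      2 * ⟪Y v, Y w⟫_ℝ - 2 * ⟪Z v, Z w⟫_ℝ ≤ 0 ∧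
        (‖Z v‖ ≤ ‖Y v‖ → -b * ‖Y v‖ ^ 2 ≤ 2 * ⟪Y v, Y w⟫_ℝ ∧
          2 * ⟪Y v, Y w⟫_ℝ ≤ -a * ‖Y v‖ ^ 2) := by
    rintro v hv w rfl
    exact hA v _ (happ v hv)
  set φ := extChartAt (𝓡 2) q with hφ
  -- Points of the contracted line at distance `ρ / (n + 2)` from the saddle are followed backwards
  -- to the sphere of radius `ρ`. From the exit point `x`, the forward orbit stays in the cone
  -- during a time `τ` that grows with `n`.
  have hexit : ∀ n : ℕ, ∃ x : S, ∃ τ : ℝ, x ∈ chartClosedBall q ρ ∧ ‖disp q x‖ = ρ ∧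
      (∀ t ∈ Icc 0 τ, flow X t x ∈ chartClosedBall q ρ ∧
        ‖Z (disp q (flow X t x))‖ ≤ ‖Y (disp q (flow X t x))‖) ∧
      ((n : ℝ) + 2) ^ 2 ≤ 4 * Real.exp (b * τ) := by
    intro n
    set v : Plane := (ρ / ((n + 2) * ‖e‖)) • e with hv
    have he0 : 0 < ‖e‖ := norm_pos_iff.2 he
    have hnv : ‖v‖ = ρ / (n + 2) := by
      rw [hv, norm_smul, Real.norm_of_nonneg (by positivity)]
      field_simp
    have hvρ : ‖v‖ < ρ := by
      rw [hnv, div_lt_iff₀ (by positivity)]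
      nlinarith [(Nat.cast_nonneg n : (0 : ℝ) ≤ n)]
    have hmem : φ q + v ∈ φ.target :=
      hρt (by rw [mem_closedBall_iff_norm, add_sub_cancel_left]; exact hvρ.le)
    set p := φ.symm (φ q + v) with hp
    have hps : p ∈ φ.source := φ.map_target hmem
    have hdp : disp q p = v := by
      rw [disp, ← hφ, hp, φ.right_inv hmem, add_sub_cancel_left]
    have hdf : disp q (flow X 0 p) = v := by rw [hX.flow_zero, hdp]
    have hv0 : v ≠ 0 := smul_ne_zero (by positivity) he
    obtain ⟨τ, hτ, hin, hsph, hexp⟩ := exists_backward_exit hρt ha hYZ hcone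
      (hX.isMIntegralCurve_flow p) (by rw [hX.flow_zero]; exact ⟨hps, hdp ▸ hvρ⟩)
      (by rwa [hdf]) (by rw [hdf, hv, map_smul, hYe]) (by rw [hdf, hv, map_smul, hZe, smul_zero])
    refine ⟨flow X (-τ) p, τ, (hin τ ⟨hτ, le_rfl⟩).1, hsph, fun t ht ↦ ?_, ?_⟩
    · have := hin (τ - t) ⟨by linarith [ht.2], by linarith [ht.1]⟩
      rwa [show -(τ - t) = t + -τ by ring, hX.flow_add] at this
    · rw [hdf, hnv, div_pow] at hexp
      have h1 : 4 * (ρ ^ 2 / ((n : ℝ) + 2) ^ 2) * Real.exp (b * τ) =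
        ρ ^ 2 * (4 * Real.exp (b * τ)) / (n + 2) ^ 2 := by ring
      rw [h1, le_div_iff₀ (by positivity)] at hexp
      exact le_of_mul_le_mul_left hexp (by positivity)
  choose x τ hxin hxρ hxflow hτ using hexit
  have hτtop : Tendsto τ atTop atTop := by
    have h1 : Tendsto (fun n : ℕ ↦ 4 * Real.exp (b * τ n)) atTop atTop := by
      refine tendsto_atTop_mono (fun n ↦ ?_) tendsto_natCast_atTop_atTop
      have := hτ n
      nlinarith [(Nat.cast_nonneg n : (0 : ℝ) ≤ n)]
    have h2 : Tendsto (fun n : ℕ ↦ Real.exp (b * τ n)) atTop atTop :=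
      (tendsto_const_mul_atTop_of_pos (by norm_num)).1 h1
    exact (tendsto_const_mul_atTop_of_pos hb).1 (Real.tendsto_exp_comp_atTop.1 h2)
  -- By compactness of `S` the exit points converge along an ultrafilter finer than `atTop`; no
  -- subsequence is needed.
  let F : Ultrafilter ℕ := Ultrafilter.of atTop
  have hF : (F : Filter ℕ) ≤ atTop := Ultrafilter.of_le atTop
  have hlim : Tendsto x F (𝓝 (F.map x).lim) := (F.map x).le_nhds_lim
  set y := (F.map x).lim
  have hclosed : IsClosed {z | z ∈ chartClosedBall q ρ ∧ ‖Z (disp q z)‖ ≤ ‖Y (disp q z)‖} := by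
    have hc : ContinuousOn (fun z ↦ ‖Z (disp q z)‖ - ‖Y (disp q z)‖) (chartClosedBall q ρ) := by
      have hc := (continuousOn_disp q).mono (fun z (hz : z ∈ chartClosedBall q ρ) ↦ hz.1)
      exact (Z.continuous.comp_continuousOn hc).norm.sub (Y.continuous.comp_continuousOn hc).norm
    have := hc.preimage_isClosed_of_isClosed (isClosed_chartClosedBall hρt) isClosed_Iic (t := Iic 0)
    convert this using 1
    ext z
    simp
  have hsphere : IsClosed {z | z ∈ chartClosedBall q ρ ∧ ‖disp q z‖ = ρ} := by
    have hc := ((continuousOn_disp q).mono (fun z (hz : z ∈ chartClosedBall q ρ) ↦ hz.1)).norm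
    exact hc.preimage_isClosed_of_isClosed (isClosed_chartClosedBall hρt) isClosed_singleton
      (t := {ρ})
  have hy : ‖disp q y‖ = ρ :=
    (hsphere.mem_of_tendsto hlim (Eventually.of_forall fun n ↦ ⟨hxin n, hxρ n⟩)).2
  -- For fixed `t`, the orbits of the `x n` are in the closed cone at time `t` as soon as `τ n ≥ t`;
  -- the time-`t` flow is continuous, so the orbit of the limit `y` stays in the cone forever.
  have hyflow : ∀ t ≥ 0, flow X t y ∈ chartClosedBall q ρ ∧
      ‖Z (disp q (flow X t y))‖ ≤ ‖Y (disp q (flow X t y))‖ := fun t ht ↦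
    hclosed.mem_of_tendsto (((hX.continuous_flow t).tendsto y).comp hlim)
      (((hτtop.eventually_ge_atTop t).filter_mono hF).mono fun n hn ↦ hxflow n t ⟨ht, hn⟩)
  refine ⟨fun t ↦ flow X t y, hX.isMIntegralCurve_flow y, fun h ↦ ?_, 2 * ‖Y (disp q y)‖ + 1,
    by positivity, a / 2, by positivity, fun t ht ↦ ⟨(hyflow t ht).1.1, ?_⟩⟩
  · simp only [hX.flow_zero] at h
    rw [h, disp_self, norm_zero] at hy
    exact hρ.ne hy
  -- In the cone the `Y` component decays exponentially and controls the whole displacement.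
  · have hdY : ∀ s ∈ Icc 0 t, HasDerivAt (fun s ↦ ‖Y (disp q (flow X s y))‖ ^ 2)
        (2 * ⟪Y (disp q (flow X s y)), Y (coordField X q (φ q + disp q (flow X s y)))⟫_ℝ) s :=
      fun s hs ↦ (Y.hasFDerivAt.comp_hasDerivAt s
        ((hX.isMIntegralCurve_flow y).hasDerivAt_disp (hyflow s hs.1).1.1)).norm_sq
    have h := le_mul_exp_of_hasDerivAt_le (m := -a) hdY (fun s hs ↦
      ((hcone _ (hyflow s hs.1).1.2 _ rfl).2 (hyflow s hs.1).2).2) t ⟨ht, le_rfl⟩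
    simp only [hX.flow_zero] at h
    have h3 : Real.exp (-a * t) = Real.exp (-(a / 2) * t) ^ 2 := by
      rw [← Real.exp_nat_mul]; congr 1; push_cast; ring
    rw [h3, ← mul_pow] at h
    have h4 := le_of_sq_le_sq h (by positivity)
    have h5 := norm_add_le (Y (disp q (flow X t y))) (Z (disp q (flow X t y)))
    rw [hYZ] at h5
    have h6 := (hyflow t ht).2
    have h7 := Real.exp_pos (-(a / 2) * t)
    linarith

end Saddle

/-! ### 1-forms and Lie brackets in charts -/

section FormsInCharts

variable {E : Type*} [NormedAddCommGroup E] [NormedSpace ℝ E]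
  {N : Type*} [TopologicalSpace N] [ChartedSpace E N]

/-- The value at `x` of a 1-form, as a functional on the model space. -/
def formAt (α : (x : N) → TangentSpace 𝓘(ℝ, E) x →L[ℝ] Trivial N ℝ x) (x : N) : E →L[ℝ] ℝ := α x

/-- The 1-form `α` read in the chart at `p`. -/
def coordForm (α : (x : N) → TangentSpace 𝓘(ℝ, E) x →L[ℝ] Trivial N ℝ x) (p : N) (y : E) :
    E →L[ℝ] ℝ :=
  (formAt α ((extChartAt 𝓘(ℝ, E) p).symm y)).comp (chartSymmDiff p y)

variable [IsManifold 𝓘(ℝ, E) ∞ N]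

theorem inverse_chartSymmDiff {q : N} {y : E} (hy : y ∈ (extChartAt 𝓘(ℝ, E) q).target) :
    (chartSymmDiff q y).inverse = chartDiff q ((extChartAt 𝓘(ℝ, E) q).symm y) := by
  have h := chartSymmDiff_chartDiff ((extChartAt 𝓘(ℝ, E) q).map_target hy)
  rw [(extChartAt 𝓘(ℝ, E) q).right_inv hy] at h
  exact ContinuousLinearMap.inverse_eq (ContinuousLinearMap.ext h)
    (ContinuousLinearMap.ext (chartDiff_chartSymmDiff hy))

theorem inverse_chartDiff {q x : N} (hx : x ∈ (extChartAt 𝓘(ℝ, E) q).source) :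
    (chartDiff q x : E →L[ℝ] E).inverse = chartSymmDiff q (extChartAt 𝓘(ℝ, E) q x) := by
  have h := chartDiff_chartSymmDiff ((extChartAt 𝓘(ℝ, E) q).map_source hx)
  rw [(extChartAt 𝓘(ℝ, E) q).left_inv hx] at h
  exact ContinuousLinearMap.inverse_eq (ContinuousLinearMap.ext h)
    (ContinuousLinearMap.ext (chartSymmDiff_chartDiff hx))

/-- The bracket on a manifold is the flat bracket of the fields pulled back through the chart. Near
the point these are the coordinate fields, and a bracket depends only on germs. -/
theorem mlieBracket_eq_chartSymmDiff (V W : (x : N) → TangentSpace 𝓘(ℝ, E) x) (p : N) :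
    VectorField.mlieBracket 𝓘(ℝ, E) V W p = chartSymmDiff p (extChartAt 𝓘(ℝ, E) p p)
      (VectorField.lieBracket ℝ (coordField V p) (coordField W p) (extChartAt 𝓘(ℝ, E) p p)) := by
  have hpull : ∀ V : (x : N) → TangentSpace 𝓘(ℝ, E) x,
      (VectorField.mpullbackWithin 𝓘(ℝ, E) 𝓘(ℝ, E) (extChartAt 𝓘(ℝ, E) p).symm V
        (range 𝓘(ℝ, E)) : E → E) =ᶠ[𝓝 (extChartAt 𝓘(ℝ, E) p p)] coordField V p := fun V ↦ by
    filter_upwards [extChartAt_target_mem_nhds (I := 𝓘(ℝ, E)) p] with y hy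
    rw [VectorField.mpullbackWithin_apply, ModelWithCorners.range_eq_univ, mfderivWithin_univ]
    exact DFunLike.congr_fun (inverse_chartSymmDiff hy) (V _)
  rw [← VectorField.mlieBracketWithin_univ, VectorField.mlieBracketWithin_apply]
  have h1 : VectorField.lieBracketWithin ℝ
      (VectorField.mpullbackWithin 𝓘(ℝ, E) 𝓘(ℝ, E) (extChartAt 𝓘(ℝ, E) p).symm V
        (range 𝓘(ℝ, E)) : E → E)
      (VectorField.mpullbackWithin 𝓘(ℝ, E) 𝓘(ℝ, E) (extChartAt 𝓘(ℝ, E) p).symm W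
        (range 𝓘(ℝ, E)) : E → E)
      ((extChartAt 𝓘(ℝ, E) p).symm ⁻¹' univ ∩ range 𝓘(ℝ, E)) (extChartAt 𝓘(ℝ, E) p p) =
      VectorField.lieBracket ℝ (coordField V p) (coordField W p) (extChartAt 𝓘(ℝ, E) p p) := by
    have huniv : ∀ V W : E → E, VectorField.lieBracketWithin ℝ V W
        ((extChartAt 𝓘(ℝ, E) p).symm ⁻¹' univ ∩ range 𝓘(ℝ, E)) (extChartAt 𝓘(ℝ, E) p p) =
        VectorField.lieBracket ℝ V W (extChartAt 𝓘(ℝ, E) p p) := fun V W ↦ by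
      rw [preimage_univ, ModelWithCorners.range_eq_univ, univ_inter,
        VectorField.lieBracketWithin_univ]
    exact (huniv _ _).trans ((hpull V).lieBracket_vectorField_eq (hpull W))
  have h2 : ∀ z : E, (chartDiff p p : E →L[ℝ] E).inverse z =
      chartSymmDiff p (extChartAt 𝓘(ℝ, E) p p) z := fun z ↦ by
    rw [inverse_chartDiff (mem_extChartAt_source p)]
  exact (congrArg (fun z : E ↦ (chartDiff p p : E →L[ℝ] E).inverse z) h1).trans (h2 _)

theorem differentiableAt_coordForm
    {α : (x : N) → TangentSpace 𝓘(ℝ, E) x →L[ℝ] Trivial N ℝ x}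
    (hα : ContMDiff 𝓘(ℝ, E) (𝓘(ℝ, E).prod 𝓘(ℝ, E →L[ℝ] ℝ)) ∞
      (fun x ↦ TotalSpace.mk' (E →L[ℝ] ℝ)
        (E := fun x ↦ TangentSpace 𝓘(ℝ, E) x →L[ℝ] Trivial N ℝ x) x (α x))) (p : N) :
    DifferentiableAt ℝ (coordForm α p) (extChartAt 𝓘(ℝ, E) p p) := by
  have h1 := ((contMDiffAt_hom_bundle _).1 (hα p)).2
  have h2 : ContMDiffAt 𝓘(ℝ, E) 𝓘(ℝ, E →L[ℝ] ℝ) ∞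
      (fun x ↦ coordForm α p (extChartAt 𝓘(ℝ, E) p x)) p := by
    refine h1.congr_of_eventuallyEq ?_
    filter_upwards [extChartAt_source_mem_nhds (I := 𝓘(ℝ, E)) p] with x hx
    have hx' : x ∈ (chartAt E p).source := by simpa using hx
    have h3 := TangentBundle.symmL_trivializationAt (I := 𝓘(ℝ, E)) hx'
    rw [ModelWithCorners.range_eq_univ, mfderivWithin_univ] at h3
    ext v
    have h4 := congrArg (fun L ↦ L v) h3
    unfold coordForm
    rw [(extChartAt 𝓘(ℝ, E) p).left_inv hx]
    exact (congrArg (fun z ↦ α x z) h4.symm).trans (DFunLike.congr_fun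
      (Trivial.continuousLinearMapAt_trivialization ℝ N ℝ x) (α x _)).symm
  have h3 : ContMDiffAt 𝓘(ℝ, E) 𝓘(ℝ, E →L[ℝ] ℝ) ∞
      (fun y ↦ coordForm α p (extChartAt 𝓘(ℝ, E) p ((extChartAt 𝓘(ℝ, E) p).symm y)))
      (extChartAt 𝓘(ℝ, E) p p) := by
    refine ContMDiffAt.comp (I' := 𝓘(ℝ, E)) (g := fun x ↦ coordForm α p (extChartAt 𝓘(ℝ, E) p x)) _
      ?_ ((contMDiffOn_extChartAt_symm p).contMDiffAt (extChartAt_target_mem_nhds p))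
    rwa [extChartAt_to_inv]
  have h4 : ContMDiffAt 𝓘(ℝ, E) 𝓘(ℝ, E →L[ℝ] ℝ) ∞ (coordForm α p) (extChartAt 𝓘(ℝ, E) p p) := by
    refine h3.congr_of_eventuallyEq ?_
    filter_upwards [extChartAt_target_mem_nhds (I := 𝓘(ℝ, E)) p] with y hy
    rw [(extChartAt 𝓘(ℝ, E) p).right_inv hy]
  exact (contMDiffAt_iff_contDiffAt.1 h4).differentiableAt (by simp)

theorem coordForm_apply_coordField
    (α : (x : N) → TangentSpace 𝓘(ℝ, E) x →L[ℝ] Trivial N ℝ x)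
    (V : (x : N) → TangentSpace 𝓘(ℝ, E) x) {p : N} {y : E}
    (hy : y ∈ (extChartAt 𝓘(ℝ, E) p).target) :
    coordForm α p y (coordField V p y) = α ((extChartAt 𝓘(ℝ, E) p).symm y) (V _) := by
  have h := chartSymmDiff_chartDiff ((extChartAt 𝓘(ℝ, E) p).map_target hy)
    (V ((extChartAt 𝓘(ℝ, E) p).symm y))
  rw [(extChartAt 𝓘(ℝ, E) p).right_inv hy] at h
  exact congrArg (fun v ↦ formAt α _ v) h

end FormsInCharts

/-! ### Planar 1-forms that annihilate a vector field -/

section PlaneForms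

/-- If a 1-form and a vector field on the plane vanish at a point, the form annihilates the field,
and the differential of the field is invertible and has trace zero, then the form is closed at the
point. -/
theorem fderiv_symm_of_annihilates {θ : Plane → Plane →L[ℝ] ℝ} {Ω : Plane →L[ℝ] Plane →L[ℝ] ℝ}
    {F : Plane → Plane} {A : Plane →L[ℝ] Plane} {c : Plane} (hθ : HasFDerivAt θ Ω c)
    (hF : HasFDerivAt F A c) (hθ0 : θ c = 0) (hF0 : F c = 0) (h : ∀ᶠ y in 𝓝 c, θ y (F y) = 0)
    (hdet : A.det ≠ 0) (htr : planeTrace A = 0) (v w : Plane) : Ω v w = Ω w v := by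
  -- On the line `c + s • v` both `θ` and `F` vanish to first order; dividing `θ (F) = 0` by `s ^ 2`
  -- and letting `s → 0` gives the claim.
  have key : ∀ v, Ω v (A v) = 0 := by
    intro v
    have hline : HasDerivAt (fun s : ℝ ↦ c + s • v) v 0 := by
      simpa using ((hasDerivAt_id (0 : ℝ)).smul_const v).const_add c
    have hc : c + (0 : ℝ) • v = c := by simp
    have h1 : HasDerivAt (fun s : ℝ ↦ θ (c + s • v)) (Ω v) 0 := by
      rw [← hc] at hθ
      exact hθ.comp_hasDerivAt (0 : ℝ) hline
    have h2 : HasDerivAt (fun s : ℝ ↦ F (c + s • v)) (A v) 0 := by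
      rw [← hc] at hF
      exact hF.comp_hasDerivAt (0 : ℝ) hline
    have t1 := hasDerivAt_iff_tendsto_slope_zero.1 h1
    have t2 := hasDerivAt_iff_tendsto_slope_zero.1 h2
    simp only [zero_add, zero_smul, add_zero, hθ0, hF0, sub_zero] at t1 t2
    have t3 := (isBoundedBilinearMap_apply.continuous.tendsto (Ω v, A v)).comp (t1.prodMk_nhds t2)
    refine tendsto_nhds_unique t3 (tendsto_const_nhds.congr' ?_)
    have h3 : ∀ᶠ s in 𝓝 (0 : ℝ), θ (c + s • v) (F (c + s • v)) = 0 := by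
      rw [← hc] at h
      exact hline.continuousAt.eventually h
    filter_upwards [mem_nhdsWithin_of_mem_nhds h3] with s hs
    have hs' : θ (c + s • v) (F (c + s • v)) = 0 := hs
    simp [hs']
  have pol : ∀ v w, Ω v (A w) + Ω w (A v) = 0 := by
    intro v w
    have := key (v + w)
    simp only [map_add, add_apply, key] at this
    linarith
  let b := (EuclideanSpace.basisFun (Fin 2) ℝ).toBasis
  set m := LinearMap.toMatrix b b A.toLinearMap with hm
  have hdet' : A.det = m.det := (LinearMap.det_toMatrix b A.toLinearMap).symm
  have htr' : planeTrace A = m.trace := LinearMap.trace_eq_matrix_trace ℝ b A.toLinearMap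
  rw [Matrix.det_fin_two] at hdet'
  rw [Matrix.trace_fin_two, htr] at htr'
  have hAb : ∀ j, A (b j) = m 0 j • b 0 + m 1 j • b 1 := by
    intro j
    have := (b.sum_repr (A (b j))).symm
    rw [Fin.sum_univ_two] at this
    rw [this, hm, LinearMap.toMatrix_apply, LinearMap.toMatrix_apply]
    rfl
  have e1 := key (b 0)
  have e2 := key (b 1)
  have e3 := pol (b 0) (b 1)
  simp only [hAb, map_add, map_smul, smul_eq_mul] at e1 e2 e3
  -- The quadratic form `Ω v (A v)` being zero amounts to three linear equations on the entries of
  -- `Ω`. When `m 1 1 = -m 0 0`, they combine to `det A` times the antisymmetric part of `Ω`.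
  have hsymm : Ω (b 0) (b 1) = Ω (b 1) (b 0) := by
    rw [← sub_eq_zero]
    refine (mul_eq_zero.1 ?_).resolve_left hdet
    rw [hdet']
    have e4 : m 1 1 = -m 0 0 := by linarith
    rw [e4] at e2 e3 ⊢
    linear_combination m 0 0 * e3 - m 0 1 * e1 + m 1 0 * e2
  have hv := (b.sum_repr v).symm
  have hw := (b.sum_repr w).symm
  rw [Fin.sum_univ_two] at hv hw
  rw [hv, hw]
  simp only [map_add, map_smul, add_apply, smul_apply,
    smul_eq_mul, hsymm]
  ring

end PlaneForms

/-! ### The contact condition at the zeros of the characteristic field -/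

section CharacteristicField

variable {M : Type*} [TopologicalSpace M] [ChartedSpace Space M]
  {S : Type*} [TopologicalSpace S] [ChartedSpace Plane S]

/-- The differential of a map from a surface, between the model spaces. -/
def mapDiff (ι : S → M) (x : S) : Plane →L[ℝ] Space := mfderiv (𝓡 2) (𝓡 3) ι x

/-- The map `ι` read in the charts at `q` and at `ι q`. -/
def coordMap (ι : S → M) (q : S) (y : Plane) : Space :=
  extChartAt (𝓡 3) (ι q) (ι ((extChartAt (𝓡 2) q).symm y))

theorem coordMap_extChartAt (ι : S → M) (q : S) :
    coordMap ι q (extChartAt (𝓡 2) q q) = extChartAt (𝓡 3) (ι q) (ι q) := by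
  rw [coordMap, extChartAt_to_inv]

variable [IsManifold (𝓡 3) ∞ M] [IsManifold (𝓡 2) ∞ S] {ι : S → M}

omit [IsManifold (𝓡 3) ∞ M] in
theorem contDiffAt_coordMap (hι : ContMDiff (𝓡 2) (𝓡 3) ∞ ι) (q : S) :
    ContDiffAt ℝ ∞ (coordMap ι q) (extChartAt (𝓡 2) q q) := by
  refine contMDiffAt_iff_contDiffAt.1 ?_
  refine ContMDiffAt.comp (I' := 𝓡 2) (g := fun x ↦ extChartAt (𝓡 3) (ι q) (ι x)) _ ?_
    ((contMDiffOn_extChartAt_symm q).contMDiffAt (extChartAt_target_mem_nhds q))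
  rw [extChartAt_to_inv]
  exact ContMDiffAt.comp (I' := 𝓡 3) q contMDiffAt_extChartAt hι.contMDiffAt

theorem eventually_hasFDerivAt_coordMap (hι : ContMDiff (𝓡 2) (𝓡 3) ∞ ι) (q : S) :
    ∀ᶠ y in 𝓝 (extChartAt (𝓡 2) q q), y ∈ (extChartAt (𝓡 2) q).target ∧
      ι ((extChartAt (𝓡 2) q).symm y) ∈ (extChartAt (𝓡 3) (ι q)).source ∧
      HasFDerivAt (coordMap ι q)
        ((chartDiff (ι q) (ι ((extChartAt (𝓡 2) q).symm y))).comp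
          ((mapDiff ι ((extChartAt (𝓡 2) q).symm y)).comp (chartSymmDiff q y))) y := by
  have h1 : ∀ᶠ y in 𝓝 (extChartAt (𝓡 2) q q),
      ι ((extChartAt (𝓡 2) q).symm y) ∈ (extChartAt (𝓡 3) (ι q)).source := by
    refine (hι.continuous.continuousAt.comp (continuousAt_extChartAt_symm q)).eventually_mem ?_
    rw [Function.comp_apply, extChartAt_to_inv]
    exact extChartAt_source_mem_nhds (ι q)
  filter_upwards [extChartAt_target_mem_nhds (I := 𝓡 2) q, h1] with y hy hιy
  refine ⟨hy, hιy, ?_⟩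
  have d1 := (mdifferentiableAt_chart_symm hy).hasMFDerivAt
  have d2 := (hι.mdifferentiable (by simp) ((extChartAt (𝓡 2) q).symm y)).hasMFDerivAt
  have d3 := (mdifferentiableAt_chart hιy).hasMFDerivAt
  exact hasMFDerivAt_iff_hasFDerivAt.1 (d3.comp y (d2.comp y d1))

variable {𝓜 : ContactSubRiemannian M} {X : (q : S) → TangentSpace (𝓡 2) q}

omit [IsManifold (𝓡 2) ∞ S] in
theorem ContactSubRiemannian.mem_traceAt_iff (𝓜 : ContactSubRiemannian M) (ι : S → M) (q : S)
    (v : TangentSpace (𝓡 2) q) :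
    v ∈ 𝓜.traceAt ι q ↔ mfderiv (𝓡 2) (𝓡 3) ι q v ∈ 𝓜.D (ι q) := Iff.rfl

theorem ContactSubRiemannian.IsCharacteristicVectorField.mfderiv_mem
    (hX : 𝓜.IsCharacteristicVectorField ι X) (q : S) :
    mfderiv (𝓡 2) (𝓡 3) ι q (X q) ∈ 𝓜.D (ι q) := by
  rw [← 𝓜.mem_traceAt_iff]
  by_cases hq : q ∈ 𝓜.characteristicSet ι
  · rw [hX.eq_zero q hq]
    exact zero_mem _
  · rw [hX.span_eq q hq]
    exact Submodule.mem_span_singleton_self _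

/-- The form `α ∘ dι` is a functional on a plane, so its kernel `T_qS ∩ D_q` is never zero. Off the
characteristic set this kernel is spanned by `X q`, which therefore does not vanish. -/
theorem ContactSubRiemannian.IsCharacteristicVectorField.mem_characteristicSet
    (hX : 𝓜.IsCharacteristicVectorField ι X) (hco : 𝓜.CoOrientable) {q : S} (hq : X q = 0) :
    q ∈ 𝓜.characteristicSet ι := by
  obtain ⟨α, -, hα⟩ := hco
  by_contra h
  have hspan := hX.span_eq q h
  rw [hq] at hspan
  have hker : LinearMap.ker ((formAt α (ι q)).comp (mapDiff ι q)).toLinearMap ≠ ⊥ :=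
    LinearMap.ker_ne_bot_of_finrank_lt (by simp)
  obtain ⟨v, hv, hv0⟩ := Submodule.exists_mem_ne_zero_of_ne_bot hker
  have hmem : (v : TangentSpace (𝓡 2) q) ∈ 𝓜.traceAt ι q := (hα _ _).2 hv
  rw [hspan] at hmem
  obtain ⟨c, hc⟩ := (Submodule.mem_span_singleton (R := ℝ) (M := TangentSpace (𝓡 2) q)).1 hmem
  exact hv0 (hc.symm.trans (smul_zero (A := TangentSpace (𝓡 2) q) c))

theorem exists_notMem_span_pair (v₁ v₂ : Space) :
    ∃ v : Space, v ∉ Submodule.span ℝ ({v₁, v₂} : Set Space) := by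
  classical
  by_contra! h
  have h1 := finrank_span_finset_le_card (R := ℝ) ({v₁, v₂} : Finset Space)
  rw [Set.finrank, Finset.coe_pair, Submodule.eq_top_iff'.2 h, finrank_top] at h1
  have h3 : Module.finrank ℝ Space = 3 := by simp
  have h4 := Finset.card_le_two (a := v₁) (b := v₂)
  omega

theorem ContactSubRiemannian.exists_notMem (𝓜 : ContactSubRiemannian M) (p : M) :
    ∃ v : Space, (v : TangentSpace (𝓡 3) p) ∉ 𝓜.D p := by
  by_contra! h
  obtain ⟨U, -, hpU, F₁, F₂, -, -, hF⟩ := 𝓜.rank_two p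
  have hspan := (hF p hpU).2
  obtain ⟨v, hv⟩ := exists_notMem_span_pair (F₁ p : TangentSpace (𝓡 3) p)
    (F₂ p : TangentSpace (𝓡 3) p)
  have hv' : (⟨v, h v⟩ : 𝓜.D p) ∈ Submodule.span ℝ {F₁ p, F₂ p} := by rw [hspan]; trivial
  obtain ⟨a, b, hab⟩ := Submodule.mem_span_pair.1 hv'
  exact hv (Submodule.mem_span_pair.2 ⟨a, b, congrArg Subtype.val hab⟩)

/-- The linearization of a characteristic vector field at a nondegenerate critical point has nonzero
trace. -/
theorem ContactSubRiemannian.IsCharacteristicVectorField.planeTrace_ne_zero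
    (hX : 𝓜.IsCharacteristicVectorField ι X) (hco : 𝓜.CoOrientable)
    (hι : ContMDiff (𝓡 2) (𝓡 3) ∞ ι) {q : S} (hq : X q = 0) (hdet : (linearization X q).det ≠ 0) :
    planeTrace (linearization X q) ≠ 0 := by
  intro htr
  have hchar := hX.mem_characteristicSet hco hq
  obtain ⟨α, hαs, hα⟩ := hco
  set p := ι q with hp
  set c := extChartAt (𝓡 2) q q with hc
  set c' := extChartAt (𝓡 3) p p with hc'
  have hcc' : coordMap ι q c = c' := coordMap_extChartAt ι q
  have hαd : HasFDerivAt (coordForm α p) (fderiv ℝ (coordForm α p) c') c' :=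
    (differentiableAt_coordForm hαs p).hasFDerivAt
  set B := fderiv ℝ (coordForm α p) c'
  have hιs := contDiffAt_coordMap hι q
  have hιs2 : ContDiffAt ℝ 2 (coordMap ι q) c :=
    hιs.of_le (WithTop.coe_le_coe.2 (le_top : (2 : ℕ∞) ≤ ⊤))
  have hιd : HasFDerivAt (coordMap ι q) (fderiv ℝ (coordMap ι q) c) c :=
    (hιs.differentiableAt (by simp)).hasFDerivAt
  set L := fderiv ℝ (coordMap ι q) c with hL
  have hιd2 : HasFDerivAt (fderiv ℝ (coordMap ι q)) (fderiv ℝ (fderiv ℝ (coordMap ι q)) c) c :=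
    ((hιs2.fderiv_right (m := 1) (by rw [one_add_one_eq_two])).differentiableAt
      (by simp)).hasFDerivAt
  have hsymm := hιs2.isSymmSndFDerivAt (by simp)
  -- The pullback of `α` to the surface, in coordinates.
  set θ : Plane → Plane →L[ℝ] ℝ := fun y ↦
    (coordForm α p (coordMap ι q y)).comp (fderiv ℝ (coordMap ι q) y) with hθ
  have hev : ∀ᶠ y in 𝓝 c, y ∈ (extChartAt (𝓡 2) q).target ∧ ∀ w, θ y w =
      formAt α (ι ((extChartAt (𝓡 2) q).symm y))
        (mapDiff ι ((extChartAt (𝓡 2) q).symm y) (chartSymmDiff q y w)) := by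
    filter_upwards [eventually_hasFDerivAt_coordMap hι q] with y hy
    refine ⟨hy.1, fun w ↦ ?_⟩
    simp only [hθ]
    rw [hy.2.2.fderiv]
    simp only [coordForm, coordMap, ContinuousLinearMap.comp_apply]
    rw [← hp, (extChartAt (𝓡 3) p).left_inv hy.2.1, chartSymmDiff_chartDiff hy.2.1]
  have hαd' : HasFDerivAt (coordForm α p) B (coordMap ι q c) := by rwa [hcc']
  have hcomp : HasFDerivAt (fun y ↦ coordForm α p (coordMap ι q y)) (B.comp L) c :=
    hαd'.comp c hιd
  have hθd := hcomp.clm_comp hιd2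
  have hθ0 : θ c = 0 := by
    ext w
    rw [hev.self_of_nhds.2 w, extChartAt_to_inv]
    refine (hα _ _).1 ?_
    have : mapDiff ι q (chartSymmDiff q c w) ∈
        LinearMap.range (mfderiv (𝓡 2) (𝓡 3) ι q).toLinearMap := ⟨_, rfl⟩
    rw [hchar] at this
    exact this
  have hθF : ∀ᶠ y in 𝓝 c, θ y (coordField X q y) = 0 := by
    filter_upwards [hev] with y hy
    rw [hy.2]
    have h := chartSymmDiff_chartDiff ((extChartAt (𝓡 2) q).map_target hy.1)
      (X ((extChartAt (𝓡 2) q).symm y))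
    rw [(extChartAt (𝓡 2) q).right_inv hy.1] at h
    rw [coordField, h]
    exact (hα _ _).1 (hX.mfderiv_mem _)
  have hFd : HasFDerivAt (coordField X q) (linearization X q) c :=
    ((IsSmoothField.contDiffAt_coordField hX.smooth (mem_extChartAt_target q)).differentiableAt
      (by simp)).hasFDerivAt
  -- The derivative of `θ` is symmetric at `c`. Its term with the second derivative of the embedding
  -- is symmetric anyway, so the derivative `B` of `α` is symmetric on the tangent plane of `S`:
  -- `dα` vanishes there.
  have hB : ∀ v w, B (L v) (L w) = B (L w) (L v) := by
    intro v w
    have h := fderiv_symm_of_annihilates hθd hFd hθ0 (coordField_eq_zero hq) hθF hdet htr v w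
    have hs : fderiv ℝ (fderiv ℝ (coordMap ι q)) c v w =
      fderiv ℝ (fderiv ℝ (coordMap ι q)) c w v := hsymm v w
    simpa [hs, ← hL] using h
  -- For sections of `D`, differentiating `α V = 0` and `α W = 0` gives `α [V, W] = -dα (V, W)`.
  -- This is zero because at a characteristic point `V` and `W` are tangent to `S`.
  have hbr : ∀ u ∈ 𝓜.D.bracketsAt p, α p u = 0 := by
    rintro u ⟨U, hU, hpU, V, W, hV, hW, rfl⟩
    have hfield : ∀ V : (x : M) → 𝓜.D x, 𝓜.D.SmoothSectionOn V U →
        ∃ V' : Space →L[ℝ] Space, HasFDerivAt (coordField (fun x ↦ (V x).1) p) V' c' ∧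
          (∃ v, coordField (fun x ↦ (V x).1) p c' = L v) ∧
          ∀ z, B z (coordField (fun x ↦ (V x).1) p c') + coordForm α p c' (V' z) = 0 := by
      intro V hV
      have hd := ((contDiffOn_coordField_of_contMDiffOn hU hV p).contDiffAt (x := c')
        (inter_mem (extChartAt_target_mem_nhds p)
          ((continuousAt_extChartAt_symm p).preimage_mem_nhds (by
            rw [extChartAt_to_inv]; exact hU.mem_nhds hpU)))).differentiableAt
            (by simp) |>.hasFDerivAt
      refine ⟨_, hd, ?_, fun z ↦ ?_⟩
      · have hmem : (V p : TangentSpace (𝓡 3) p) ∈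
            LinearMap.range (mfderiv (𝓡 2) (𝓡 3) ι q).toLinearMap := by
          rw [hchar]; exact (V p).2
        obtain ⟨v, hv⟩ : ∃ v : Plane, mapDiff ι q v = (V p : TangentSpace (𝓡 3) p) := hmem
        refine ⟨chartDiff q q v, ?_⟩
        rw [hL, (eventually_hasFDerivAt_coordMap hι q).self_of_nhds.2.2.fderiv]
        simp only [ContinuousLinearMap.comp_apply]
        rw [chartSymmDiff_chartDiff (mem_extChartAt_source q), extChartAt_to_inv, coordField,
          hc', extChartAt_to_inv]
        exact congrArg (fun z : Space ↦ chartDiff (E := Space) p p z) hv.symm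
      · have h0 : (fun y ↦ coordForm α p y (coordField (fun x ↦ (V x).1) p y)) =ᶠ[𝓝 c']
            fun _ ↦ 0 := by
          filter_upwards [extChartAt_target_mem_nhds (I := 𝓡 3) p] with y hy
          rw [coordForm_apply_coordField α _ hy]
          exact (hα _ _).1 (V _).2
        have h1 := (hαd.clm_apply hd).unique ((hasFDerivAt_const (0 : ℝ) c').congr_of_eventuallyEq h0)
        have h2 := DFunLike.congr_fun h1 z
        simp at h2
        linarith
    obtain ⟨V', hVd, ⟨v, hv⟩, hVB⟩ := hfield V hV
    obtain ⟨W', hWd, ⟨w, hw⟩, hWB⟩ := hfield W hW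
    rw [mlieBracket_eq_chartSymmDiff]
    have e : coordForm α p c' (VectorField.lieBracket ℝ (coordField (fun x ↦ (V x).1) p)
        (coordField (fun x ↦ (W x).1) p) c') = 0 := by
      rw [VectorField.lieBracket_eq]
      simp only [hVd.fderiv, hWd.fderiv, map_sub]
      have h1 := hVB (coordField (fun x ↦ (W x).1) p c')
      have h2 := hWB (coordField (fun x ↦ (V x).1) p c')
      rw [hv, hw] at h1 h2 ⊢
      linarith [hB v w]
    rw [coordForm, hc', extChartAt_to_inv] at e
    exact e
  -- Now `D` and its brackets all lie in the kernel of `α`, which the contact condition forces to be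
  -- everything, whereas `D` is a proper subspace.
  obtain ⟨v, hv⟩ := 𝓜.exists_notMem p
  refine hv ((hα p v).2 ?_)
  have hle : 𝓜.D p ⊔ Submodule.span ℝ (𝓜.D.bracketsAt p) ≤ LinearMap.ker (α p).toLinearMap :=
    sup_le (fun u hu ↦ (hα _ _).1 hu) (Submodule.span_le.2 fun u hu ↦ hbr u hu)
  rw [𝓜.contact p] at hle
  exact hle (Submodule.mem_top (x := v))

end CharacteristicField

/-! ### Finiteness of the length of admissible curves -/

section Length

variable {M : Type*} [TopologicalSpace M] [ChartedSpace Space M] [IsManifold (𝓡 3) ∞ M]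
  {S : Type*} [TopologicalSpace S] [ChartedSpace Plane S] [IsManifold (𝓡 2) ∞ S]
  {ι : S → M} {𝓜 : ContactSubRiemannian M}

/-- Linear independence is stable, with uniform control of the coefficients. -/
theorem exists_coeff_bound {Y : Type*} [TopologicalSpace Y] {f₁ f₂ : Y → Space} {y₀ : Y}
    (h₁ : ContinuousAt f₁ y₀) (h₂ : ContinuousAt f₂ y₀)
    (hli : LinearIndependent ℝ ![f₁ y₀, f₂ y₀]) :
    ∃ K : ℝ, 0 ≤ K ∧ ∀ᶠ y in 𝓝 y₀, ∀ a b : ℝ, |a| + |b| ≤ K * ‖a • f₁ y + b • f₂ y‖ := by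
  let T : ℝ × ℝ →ₗ[ℝ] Space :=
    (LinearMap.toSpanSingleton ℝ Space (f₁ y₀)).coprod (LinearMap.toSpanSingleton ℝ Space (f₂ y₀))
  have hT : LinearMap.ker T = ⊥ := by
    refine LinearMap.ker_eq_bot'.2 fun z hz ↦ ?_
    have := LinearIndependent.pair_iff.1 hli z.1 z.2 (by simpa [T] using hz)
    exact Prod.ext this.1 this.2
  obtain ⟨K, hK, hTK⟩ := T.exists_antilipschitzWith hT
  have hK0 : (0 : ℝ) < K := hK
  -- At `y₀` the sum `|a| + |b|` is at most `2 K` times the norm of the combination. Moving each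
  -- vector by less than `1 / (4 K)` costs at most half of the sum, which is absorbed by doubling
  -- the constant.
  refine ⟨4 * K, by positivity, ?_⟩
  have hδ : (0 : ℝ) < 1 / (4 * K) := by positivity
  filter_upwards [Metric.continuousAt_iff'.1 h₁ _ hδ, Metric.continuousAt_iff'.1 h₂ _ hδ] with y e₁ e₂
  intro a b
  rw [dist_eq_norm] at e₁ e₂
  have h3 : ‖(a, b)‖ ≤ K * ‖a • f₁ y₀ + b • f₂ y₀‖ := by
    have := ZeroHomClass.bound_of_antilipschitz T hTK (a, b)
    simpa [T] using this
  have ha : |a| ≤ ‖(a, b)‖ := norm_fst_le (a, b)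
  have hb : |b| ≤ ‖(a, b)‖ := norm_snd_le (a, b)
  have h4 : ‖a • f₁ y₀ + b • f₂ y₀‖ ≤ ‖a • f₁ y + b • f₂ y‖ + (|a| + |b|) * (1 / (4 * K)) := by
    have e : a • f₁ y₀ + b • f₂ y₀ =
        (a • f₁ y + b • f₂ y) - (a • (f₁ y - f₁ y₀) + b • (f₂ y - f₂ y₀)) := by module
    rw [e]
    refine (norm_sub_le _ _).trans (add_le_add_right ((norm_add_le _ _).trans ?_) _)
    rw [norm_smul, norm_smul, Real.norm_eq_abs, Real.norm_eq_abs, add_mul]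
    gcongr
  have h5 : K * ((|a| + |b|) * (1 / (4 * K))) = (|a| + |b|) / 4 := by field_simp
  have h6 := mul_le_mul_of_nonneg_left h4 hK0.le
  rw [mul_add, h5] at h6
  linarith

theorem ContactSubRiemannian.vectorLength_of_mem (𝓜 : ContactSubRiemannian M) {x : M}
    {v : TangentSpace (𝓡 3) x} (h : v ∈ 𝓜.D x) :
    𝓜.vectorLength x v = ENNReal.ofReal (√(𝓜.metric x ⟨v, h⟩ ⟨v, h⟩)) := dif_pos h

/-- Locally, the sub-Riemannian length is bounded by the norm in a chart. -/
theorem ContactSubRiemannian.exists_vectorLength_le (𝓜 : ContactSubRiemannian M) (p : M) :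
    ∃ K : ℝ, 0 ≤ K ∧ ∀ᶠ x in 𝓝 p, ∀ v : Space, (v : TangentSpace (𝓡 3) x) ∈ 𝓜.D x →
      𝓜.vectorLength x v ≤ ENNReal.ofReal (K * ‖chartDiff (E := Space) p x v‖) := by
  obtain ⟨U, hU, hpU, F₁, F₂, hF₁, hF₂, hF⟩ := 𝓜.rank_two p
  have hcont : ∀ F : (x : M) → 𝓜.D x, 𝓜.D.SmoothSectionOn F U →
      ContinuousAt (fun x ↦ chartDiff (E := Space) p x (F x : TangentSpace (𝓡 3) x)) p := by
    intro F hFs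
    have h1 : ContinuousAt (coordField (fun x ↦ (F x).1) p) (extChartAt (𝓡 3) p p) :=
      ((contDiffOn_coordField_of_contMDiffOn hU hFs p).contDiffAt
        (inter_mem (extChartAt_target_mem_nhds p)
          ((continuousAt_extChartAt_symm p).preimage_mem_nhds (by
            rw [extChartAt_to_inv]; exact hU.mem_nhds hpU)))).continuousAt
    have h2 : ContinuousAt (fun x ↦ coordField (fun x ↦ (F x).1) p (extChartAt (𝓡 3) p x)) p :=
      h1.comp (continuousAt_extChartAt p)
    refine h2.congr ?_
    filter_upwards [extChartAt_source_mem_nhds (I := 𝓡 3) p] with x hx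
    exact coordField_extChartAt _ hx
  have hli : LinearIndependent ℝ ![chartDiff (E := Space) p p (F₁ p : TangentSpace (𝓡 3) p),
      chartDiff (E := Space) p p (F₂ p : TangentSpace (𝓡 3) p)] := by
    refine LinearIndependent.pair_iff.2 fun a b hab ↦ ?_
    refine LinearIndependent.pair_iff.1 (hF p hpU).1 a b (Subtype.ext ?_)
    have h1 : chartDiff (E := Space) p p
        (show Space from (a • (F₁ p : TangentSpace (𝓡 3) p) + b • (F₂ p : TangentSpace (𝓡 3) p))) =
        0 := by
      rw [← hab]
      exact ((chartDiff (E := Space) p p).map_add _ _).trans (congrArg₂ (· + ·)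
        ((chartDiff (E := Space) p p).map_smul _ _) ((chartDiff (E := Space) p p).map_smul _ _))
    exact (chartDiff_eq_zero_iff (mem_extChartAt_source p) _).1 h1
  obtain ⟨K, hK, hKev⟩ := exists_coeff_bound (hcont F₁ hF₁) (hcont F₂ hF₂) hli
  -- The metric is only known to be smooth on smooth sections. It is bounded on the local frame, and
  -- the coefficients of a vector in the frame are bounded by its norm in the chart.
  have hmetric : ∀ V W : (x : M) → 𝓜.D x, 𝓜.D.SmoothSectionOn V U → 𝓜.D.SmoothSectionOn W U →
      ∃ G : ℝ, 0 ≤ G ∧ ∀ᶠ x in 𝓝 p, |𝓜.metric x (V x) (W x)| ≤ G := by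
    intro V W hV hW
    have h1 := ((𝓜.metric_smooth U hU V W hV hW).continuousOn.continuousAt (hU.mem_nhds hpU)).abs
    refine ⟨|𝓜.metric p (V p) (W p)| + 1, by positivity, ?_⟩
    exact (h1.eventually_lt_const (lt_add_one _)).mono fun _ h ↦ h.le
  obtain ⟨G₁, hG₁, e₁⟩ := hmetric F₁ F₁ hF₁ hF₁
  obtain ⟨G₂, hG₂, e₂⟩ := hmetric F₂ F₂ hF₂ hF₂
  obtain ⟨G₃, hG₃, e₃⟩ := hmetric F₁ F₂ hF₁ hF₂
  set G := G₁ + G₂ + G₃ with hG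
  refine ⟨√G * K, by positivity, ?_⟩
  filter_upwards [hKev, e₁, e₂, e₃, hU.mem_nhds hpU] with x hx m₁ m₂ m₃ hxU
  intro v hv
  rw [𝓜.vectorLength_of_mem hv]
  refine ENNReal.ofReal_le_ofReal ?_
  have hspan : (⟨v, hv⟩ : 𝓜.D x) ∈ Submodule.span ℝ {F₁ x, F₂ x} := by
    rw [(hF x hxU).2]; trivial
  obtain ⟨a, b, hab⟩ := Submodule.mem_span_pair.1 hspan
  have hv2 : chartDiff (E := Space) p x v = a • chartDiff (E := Space) p x (F₁ x).1 +
      b • chartDiff (E := Space) p x (F₂ x).1 := by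
    have h1 : v = a • (F₁ x : TangentSpace (𝓡 3) x) + b • (F₂ x : TangentSpace (𝓡 3) x) :=
      (congrArg Subtype.val hab).symm
    refine (congrArg (fun w : Space ↦ chartDiff (E := Space) p x w) h1).trans ?_
    exact ((chartDiff (E := Space) p x).map_add _ _).trans (congrArg₂ (· + ·)
        ((chartDiff (E := Space) p x).map_smul _ _) ((chartDiff (E := Space) p x).map_smul _ _))
  have h2 : 𝓜.metric x ⟨v, hv⟩ ⟨v, hv⟩ = a ^ 2 * 𝓜.metric x (F₁ x) (F₁ x) +
      b ^ 2 * 𝓜.metric x (F₂ x) (F₂ x) + 2 * (a * b) * 𝓜.metric x (F₁ x) (F₂ x) := by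
    rw [← hab]
    simp only [map_add, map_smul, LinearMap.add_apply, LinearMap.smul_apply, smul_eq_mul,
      𝓜.metric_symm x (F₂ x) (F₁ x)]
    ring
  have h3 : 𝓜.metric x ⟨v, hv⟩ ⟨v, hv⟩ ≤ G * (|a| + |b|) ^ 2 := by
    rw [h2]
    have i₁ : a ^ 2 * 𝓜.metric x (F₁ x) (F₁ x) ≤ (|a| + |b|) ^ 2 * G₁ := by
      refine (le_abs_self _).trans ?_
      rw [abs_mul, abs_of_nonneg (sq_nonneg a)]
      refine mul_le_mul ?_ m₁ (abs_nonneg _) (sq_nonneg _)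
      rw [← sq_abs]; gcongr; linarith [abs_nonneg b]
    have i₂ : b ^ 2 * 𝓜.metric x (F₂ x) (F₂ x) ≤ (|a| + |b|) ^ 2 * G₂ := by
      refine (le_abs_self _).trans ?_
      rw [abs_mul, abs_of_nonneg (sq_nonneg b)]
      refine mul_le_mul ?_ m₂ (abs_nonneg _) (sq_nonneg _)
      rw [← sq_abs]; gcongr; linarith [abs_nonneg a]
    have i₃ : 2 * (a * b) * 𝓜.metric x (F₁ x) (F₂ x) ≤ (|a| + |b|) ^ 2 * G₃ := by
      refine (le_abs_self _).trans ?_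
      rw [abs_mul, abs_mul, abs_mul, abs_two]
      refine mul_le_mul ?_ m₃ (abs_nonneg _) (sq_nonneg _)
      nlinarith [sq_nonneg |a|, sq_nonneg |b|]
    rw [hG]; linarith
  calc √(𝓜.metric x ⟨v, hv⟩ ⟨v, hv⟩) ≤ √(G * (|a| + |b|) ^ 2) := Real.sqrt_le_sqrt h3
    _ = √G * (|a| + |b|) := by
      rw [Real.sqrt_mul (by positivity), Real.sqrt_sq (by positivity)]
    _ ≤ √G * (K * ‖chartDiff (E := Space) p x v‖) := by
      gcongr
      rw [hv2]
      exact hx a b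
    _ = _ := by ring

theorem exists_vectorLength_mapDiff_le (hι : ContMDiff (𝓡 2) (𝓡 3) ∞ ι)
    (𝓜 : ContactSubRiemannian M) (q : S) :
    ∃ K : ℝ, 0 ≤ K ∧ ∀ᶠ x in 𝓝 q, ∀ w : Plane,
      (mapDiff ι x w : TangentSpace (𝓡 3) (ι x)) ∈ 𝓜.D (ι x) →
      𝓜.vectorLength (ι x) (mapDiff ι x w) ≤ ENNReal.ofReal (K * ‖chartDiff q x w‖) := by
  obtain ⟨K, hK, hKev⟩ := 𝓜.exists_vectorLength_le (ι q)
  have hc : ContinuousAt (fun x ↦ ‖fderiv ℝ (coordMap ι q) (extChartAt (𝓡 2) q x)‖) q :=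
    (ContinuousAt.comp (g := fderiv ℝ (coordMap ι q))
      ((contDiffAt_coordMap hι q).fderiv_right (m := 0) (by simp)).continuousAt
      (continuousAt_extChartAt q)).norm
  refine ⟨K * (‖fderiv ℝ (coordMap ι q) (extChartAt (𝓡 2) q q)‖ + 1), by positivity, ?_⟩
  filter_upwards [hι.continuous.continuousAt.eventually hKev,
    hc.eventually_lt_const (lt_add_one _),
    (continuousAt_extChartAt (I := 𝓡 2) q).eventually (eventually_hasFDerivAt_coordMap hι q),
    extChartAt_source_mem_nhds (I := 𝓡 2) q] with x h1 h2 h3 h4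
  intro w hw
  refine (h1 _ hw).trans (ENNReal.ofReal_le_ofReal ?_)
  have h5 := h3.2.2.fderiv
  rw [(extChartAt (𝓡 2) q).left_inv h4] at h5
  have h6 : chartDiff (E := Space) (ι q) (ι x) (mapDiff ι x w) =
      fderiv ℝ (coordMap ι q) (extChartAt (𝓡 2) q x) (chartDiff q x w) := by
    rw [h5, ContinuousLinearMap.comp_apply, ContinuousLinearMap.comp_apply,
      chartSymmDiff_chartDiff h4]
  rw [h6, mul_assoc]
  gcongr
  exact (ContinuousLinearMap.le_opNorm _ _).trans (by gcongr)

theorem chartDiff_velocity {γ : ℝ → S} {t : ℝ} (hγ : MDifferentiableAt 𝓘(ℝ, ℝ) (𝓡 2) γ t) {q : S}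
    (hq : γ t ∈ (extChartAt (𝓡 2) q).source) :
    HasDerivAt (fun s ↦ extChartAt (𝓡 2) q (γ s))
      (chartDiff (E := Plane) q (γ t) (velocity γ t)) t := by
  refine hasDerivAt_chart_comp (hγ.hasMFDerivAt.congr_mfderiv ?_) hq
  refine ContinuousLinearMap.ext_ring ?_
  exact (one_smul ℝ (velocity γ t : Plane)).symm

/-- Admissible curves have finite length. -/
theorem ContactSubRiemannian.IsAdmissible.curveLength_lt_top
    (hι : ContMDiff (𝓡 2) (𝓡 3) ∞ ι) {γ : ℝ → S} {T : ℝ} (hγ : 𝓜.IsAdmissible ι γ T) :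
    𝓜.curveLength ι γ T < ⊤ := by
  obtain ⟨hT, ⟨hγc, hγL⟩, hγD⟩ := hγ
  set f : ℝ → ℝ≥0∞ := fun t ↦
    𝓜.vectorLength (ι (γ t)) (mfderiv (𝓡 2) (𝓡 3) ι (γ t) (velocity γ t)) with hf
  set μ := volume.restrict (Icc 0 T) with hμ
  have hcover : ∫⁻ t in Icc 0 T, f t ∂μ < ⊤ := by
    refine isCompact_Icc.induction_on (p := fun s ↦ ∫⁻ t in s, f t ∂μ < ⊤) (by simp)
      (fun s t hst ht ↦ (lintegral_mono_set hst).trans_lt ht)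
      (fun s t hs ht ↦ (lintegral_union_le f s t).trans_lt (ENNReal.add_lt_top.2 ⟨hs, ht⟩))
      fun t₀ ht₀ ↦ ?_
    obtain ⟨u, hu, L, hL⟩ := hγL t₀ ht₀
    obtain ⟨K, hK, hKev⟩ := exists_vectorLength_mapDiff_le hι 𝓜 (γ t₀)
    have h1 : ∀ᶠ t in 𝓝[Icc 0 T] t₀, γ t ∈ (extChartAt (𝓡 2) (γ t₀)).source :=
      (hγc t₀ ht₀).eventually_mem (extChartAt_source_mem_nhds (γ t₀))
    have h2 := (hγc t₀ ht₀).eventually hKev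
    obtain ⟨V, hVo, ht₀V, hV⟩ := mem_nhdsWithin.1 (inter_mem hu (inter_mem h1 h2))
    refine ⟨V ∩ Icc 0 T, inter_mem (mem_nhdsWithin_of_mem_nhds (hVo.mem_nhds ht₀V))
      self_mem_nhdsWithin, ?_⟩
    have hbound : ∀ᵐ t ∂(μ.restrict (V ∩ Icc 0 T)), f t ≤ ENNReal.ofReal (K * L) := by
      -- The Lipschitz estimate holds within `[0, T]` only, and bounds the derivative at interior
      -- times; the endpoints are negligible.
      have hne : ∀ᵐ t : ℝ, t ≠ 0 ∧ t ≠ T := by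
        have : ∀ a : ℝ, ∀ᵐ t : ℝ, t ≠ a := fun a ↦ by simp [ae_iff, measure_singleton]
        exact (this 0).and (this T)
      have hmeas : MeasurableSet (V ∩ Icc 0 T) := hVo.measurableSet.inter measurableSet_Icc
      filter_upwards [ae_restrict_of_ae hγD, ae_restrict_of_ae (ae_restrict_of_ae hne),
        ae_restrict_mem hmeas] with t hD hne htV
      have htI : Icc 0 T ∈ 𝓝 t := Icc_mem_nhds (lt_of_le_of_ne htV.2.1 (Ne.symm hne.1))
        (lt_of_le_of_ne htV.2.2 hne.2)
      have hVt : u ∈ 𝓝 t := mem_of_superset (inter_mem (hVo.mem_nhds htV.1) htI)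
        fun s hs ↦ (hV hs).1
      obtain ⟨-, hsrc, hlen⟩ := hV htV
      refine (hlen (velocity γ t) hD.2).trans (ENNReal.ofReal_le_ofReal ?_)
      have h3 := chartDiff_velocity hD.1 hsrc
      have h4 := norm_deriv_le_of_lipschitzOn hVt hL
      rw [h3.deriv] at h4
      gcongr
    calc ∫⁻ t in V ∩ Icc 0 T, f t ∂μ ≤ ∫⁻ _ in V ∩ Icc 0 T, ENNReal.ofReal (K * L) ∂μ :=
          lintegral_mono_ae hbound
      _ = ENNReal.ofReal (K * L) * μ (V ∩ Icc 0 T) := setLIntegral_const _ _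
      _ < ⊤ := ENNReal.mul_lt_top ENNReal.ofReal_lt_top
          ((measure_mono inter_subset_right).trans_lt (by rw [hμ]; simp))
  rw [hμ, Measure.restrict_restrict measurableSet_Icc, inter_self] at hcover
  exact hcover

end Length

/-! ### The relation of being joined by an admissible curve -/

section Curves

variable {S : Type*} [TopologicalSpace S] [ChartedSpace Plane S]

/-- The curve `γ` is continuous and Lipschitz in the chart at `γ t₀`, near `t₀` within `s`. -/
def IsLipschitzNear (γ : ℝ → S) (s : Set ℝ) (t₀ : ℝ) : Prop :=
  ContinuousWithinAt γ s t₀ ∧ ∃ u ∈ 𝓝[s] t₀, ∃ K : ℝ≥0,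
    LipschitzOnWith K (fun t ↦ extChartAt (𝓡 2) (γ t₀) (γ t)) u

theorem isLipschitzCurve_iff {γ : ℝ → S} {T : ℝ} :
    IsLipschitzCurve γ T ↔ ∀ t₀ ∈ Icc 0 T, IsLipschitzNear γ (Icc 0 T) t₀ :=
  ⟨fun h t₀ ht₀ ↦ ⟨h.1 t₀ ht₀, h.2 t₀ ht₀⟩,
    fun h ↦ ⟨fun t₀ ht₀ ↦ (h t₀ ht₀).1, fun t₀ ht₀ ↦ (h t₀ ht₀).2⟩⟩

theorem IsLipschitzNear.mono {γ : ℝ → S} {s s' : Set ℝ} {t₀ : ℝ} (h : IsLipschitzNear γ s t₀)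
    (hs : 𝓝[s'] t₀ ≤ 𝓝[s] t₀) : IsLipschitzNear γ s' t₀ := by
  obtain ⟨u, hu, K, hK⟩ := h.2
  exact ⟨h.1.mono_left hs, u, hs hu, K, hK⟩

theorem IsLipschitzNear.congr {γ γ' : ℝ → S} {s : Set ℝ} {t₀ : ℝ} (h : IsLipschitzNear γ s t₀)
    (ht₀ : t₀ ∈ s) (hs : EqOn γ' γ s) : IsLipschitzNear γ' s t₀ := by
  obtain ⟨u, hu, K, hK⟩ := h.2
  refine ⟨h.1.congr hs (hs ht₀), u ∩ s, inter_mem hu self_mem_nhdsWithin, K, ?_⟩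
  intro x hx y hy
  simp only
  rw [hs ht₀, hs hx.2, hs hy.2]
  exact hK hx.1 hy.1

theorem IsLipschitzNear.comp {γ : ℝ → S} {s s' : Set ℝ} {t₀ : ℝ} {ρ : ℝ → ℝ}
    (h : IsLipschitzNear γ s (ρ t₀)) (hρ : LipschitzWith 1 ρ) (hs : MapsTo ρ s' s) :
    IsLipschitzNear (fun t ↦ γ (ρ t)) s' t₀ := by
  obtain ⟨u, hu, K, hK⟩ := h.2
  have ht : Tendsto ρ (𝓝[s'] t₀) (𝓝[s] (ρ t₀)) := hρ.continuous.continuousWithinAt.tendsto_nhdsWithin hs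
  refine ⟨h.1.tendsto.comp ht, ρ ⁻¹' u, ht hu, K * 1, ?_⟩
  exact hK.comp (hρ.lipschitzOnWith (s := ρ ⁻¹' u)) (mapsTo_preimage _ _)

/-- The common point `t₀` separates the two sets, so distances across it add up. -/
theorem LipschitzOnWith.union_of_le {F : Type*} [PseudoMetricSpace F] {f : ℝ → F} {s s' : Set ℝ}
    {t₀ : ℝ} {K K' : ℝ≥0} (h : LipschitzOnWith K f s) (h' : LipschitzOnWith K' f s')
    (hs : s ⊆ Iic t₀) (hs' : s' ⊆ Ici t₀) (ht : t₀ ∈ s) (ht' : t₀ ∈ s') :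
    LipschitzOnWith (max K K') f (s ∪ s') := by
  have key : ∀ x ∈ s, ∀ y ∈ s', dist (f x) (f y) ≤ (max K K' : ℝ≥0) * dist x y := by
    intro x hx y hy
    have h1 := h.dist_le_mul x hx t₀ ht
    have h2 := h'.dist_le_mul t₀ ht' y hy
    have h3 : x ≤ t₀ := hs hx
    have h4 : t₀ ≤ y := hs' hy
    have h5 : dist x y = dist x t₀ + dist t₀ y := by
      rw [Real.dist_eq, Real.dist_eq, Real.dist_eq, abs_of_nonpos (by linarith),
        abs_of_nonpos (by linarith), abs_of_nonpos (by linarith)]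
      ring
    have h6 : (K : ℝ) ≤ (max K K' : ℝ≥0) := by exact_mod_cast le_max_left K K'
    have h7 : (K' : ℝ) ≤ (max K K' : ℝ≥0) := by exact_mod_cast le_max_right K K'
    calc dist (f x) (f y) ≤ dist (f x) (f t₀) + dist (f t₀) (f y) := dist_triangle _ _ _
      _ ≤ (max K K' : ℝ≥0) * dist x t₀ + (max K K' : ℝ≥0) * dist t₀ y := by
        refine add_le_add (h1.trans ?_) (h2.trans ?_) <;> gcongr
      _ = _ := by rw [h5, mul_add]
  refine LipschitzOnWith.of_dist_le_mul fun x hx y hy ↦ ?_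
  rcases hx with hx | hx <;> rcases hy with hy | hy
  · exact ((h.weaken (le_max_left K K')).dist_le_mul x hx y hy)
  · exact key x hx y hy
  · rw [dist_comm, dist_comm x y]; exact key y hy x hx
  · exact ((h'.weaken (le_max_right K K')).dist_le_mul x hx y hy)

theorem IsLipschitzNear.union {γ : ℝ → S} {s s' : Set ℝ} {t₀ : ℝ} (h : IsLipschitzNear γ s t₀)
    (h' : IsLipschitzNear γ s' t₀) (hs : s ⊆ Iic t₀) (hs' : s' ⊆ Ici t₀) (ht : t₀ ∈ s)
    (ht' : t₀ ∈ s') : IsLipschitzNear γ (s ∪ s') t₀ := by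
  obtain ⟨u, hu, K, hK⟩ := h.2
  obtain ⟨u', hu', K', hK'⟩ := h'.2
  refine ⟨h.1.union h'.1, (u ∩ s) ∪ (u' ∩ s'), ?_, max K K', ?_⟩
  · rw [nhdsWithin_union]
    exact union_mem_sup (inter_mem hu self_mem_nhdsWithin) (inter_mem hu' self_mem_nhdsWithin)
  · exact (hK.mono inter_subset_left).union_of_le (hK'.mono inter_subset_left)
      (inter_subset_right.trans hs) (inter_subset_right.trans hs')
      ⟨mem_of_mem_nhdsWithin ht hu, ht⟩ ⟨mem_of_mem_nhdsWithin ht' hu', ht'⟩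

variable [IsManifold (𝓡 2) ∞ S] {X : (q : S) → TangentSpace (𝓡 2) q}

/-- A reparametrized trajectory of a smooth field is locally Lipschitz. -/
theorem IsSmoothField.isLipschitzNear_comp (hX : IsSmoothField X) {γ : ℝ → S}
    (hγ : IsMIntegralCurve (I := 𝓡 2) γ X) {ρ ρ' : ℝ → ℝ} {t₀ : ℝ}
    (hρ : ∀ᶠ t in 𝓝 t₀, HasDerivAt ρ (ρ' t) t) (hρ' : ContinuousAt ρ' t₀) (s : Set ℝ) :
    IsLipschitzNear (fun t ↦ γ (ρ t)) s t₀ := by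
  have hρc : ContinuousAt ρ t₀ := hρ.self_of_nhds.continuousAt
  have hc : ContinuousAt (fun t ↦ γ (ρ t)) t₀ :=
    ContinuousAt.comp (f := ρ) hγ.continuous.continuousAt hρc
  refine ⟨hc.continuousWithinAt, ?_⟩
  have hmem := hc.eventually_mem (extChartAt_source_mem_nhds (I := 𝓡 2) (γ (ρ t₀)))
  have hder : ∀ᶠ t in 𝓝 t₀, HasDerivAt (fun t ↦ extChartAt (𝓡 2) (γ (ρ t₀)) (γ (ρ t)))
      (ρ' t • coordField X (γ (ρ t₀)) (extChartAt (𝓡 2) (γ (ρ t₀)) (γ (ρ t)))) t := by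
    filter_upwards [hρ, hmem] with t h1 h2
    exact (hγ.hasDerivAt_chart h2).scomp t h1
  have hc2 : ContinuousAt (fun t ↦ extChartAt (𝓡 2) (γ (ρ t₀)) (γ (ρ t))) t₀ :=
    hder.self_of_nhds.continuousAt
  have hc3 : ContinuousAt (fun t ↦
      ρ' t • coordField X (γ (ρ t₀)) (extChartAt (𝓡 2) (γ (ρ t₀)) (γ (ρ t)))) t₀ :=
    hρ'.smul (ContinuousAt.comp (g := coordField X (γ (ρ t₀)))
      (hX.contDiffAt_coordField (mem_extChartAt_target _)).continuousAt hc2)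
  obtain ⟨K, u, hu, hK⟩ := (hasStrictDerivAt_of_hasDerivAt_of_continuousAt hder
    hc3).hasStrictFDerivAt.exists_lipschitzOnWith
  exact ⟨u, mem_nhdsWithin_of_mem_nhds hu, K, hK⟩

variable {M : Type*} [TopologicalSpace M] [ChartedSpace Space M] [IsManifold (𝓡 3) ∞ M]
  {ι : S → M} {𝓜 : ContactSubRiemannian M}

/-- The curve `γ` is differentiable at time `t`, with velocity in `D`. -/
def ContactSubRiemannian.IsHorizontalAt (𝓜 : ContactSubRiemannian M) (ι : S → M) (γ : ℝ → S)
    (t : ℝ) : Prop :=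
  MDifferentiableAt 𝓘(ℝ, ℝ) (𝓡 2) γ t ∧
    mfderiv (𝓡 2) (𝓡 3) ι (γ t) (velocity γ t) ∈ 𝓜.D (ι (γ t))

omit [IsManifold (𝓡 2) ∞ S] in
theorem isHorizontalAt_of_hasMFDerivAt {γ : ℝ → S} {t : ℝ} {w : TangentSpace (𝓡 2) (γ t)}
    (h : HasMFDerivAt 𝓘(ℝ, ℝ) (𝓡 2) γ t ((1 : ℝ →L[ℝ] ℝ).smulRight w))
    (hw : mfderiv (𝓡 2) (𝓡 3) ι (γ t) w ∈ 𝓜.D (ι (γ t))) : 𝓜.IsHorizontalAt ι γ t := by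
  refine ⟨h.mdifferentiableAt, ?_⟩
  have : velocity γ t = w := by
    unfold velocity
    rw [h.mfderiv]
    exact one_smul ℝ (w : Plane)
  rwa [this]

omit [IsManifold (𝓡 2) ∞ S] in
theorem ContactSubRiemannian.IsHorizontalAt.congr {γ γ' : ℝ → S} {t : ℝ}
    (h : 𝓜.IsHorizontalAt ι γ t) (hγ : γ' =ᶠ[𝓝 t] γ) : 𝓜.IsHorizontalAt ι γ' t := by
  have h1 := (h.1.hasMFDerivAt.congr_of_eventuallyEq hγ)
  refine ⟨h1.mdifferentiableAt, ?_⟩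
  have h2 : γ' t = γ t := hγ.self_of_nhds
  have h3 : (velocity γ' t : Plane) = velocity γ t := by
    exact congrArg (fun L : ℝ →L[ℝ] Plane ↦ L 1) h1.mfderiv
  have h4 : ∀ x y : S, x = y → ∀ v w : Plane, v = w → mfderiv (𝓡 2) (𝓡 3) ι y w ∈ 𝓜.D (ι y) →
      mfderiv (𝓡 2) (𝓡 3) ι x v ∈ 𝓜.D (ι x) := by
    rintro x _ rfl v _ rfl h; exact h
  exact h4 _ _ h2 _ _ h3 h.2

omit [IsManifold (𝓡 2) ∞ S] in
theorem ContactSubRiemannian.IsHorizontalAt.comp {γ : ℝ → S} {ρ : ℝ → ℝ} {r t : ℝ}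
    (h : 𝓜.IsHorizontalAt ι γ (ρ t)) (hρ : HasDerivAt ρ r t) :
    𝓜.IsHorizontalAt ι (fun t ↦ γ (ρ t)) t := by
  have h1 := h.1.hasMFDerivAt.comp t (hasMFDerivAt_iff_hasFDerivAt.mpr hρ.hasFDerivAt)
  refine isHorizontalAt_of_hasMFDerivAt (w := r • velocity γ (ρ t)) (h1.congr_mfderiv ?_) ?_
  · refine ContinuousLinearMap.ext_ring ?_
    have e1 : (mfderiv 𝓘(ℝ, ℝ) (𝓡 2) γ (ρ t) : ℝ →L[ℝ] Plane) (r • (1 : ℝ)) =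
      r • (mfderiv 𝓘(ℝ, ℝ) (𝓡 2) γ (ρ t) : ℝ →L[ℝ] Plane) 1 := map_smul _ _ _
    have e2 : (ContinuousLinearMap.toSpanSingleton ℝ r) (1 : ℝ) = r • (1 : ℝ) := by simp
    exact ((congrArg (mfderiv 𝓘(ℝ, ℝ) (𝓡 2) γ (ρ t) : ℝ →L[ℝ] Plane) e2).trans e1).trans
      (one_smul ℝ (r • velocity γ (ρ t) : Plane)).symm
  · have := (𝓜.D (ι (γ (ρ t)))).smul_mem r h.2
    rw [← map_smul] at this
    exact this

omit [IsManifold (𝓡 2) ∞ S] in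
-- On the open interval differentiability is insensitive to the values of the curve outside `[0,
-- T]`, which makes reversal and concatenation pointwise checks.
theorem isAdmissible_iff {γ : ℝ → S} {T : ℝ} : 𝓜.IsAdmissible ι γ T ↔
    0 < T ∧ (∀ t ∈ Icc 0 T, IsLipschitzNear γ (Icc 0 T) t) ∧
      ∀ᵐ t, t ∈ Ioo 0 T → 𝓜.IsHorizontalAt ι γ t := by
  have h : (∀ᵐ t ∂(volume.restrict (Icc 0 T)), 𝓜.IsHorizontalAt ι γ t) ↔
      ∀ᵐ t, t ∈ Ioo 0 T → 𝓜.IsHorizontalAt ι γ t := by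
    rw [← ae_restrict_iff' measurableSet_Ioo, restrict_Ioo_eq_restrict_Icc]
  rw [← isLipschitzCurve_iff, ← h]
  rfl

/-- There is an admissible curve from `p` to `q`. -/
def ContactSubRiemannian.Joined (𝓜 : ContactSubRiemannian M) (ι : S → M) (p q : S) : Prop :=
  ∃ (γ : ℝ → S) (T : ℝ), 𝓜.IsAdmissible ι γ T ∧ γ 0 = p ∧ γ T = q

/-- The infimum runs over finite lengths, so it is infinite only when there is no curve at all. The
metric plays no role after this point. -/
theorem ContactSubRiemannian.inducedDist_lt_top_iff (hι : ContMDiff (𝓡 2) (𝓡 3) ∞ ι) {p q : S} :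
    𝓜.inducedDist ι p q < ⊤ ↔ 𝓜.Joined ι p q := by
  unfold ContactSubRiemannian.inducedDist
  simp only [iInf_lt_iff]
  constructor
  · rintro ⟨γ, T, h, -⟩
    exact ⟨γ, T, h⟩
  · rintro ⟨γ, T, h⟩
    exact ⟨γ, T, h, h.1.curveLength_lt_top hι⟩

omit [IsManifold (𝓡 2) ∞ S] in
theorem ContactSubRiemannian.Joined.refl (p : S) : 𝓜.Joined ι p p := by
  refine ⟨fun _ ↦ p, 1, isAdmissible_iff.2 ⟨one_pos, fun t _ ↦ ⟨continuousWithinAt_const, univ,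
    univ_mem, 0, (LipschitzWith.const _).lipschitzOnWith⟩, Eventually.of_forall fun t _ ↦ ?_⟩,
    rfl, rfl⟩
  refine isHorizontalAt_of_hasMFDerivAt (w := 0) ((hasMFDerivAt_const p t).congr_mfderiv ?_) ?_
  · exact (ContinuousLinearMap.smulRight_zero (M₂ := Plane) (1 : ℝ →L[ℝ] ℝ)).symm
  · rw [map_zero]; exact zero_mem _

omit [IsManifold (𝓡 2) ∞ S] in
theorem ContactSubRiemannian.Joined.symm {p q : S} (h : 𝓜.Joined ι p q) : 𝓜.Joined ι q p := by
  obtain ⟨γ, T, h, rfl, rfl⟩ := h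
  obtain ⟨hT, hL, hH⟩ := isAdmissible_iff.1 h
  refine ⟨fun t ↦ γ (T - t), T, isAdmissible_iff.2 ⟨hT, fun t ht ↦ ?_, ?_⟩, by simp, by simp⟩
  · refine (hL (T - t) ⟨by linarith [ht.2], by linarith [ht.1]⟩).comp ?_ ?_
    · exact LipschitzWith.of_dist_le_mul fun x y ↦ by
        rw [NNReal.coe_one, one_mul, Real.dist_eq, Real.dist_eq, abs_sub_comm]
        exact le_of_eq (congrArg _ (by ring))
    · exact fun s hs ↦ ⟨by linarith [hs.2], by linarith [hs.1]⟩
  · filter_upwards [(volume.measurePreserving_sub_left T).quasiMeasurePreserving.ae hH] with t ht h2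
    exact (ht ⟨by linarith [h2.2], by linarith [h2.1]⟩).comp ((hasDerivAt_id t).const_sub T)

omit [IsManifold (𝓡 2) ∞ S] in
theorem ContactSubRiemannian.Joined.trans {p q r : S} (h : 𝓜.Joined ι p q)
    (h' : 𝓜.Joined ι q r) : 𝓜.Joined ι p r := by
  obtain ⟨γ, T, h, rfl, rfl⟩ := h
  obtain ⟨γ', T', h', hq, rfl⟩ := h'
  obtain ⟨hT, hL, hH⟩ := isAdmissible_iff.1 h
  obtain ⟨hT', hL', hH'⟩ := isAdmissible_iff.1 h'
  set δ : ℝ → S := fun t ↦ if t ≤ T then γ t else γ' (t - T) with hδ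
  have e1 : EqOn δ γ (Iic T) := fun t ht ↦ if_pos ht
  have e2 : EqOn δ (fun t ↦ γ' (t - T)) (Ici T) := by
    intro t ht
    rcases eq_or_lt_of_le (show T ≤ t from ht) with rfl | h
    · simp [hδ, hq]
    · exact if_neg (not_le.2 h)
  have l1 : ∀ t ∈ Icc 0 T, IsLipschitzNear δ (Icc 0 T) t := fun t ht ↦
    (hL t ht).congr ht (e1.mono fun s hs ↦ hs.2)
  have l2 : ∀ t ∈ Icc T (T + T'), IsLipschitzNear δ (Icc T (T + T')) t := fun t ht ↦ by
    refine IsLipschitzNear.congr ?_ ht (e2.mono fun s hs ↦ hs.1)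
    refine (hL' (t - T) ⟨by linarith [ht.1], by linarith [ht.2]⟩).comp (ρ := fun t ↦ t - T) ?_ ?_
    · exact LipschitzWith.of_dist_le_mul fun x y ↦ by simp [Real.dist_eq]
    · exact fun s hs ↦ ⟨by linarith [hs.1], by linarith [hs.2]⟩
  have hun : Icc 0 (T + T') = Icc 0 T ∪ Icc T (T + T') :=
    (Icc_union_Icc_eq_Icc hT.le (by linarith)).symm
  refine ⟨δ, T + T', isAdmissible_iff.2 ⟨by positivity, fun t ht ↦ ?_, ?_⟩, ?_, ?_⟩
  · rcases lt_trichotomy t T with h | rfl | h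
    · refine (l1 t ⟨ht.1, h.le⟩).mono ?_
      rw [nhdsWithin_le_iff]
      filter_upwards [self_mem_nhdsWithin, mem_nhdsWithin_of_mem_nhds (Iio_mem_nhds h)] with s h1 h2
      exact ⟨h1.1, le_of_lt h2⟩
    · rw [hun]
      exact (l1 t ⟨ht.1, le_rfl⟩).union (l2 t ⟨le_rfl, ht.2⟩) (fun s hs ↦ hs.2) (fun s hs ↦ hs.1)
        ⟨ht.1, le_rfl⟩ ⟨le_rfl, ht.2⟩
    · refine (l2 t ⟨h.le, ht.2⟩).mono ?_
      rw [nhdsWithin_le_iff]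
      filter_upwards [self_mem_nhdsWithin, mem_nhdsWithin_of_mem_nhds (Ioi_mem_nhds h)] with s h1 h2
      exact ⟨le_of_lt h2, h1.2⟩
  · have hne : ∀ᵐ t : ℝ, t ≠ T := by simp [ae_iff, measure_singleton]
    filter_upwards [hH, (measurePreserving_sub_right volume T).quasiMeasurePreserving.ae hH', hne]
      with t h1 h2 h3 ht
    rcases lt_or_gt_of_ne h3 with h | h
    · exact (h1 ⟨ht.1, h⟩).congr (e1.eventuallyEq_of_mem (Iic_mem_nhds h))
    · refine ((h2 ⟨by linarith, by linarith [ht.2]⟩).comp (ρ := fun t ↦ t - T)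
        ((hasDerivAt_id t).sub_const T)).congr (e2.eventuallyEq_of_mem (Ici_mem_nhds h))
  · exact e1 hT.le
  · have := e2 (show T ≤ T + T' by linarith)
    simpa using this

/-- The points of a trajectory of a field tangent to `D` are joined. -/
theorem IsSmoothField.joined (hX : IsSmoothField X)
    (hD : ∀ q, mfderiv (𝓡 2) (𝓡 3) ι q (X q) ∈ 𝓜.D (ι q)) {γ : ℝ → S}
    (hγ : IsMIntegralCurve (I := 𝓡 2) γ X) (a b : ℝ) : 𝓜.Joined ι (γ a) (γ b) := by
  wlog h : a < b generalizing a b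
  · rcases eq_or_lt_of_le (not_lt.1 h) with rfl | h'
    · exact .refl _
    · exact (this b a h').symm
  refine ⟨fun t ↦ γ (t + a), b - a, isAdmissible_iff.2 ⟨by linarith, fun t _ ↦ ?_,
    Eventually.of_forall fun t _ ↦ ?_⟩, by simp, by simp⟩
  · exact hX.isLipschitzNear_comp hγ (ρ' := fun _ ↦ 1)
      (Eventually.of_forall fun s ↦ (hasDerivAt_id s).add_const a) continuousAt_const _
  · exact (isHorizontalAt_of_hasMFDerivAt (hγ (t + a)) (hD _)).comp (ρ := fun t ↦ t + a)
      ((hasDerivAt_id t).add_const a)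

/-- A point whose trajectory tends exponentially to a zero of the field is joined to that zero. -/
theorem IsSmoothField.joined_of_tendsto (hX : IsSmoothField X)
    (hD : ∀ q, mfderiv (𝓡 2) (𝓡 3) ι q (X q) ∈ 𝓜.D (ι q)) {γ : ℝ → S}
    (hγ : IsMIntegralCurve (I := 𝓡 2) γ X) {q : S} (hq : X q = 0) {C c : ℝ} (hC : 0 < C)
    (hc : 0 < c) (h : ∀ t ≥ 0, γ t ∈ (extChartAt (𝓡 2) q).source ∧
      ‖disp q (γ t)‖ ≤ C * Real.exp (-c * t)) : 𝓜.Joined ι (γ 0) q := by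
  classical
  -- In this time the distance to `q` is at most `C * s`, so the field has size `O(s)`. The speed of
  -- reparametrization is `1 / (c * s)`, and the new curve has bounded velocity up to `s = 0`, where
  -- it is given the value `q`.
  set ρ : ℝ → ℝ := fun s ↦ -Real.log s / c with hρ
  set δ : ℝ → S := fun s ↦ if s ≤ 0 then q else γ (ρ s) with hδ
  have hδpos : ∀ s, 0 < s → δ s = γ (ρ s) := fun s hs ↦ if_neg (not_le.2 hs)
  have hδev : ∀ s, 0 < s → δ =ᶠ[𝓝 s] fun s ↦ γ (ρ s) := fun s hs ↦
    Filter.mem_of_superset (Ioi_mem_nhds hs) hδpos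
  have hδ0 : δ 0 = q := if_pos le_rfl
  have hρder : ∀ s, 0 < s → HasDerivAt ρ (-s⁻¹ / c) s := fun s hs ↦
    ((Real.hasDerivAt_log hs.ne').fun_neg).div_const c
  have hρ0 : ∀ s, 0 < s → s ≤ 1 → 0 ≤ ρ s := fun s hs hs1 ↦
    div_nonneg (neg_nonneg.2 (Real.log_nonpos hs.le hs1)) hc.le
  have hexp : ∀ s, 0 < s → Real.exp (-c * ρ s) = s := fun s hs ↦ by
    rw [hρ]
    simp only
    rw [show -c * (-Real.log s / c) = Real.log s by field_simp, Real.exp_log hs]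
  have hdisp : ∀ s, 0 < s → s ≤ 1 → γ (ρ s) ∈ (extChartAt (𝓡 2) q).source ∧
      ‖disp q (γ (ρ s))‖ ≤ C * s := fun s hs hs1 ↦ by
    have := h (ρ s) (hρ0 s hs hs1)
    rwa [hexp s hs] at this
  refine ContactSubRiemannian.Joined.symm ⟨δ, 1, isAdmissible_iff.2 ⟨one_pos, fun s hs ↦ ?_,
    Eventually.of_forall fun s hs ↦ ?_⟩, hδ0, ?_⟩
  · rcases eq_or_lt_of_le hs.1 with rfl | hpos
    · set φ := extChartAt (𝓡 2) q with hφ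
      obtain ⟨L, U, hU, hL⟩ := ((hX.contDiffAt_coordField (mem_extChartAt_target q)).of_le
        (m := 1) (by simp)).exists_lipschitzOnWith
      obtain ⟨ε, hε, hεU⟩ := Metric.mem_nhds_iff.1 hU
      have hXq : coordField X q (φ q) = 0 := coordField_eq_zero hq
      have hfield : ∀ y ∈ Metric.ball (φ q) ε, ‖coordField X q y‖ ≤ L * ‖y - φ q‖ := by
        intro y hy
        have := hL.norm_sub_le (hεU hy) (hεU (Metric.mem_ball_self hε))
        rwa [hXq, sub_zero] at this
      set d := min 1 (ε / (2 * C)) with hd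
      have hd0 : 0 < d := by positivity
      have hder : ∀ s ∈ Ioo 0 d, HasDerivAt (fun s ↦ φ (γ (ρ s)))
          ((-s⁻¹ / c) • coordField X q (φ (γ (ρ s)))) s := fun s hs ↦
        (hγ.hasDerivAt_chart (hdisp s hs.1 (hs.2.le.trans (min_le_left _ _))).1).scomp s
          (hρder s hs.1)
      have hbd : ∀ s ∈ Ioo 0 d, ‖(-s⁻¹ / c) • coordField X q (φ (γ (ρ s)))‖ ≤ L * C / c := by
        intro s hs
        have h1 := (hdisp s hs.1 (hs.2.le.trans (min_le_left _ _))).2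
        have h2 : s < ε / (2 * C) := hs.2.trans_le (min_le_right _ _)
        have h3 : C * s < ε := by
          rw [lt_div_iff₀ (by positivity)] at h2
          nlinarith [hs.1]
        have h4 := hfield (φ (γ (ρ s))) (by
          rw [Metric.mem_ball, dist_eq_norm]; exact lt_of_le_of_lt h1 h3)
        have h5 : ‖φ (γ (ρ s)) - φ q‖ ≤ C * s := h1
        rw [norm_smul, Real.norm_eq_abs, abs_div, abs_neg, abs_inv, abs_of_pos hs.1, abs_of_pos hc]
        calc s⁻¹ / c * ‖coordField X q (φ (γ (ρ s)))‖ ≤ s⁻¹ / c * (L * (C * s)) := by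
              have := hs.1
              gcongr
              exact h4.trans (by gcongr)
          _ = L * C / c := by have := hs.1.ne'; field_simp
      -- `C` controls the distance to the endpoint, `L * C / c` the velocity at positive times.
      set K : ℝ≥0 := ⟨max C (L * C / c), by positivity⟩ with hK
      have hK1 : C ≤ K := le_max_left _ _
      have hK2 : L * C / c ≤ K := le_max_right _ _
      have hLip : LipschitzOnWith K (fun s ↦ φ (γ (ρ s))) (Ioo 0 d) := by
        refine (convex_Ioo 0 d).lipschitzOnWith_of_nnnorm_hasDerivWithin_le
          (fun s hs ↦ (hder s hs).hasDerivWithinAt) fun s hs ↦ ?_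
        exact_mod_cast (hbd s hs).trans hK2
      have h0 : ∀ s ∈ Ioo 0 d, dist (φ (γ (ρ s))) (φ q) ≤ K * dist s 0 := by
        intro s hs
        rw [dist_eq_norm, Real.dist_eq, sub_zero, abs_of_pos hs.1]
        refine ((hdisp s hs.1 (hs.2.le.trans (min_le_left _ _))).2).trans ?_
        have := hs.1
        gcongr
      have hLip2 : LipschitzOnWith K (fun s ↦ φ (δ s)) (Ico 0 d) := by
        refine LipschitzOnWith.of_dist_le_mul fun x hx y hy ↦ ?_
        rcases eq_or_lt_of_le hx.1 with rfl | hx0 <;> rcases eq_or_lt_of_le hy.1 with rfl | hy0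
        · simp
        · rw [hδ0, hδpos y hy0, dist_comm, dist_comm (0 : ℝ)]; exact h0 y ⟨hy0, hy.2⟩
        · rw [hδ0, hδpos x hx0]; exact h0 x ⟨hx0, hx.2⟩
        · rw [hδpos x hx0, hδpos y hy0]
          exact hLip.dist_le_mul x ⟨hx0, hx.2⟩ y ⟨hy0, hy.2⟩
      have hnh : Ico 0 d ∈ 𝓝[Icc 0 1] (0 : ℝ) := by
        filter_upwards [self_mem_nhdsWithin, mem_nhdsWithin_of_mem_nhds (Iio_mem_nhds hd0)]
          with s h1 h2
        exact ⟨h1.1, h2⟩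
      have hsrc : ∀ s ∈ Ico 0 d, δ s ∈ φ.source := by
        intro s hs
        rcases eq_or_lt_of_le hs.1 with rfl | hs0
        · rw [hδ0]; exact mem_extChartAt_source q
        · rw [hδpos s hs0]; exact (hdisp s hs0 (hs.2.le.trans (min_le_left _ _))).1
      refine ⟨?_, Ico 0 d, hnh, K, ?_⟩
      · have h1 : ContinuousWithinAt (fun s ↦ φ (δ s)) (Ico 0 d) 0 :=
          hLip2.continuousOn 0 ⟨le_rfl, hd0⟩
        have h2 : ContinuousAt φ.symm (φ (δ 0)) := by
          rw [hδ0]; exact continuousAt_extChartAt_symm q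
        have h3 : ContinuousWithinAt (fun s ↦ φ.symm (φ (δ s))) (Ico 0 d) 0 :=
          ContinuousAt.comp_continuousWithinAt (f := fun s ↦ φ (δ s)) h2 h1
        exact (h3.congr (fun s hs ↦ (φ.left_inv (hsrc s hs)).symm)
          (φ.left_inv (hsrc 0 ⟨le_rfl, hd0⟩)).symm).mono_of_mem_nhdsWithin hnh
      · rw [hδ0]; exact hLip2
    · have h1 : IsLipschitzNear (fun s ↦ γ (ρ s)) (Icc 0 1 ∩ Ioi 0) s :=
        hX.isLipschitzNear_comp hγ (Filter.mem_of_superset (Ioi_mem_nhds hpos) fun t ht ↦ hρder t ht)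
          ((continuousAt_inv₀ hpos.ne').neg.div_const c) _
      exact (h1.congr ⟨hs, hpos⟩ fun t ht ↦ hδpos t ht.2).mono
        (nhdsWithin_le_iff.2 (inter_mem self_mem_nhdsWithin
          (mem_nhdsWithin_of_mem_nhds (Ioi_mem_nhds hpos))))
  · exact ((isHorizontalAt_of_hasMFDerivAt (hγ (ρ s)) (hD _)).comp (hρder s hs.1)).congr
      (hδev s hs.1)
  · rw [hδpos 1 one_pos]
    simp [hρ]

end Curves

/-! ### Without closed orbits, all points are joined -/

section Connecting

variable {S : Type*} [TopologicalSpace S] [ChartedSpace Plane S]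
  {X : (q : S) → TangentSpace (𝓡 2) q}

theorem linearization_neg (X : (q : S) → TangentSpace (𝓡 2) q) (q : S) :
    linearization (fun q ↦ -X q) q = -linearization X q := by
  have h : coordField (fun q ↦ -X q) q = fun y ↦ -coordField X q y := by
    funext y
    exact (chartDiff (E := Plane) q ((extChartAt (𝓡 2) q).symm y)).map_neg _
  rw [linearization_eq, linearization_eq, h, fderiv_fun_neg]

theorem det_neg_plane (A : Plane →L[ℝ] Plane) : (-A).det = A.det := by
  have h : (-A).toLinearMap = (-1 : ℝ) • A.toLinearMap := by ext; simp
  rw [ContinuousLinearMap.det, h, LinearMap.det_smul]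
  simp

theorem planeTrace_neg (A : Plane →L[ℝ] Plane) : planeTrace (-A) = -planeTrace A :=
  map_neg (LinearMap.trace ℝ Plane) A.toLinearMap

/-- A sink: a zero of the field, with a linearization of positive determinant and negative trace. -/
def IsSink (X : (q : S) → TangentSpace (𝓡 2) q) (q : S) : Prop :=
  X q = 0 ∧ 0 < (linearization X q).det ∧ planeTrace (linearization X q) < 0

theorem isSink_neg_iff {q : S} : IsSink (fun q ↦ -X q) q ↔
    X q = 0 ∧ 0 < (linearization X q).det ∧ 0 < planeTrace (linearization X q) := by
  unfold IsSink
  rw [linearization_neg, det_neg_plane, planeTrace_neg, neg_lt_zero]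
  exact and_congr_left' neg_eq_zero

variable [IsManifold (𝓡 2) ∞ S] [T2Space S]

theorem IsSmoothField.ne_zero_of_ne_zero (hX : IsSmoothField X) {γ : ℝ → S}
    (hγ : IsMIntegralCurve (I := 𝓡 2) γ X) {t₀ : ℝ} (h : X (γ t₀) ≠ 0) (t : ℝ) :
    X (γ t) ≠ 0 := fun h0 ↦ h <| by
  have := hX.integralCurve_eq hγ (isMIntegralCurve_const h0) (t := t) rfl
  rw [congrFun this t₀]
  exact h0

variable [CompactSpace S]

omit [CompactSpace S] in
/-- No trajectory other than the rest point comes from a sink. -/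
theorem IsSmoothField.eq_of_tendsto_atBot_sink (hX : IsSmoothField X) {q : S} (hq : IsSink X q)
    {γ : ℝ → S} (hγ : IsMIntegralCurve (I := 𝓡 2) γ X) (h : Tendsto γ atBot (𝓝 q)) (t : ℝ) :
    γ t = q := by
  obtain ⟨N, hN, C, hC, c, hc, hest⟩ := hX.exists_sink_nhds hq.1 hq.2.1 hq.2.2
  -- The sink estimate started at time `s` bounds the displacement at time `t` by `C` times the one
  -- at time `s`, which tends to zero as `s → -∞`.
  have hev : ∀ᶠ s in atBot, γ t ∈ (extChartAt (𝓡 2) q).source ∧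
      ‖disp q (γ t)‖ ≤ C * ‖disp q (γ s)‖ := by
    filter_upwards [h.eventually_mem hN, eventually_le_atBot t] with s hs hst
    have h1 := hest (fun u ↦ γ (u + s)) (hγ.comp_add s) (by simpa using hs) (t - s) (by linarith)
    simp only [sub_add_cancel, zero_add] at h1
    refine ⟨h1.1, h1.2.trans ?_⟩
    have : Real.exp (-c * (t - s)) ≤ 1 := Real.exp_le_one_iff.2 (by nlinarith)
    exact mul_le_of_le_one_right (by positivity) this
  obtain ⟨hsrc, -⟩ := hev.exists.choose_spec
  have hdisp : Tendsto (fun s ↦ C * ‖disp q (γ s)‖) atBot (𝓝 (C * ‖disp q q‖)) :=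
    ((((continuousOn_disp q).continuousAt (extChartAt_source_mem_nhds q)).tendsto.comp
      h).norm).const_mul C
  rw [disp_self, norm_zero, mul_zero] at hdisp
  have := ge_of_tendsto hdisp (hev.mono fun s hs ↦ hs.2)
  exact (disp_eq_zero_iff hsrc).1 (norm_le_zero_iff.1 this)

variable {M : Type*} [TopologicalSpace M] [ChartedSpace Space M] [IsManifold (𝓡 3) ∞ M]
  {ι : S → M} {𝓜 : ContactSubRiemannian M}

/-- The points of the basin of a sink are joined to the sink, and the basin is open. -/
theorem IsSmoothField.eventually_joined_sink (hX : IsSmoothField X)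
    (hD : ∀ q, mfderiv (𝓡 2) (𝓡 3) ι q (X q) ∈ 𝓜.D (ι q)) {x q : S} (hq : IsSink X q)
    (h : Tendsto (fun t ↦ flow X t x) atTop (𝓝 q)) : ∀ᶠ y in 𝓝 x, 𝓜.Joined ι y q := by
  obtain ⟨N, hN, C, hC, c, hc, hest⟩ := hX.exists_sink_nhds hq.1 hq.2.1 hq.2.2
  -- By a fixed time `T` the trajectory of `x` is inside the attracting neighbourhood, hence so are
  -- those of nearby points.
  obtain ⟨T, hT⟩ := (h.eventually_mem (interior_mem_nhds.2 hN)).exists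
  filter_upwards [(hX.continuous_flow T).continuousAt.eventually_mem
    (isOpen_interior.mem_nhds hT)] with y hy
  have hγ := (hX.isMIntegralCurve_flow y).comp_add T
  have h1 := hest _ hγ (by simpa using interior_subset hy)
  have h2 : 𝓜.Joined ι (flow X (0 + T) y) q :=
    -- Adding `1` keeps the constant positive when the point is the sink itself.
    hX.joined_of_tendsto hD (C := C * ‖disp q (flow X (0 + T) y)‖ + 1) hγ hq.1 (by positivity) hc
      fun t ht ↦ ⟨(h1 t ht).1, (h1 t ht).2.trans (by
        gcongr
        exact le_add_of_nonneg_right zero_le_one)⟩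
  have h3 := hX.joined hD (hX.isMIntegralCurve_flow y) 0 (0 + T)
  simp only [hX.flow_zero] at h3
  exact h3.trans h2

/-- The trajectories of the opposite field are the reversed trajectories. -/
theorem IsSmoothField.flow_neg_field (hX : IsSmoothField X) (t : ℝ) (x : S) :
    flow (fun q ↦ -X q) t x = flow X (-t) x := by
  have := hX.neg.eq_flow (hX.isMIntegralCurve_flow x).neg t
  simp only [neg_zero, hX.flow_zero] at this
  exact this.symm

theorem IsSmoothField.eventually_joined_source (hX : IsSmoothField X)
    (hD : ∀ q, mfderiv (𝓡 2) (𝓡 3) ι q (X q) ∈ 𝓜.D (ι q)) {x q : S}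
    (hq : IsSink (fun q ↦ -X q) q) (h : Tendsto (fun t ↦ flow X t x) atBot (𝓝 q)) :
    ∀ᶠ y in 𝓝 x, 𝓜.Joined ι y q := by
  refine hX.neg.eventually_joined_sink (fun p ↦ ?_) hq ?_
  · rw [map_neg]; exact neg_mem (hD p)
  · simp only [hX.flow_neg_field]
    exact h.comp tendsto_neg_atTop_atBot

omit [IsManifold (𝓡 2) ∞ S] [T2Space S] in
theorem tendsto_flow_of_omegaLimit_eq {f : Filter ℝ} {x q : S}
    (h : omegaLimit f (flow X) {x} = {q}) : Tendsto (fun t ↦ flow X t x) f (𝓝 q) := by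
  refine tendsto_nhds.2 fun v hv hq ↦ ?_
  filter_upwards [eventually_mapsTo_of_isOpen_of_omegaLimit_subset f (flow X) {x} hv
    (by rw [h]; exact singleton_subset_iff.2 hq)] with t ht
  exact ht rfl

omit [IsManifold (𝓡 2) ∞ S] [T2Space S] in
theorem exists_tendsto_flow {f : Filter ℝ} {x : S} (hno : ¬ ∃ C : Set S, IsClosedOrbit X C)
    (h : IsCriticalElement X (omegaLimit f (flow X) {x})) :
    ∃ q, X q = 0 ∧ Tendsto (fun t ↦ flow X t x) f (𝓝 q) := by
  rcases h with ⟨q, hq, h⟩ | h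
  · exact ⟨q, hq, tendsto_flow_of_omegaLimit_eq h⟩
  · exact (hno ⟨_, h⟩).elim

omit [IsManifold (𝓡 2) ∞ S] [T2Space S] [CompactSpace S] in
/-- Punctured neighbourhoods of a point of a surface contain a connected one. -/
theorem exists_isPreconnected_punctured (q : S) {U : Set S} (hU : U ∈ 𝓝 q) :
    ∃ A ⊆ U, IsPreconnected A ∧ A ∪ {q} ∈ 𝓝 q ∧ q ∉ A := by
  set φ := extChartAt (𝓡 2) q with hφ
  have h1 : φ.target ∩ φ.symm ⁻¹' U ∈ 𝓝 (φ q) := by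
    refine inter_mem (extChartAt_target_mem_nhds q) ((continuousAt_extChartAt_symm q).preimage_mem_nhds ?_)
    rwa [extChartAt_to_inv]
  obtain ⟨ρ, hρ, hρU⟩ := Metric.mem_nhds_iff.1 h1
  have hrank : 1 < Module.rank ℝ Plane := by
    rw [← Module.finrank_eq_rank, finrank_euclideanSpace_fin]; norm_num
  -- The ball is parametrized by the whole plane, whose complement of the origin is connected.
  set b := OpenPartialHomeomorph.univBall (φ q) ρ with hb
  have hbt : b.target = Metric.ball (φ q) ρ := OpenPartialHomeomorph.univBall_target _ hρ
  have hbs : b.source = univ := OpenPartialHomeomorph.univBall_source _ _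
  have hb0 : b 0 = φ q := OpenPartialHomeomorph.univBall_apply_zero _ _
  have hball : ∀ v, b v ∈ Metric.ball (φ q) ρ := fun v ↦ by
    rw [← hbt]; exact b.map_source (by rw [hbs]; trivial)
  have hcont : ContinuousOn (fun v ↦ φ.symm (b v)) ({0}ᶜ : Set Plane) :=
    (continuousOn_extChartAt_symm q).comp
      (OpenPartialHomeomorph.continuous_univBall (φ q) ρ).continuousOn fun v _ ↦ (hρU (hball v)).1
  refine ⟨(fun v ↦ φ.symm (b v)) '' {0}ᶜ, ?_,
    ((isConnected_compl_singleton_of_one_lt_rank hrank 0).image _ hcont).isPreconnected, ?_, ?_⟩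
  · rintro _ ⟨v, -, rfl⟩
    exact (hρU (hball v)).2
  · filter_upwards [extChartAt_source_mem_nhds (I := 𝓡 2) q,
      (continuousAt_extChartAt (I := 𝓡 2) q).eventually_mem (Metric.ball_mem_nhds _ hρ)] with x h2 h3
    by_cases hx : x = q
    · exact Or.inr hx
    refine Or.inl ⟨b.symm (φ x), fun h0 ↦ hx ?_, ?_⟩
    · have h4 : b (b.symm (φ x)) = φ x := b.right_inv (by rw [hbt]; exact h3)
      rw [show b.symm (φ x) = 0 from h0, hb0] at h4
      exact φ.injOn h2 (mem_extChartAt_source q) h4.symm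
    · simp only
      rw [b.right_inv (by rw [hbt]; exact h3), φ.left_inv h2]
  · rintro ⟨v, hv, h⟩
    refine hv ?_
    have h4 : b v = b 0 := by
      rw [hb0, ← φ.right_inv (hρU (hball v)).1]
      exact congrArg φ h
    exact b.injOn (by rw [hbs]; trivial) (by rw [hbs]; trivial) h4

/-- If there are no closed orbits, then nearby points are joined, away from the saddles. -/
theorem IsMorseSmale.eventually_joined (hMS : IsMorseSmale X)
    (hD : ∀ q, mfderiv (𝓡 2) (𝓡 3) ι q (X q) ∈ 𝓜.D (ι q))
    (htr : ∀ q, X q = 0 → planeTrace (linearization X q) ≠ 0)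
    (hno : ¬ ∃ C : Set S, IsClosedOrbit X C) {x : S} (hx : ¬ IsSaddle X x) :
    ∀ᶠ y in 𝓝 x, 𝓜.Joined ι x y := by
  have hX : IsSmoothField X := hMS.smooth
  have htype : ∀ q, X q = 0 → IsSaddle X q ∨ IsSink X q ∨ IsSink (fun q ↦ -X q) q := by
    intro q hq
    rcases lt_or_gt_of_ne (hMS.nondegenerate_criticalPoints q hq).2 with h | h
    · exact Or.inl ⟨hq, h⟩
    rcases lt_or_gt_of_ne (htr q hq) with h' | h'
    · exact Or.inr (Or.inl ⟨hq, h, h'⟩)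
    · exact Or.inr (Or.inr (isSink_neg_iff.2 ⟨hq, h, h'⟩))
  -- It is enough to join all nearby points, `x` included, to one common zero.
  suffices h : ∃ q, ∀ᶠ y in 𝓝 x, 𝓜.Joined ι y q by
    obtain ⟨q, hq⟩ := h
    exact hq.mono fun y hy ↦ hq.self_of_nhds.trans hy.symm
  have hγ := hX.isMIntegralCurve_flow x
  obtain ⟨q₁, hq₁, h₁⟩ := exists_tendsto_flow hno (hMS.omegaLimit_eq x)
  obtain ⟨q₂, hq₂, h₂⟩ := exists_tendsto_flow hno (hMS.alphaLimit_eq x)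
  by_cases hx0 : X x = 0
  · have hconst : (fun t ↦ flow X t x) = fun _ ↦ x :=
      hX.integralCurve_eq hγ (isMIntegralCurve_const hx0) (hX.flow_zero x)
    rcases htype x hx0 with h | h | h
    · exact (hx h).elim
    · exact ⟨x, hX.eventually_joined_sink hD h (by rw [hconst]; exact tendsto_const_nhds)⟩
    · exact ⟨x, hX.eventually_joined_source hD h (by rw [hconst]; exact tendsto_const_nhds)⟩
  have heq : ∀ y, y = x → X y ≠ 0 := by rintro _ rfl; exact hx0
  have hne : ∀ t, X (flow X t x) ≠ 0 :=
    hX.ne_zero_of_ne_zero hγ (t₀ := 0) (heq _ (hX.flow_zero x))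
  -- A nonconstant trajectory neither enters a source nor comes out of a sink, and its two limits
  -- are not both saddles: either it ends at a sink or it begins at a source.
  rcases htype q₁ hq₁ with h | h | h
  · rcases htype q₂ hq₂ with h' | h' | h'
    · exact (hMS.no_saddleConnection _ ⟨hγ, hne, q₂, q₁, h', h, h₂, h₁⟩).elim
    · have := hX.eq_of_tendsto_atBot_sink h' hγ h₂ 0
      simp only [hX.flow_zero] at this
      exact (hx0 (this ▸ hq₂)).elim
    · exact ⟨q₂, hX.eventually_joined_source hD h' h₂⟩
  · exact ⟨q₁, hX.eventually_joined_sink hD h h₁⟩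
  · have := hX.neg.eq_of_tendsto_atBot_sink h hγ.neg (h₁.comp tendsto_neg_atBot_atTop) 0
    simp only [neg_zero, hX.flow_zero] at this
    exact (hx0 (this ▸ hq₁)).elim

/-- If there are no closed orbits, then nearby points are joined, also near saddles. -/
theorem IsMorseSmale.eventually_joined_saddle (hMS : IsMorseSmale X)
    (hD : ∀ q, mfderiv (𝓡 2) (𝓡 3) ι q (X q) ∈ 𝓜.D (ι q))
    (htr : ∀ q, X q = 0 → planeTrace (linearization X q) ≠ 0)
    (hno : ¬ ∃ C : Set S, IsClosedOrbit X C) {q : S} (hq : IsSaddle X q) :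
    ∀ᶠ y in 𝓝 q, 𝓜.Joined ι q y := by
  have hX : IsSmoothField X := hMS.smooth
  have hU : ({p : S | IsCriticalPoint X p} \ {q})ᶜ ∈ 𝓝 q :=
    (hMS.finite_criticalPoints.subset sdiff_subset).isClosed.isOpen_compl.mem_nhds
      fun h ↦ h.2 rfl
  obtain ⟨A, hAU, hA, hAq, hqA⟩ := exists_isPreconnected_punctured q hU
  have hnc : ∀ x ∈ A, ¬ IsSaddle X x := fun x hx hs ↦
    hAU hx ⟨hs.1, fun h ↦ hqA (h ▸ hx)⟩
  -- The punctured neighbourhood `A` contains no saddle, so the classes are locally constant along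
  -- it, and it is connected.
  have hAJ : ∀ x ∈ A, ∀ y ∈ A, 𝓜.Joined ι x y := fun x hx y hy ↦
    hA.induction₂ (fun x y ↦ 𝓜.Joined ι x y)
      (fun x hx ↦ mem_nhdsWithin_of_mem_nhds (hMS.eventually_joined hD htr hno (hnc x hx)))
      (fun _ _ _ _ _ _ h h' ↦ h.trans h') (fun _ _ _ _ h ↦ h.symm) hx hy
  obtain ⟨γ, hγ, hγ0, C, hC, c, hc, hest⟩ := hX.exists_trajectory_to_saddle hq.1 hq.2
  have hγq : 𝓜.Joined ι (γ 0) q := hX.joined_of_tendsto hD hγ hq.1 hC hc hest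
  have htend : Tendsto γ atTop (𝓝 q) := by
    have h1 : Tendsto (fun t ↦ disp q (γ t)) atTop (𝓝 0) := by
      refine squeeze_zero_norm' (eventually_ge_atTop 0 |>.mono fun t ht ↦ (hest t ht).2) ?_
      have : Tendsto (fun t : ℝ ↦ Real.exp (-c * t)) atTop (𝓝 0) :=
        Real.tendsto_exp_atBot.comp (tendsto_id.const_mul_atTop_of_neg (neg_lt_zero.2 hc))
      simpa using this.const_mul C
    have h2 : Tendsto (fun t ↦ extChartAt (𝓡 2) q (γ t)) atTop (𝓝 (extChartAt (𝓡 2) q q)) := by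
      have := h1.add_const (extChartAt (𝓡 2) q q)
      simpa [disp] using this
    have h3 := (continuousAt_extChartAt_symm (I := 𝓡 2) q).tendsto.comp h2
    rw [extChartAt_to_inv] at h3
    refine h3.congr' ((eventually_ge_atTop 0).mono fun t ht ↦ ?_)
    exact (extChartAt (𝓡 2) q).left_inv (hest t ht).1
  -- The trajectory that tends to the saddle passes through `A` and so links the saddle to it.
  obtain ⟨t, ht⟩ := (htend.eventually_mem hAq).exists
  have htA : γ t ∈ A := by
    refine ht.resolve_right fun h ↦ hγ0 ?_
    have h : γ t = q := h
    have := hX.integralCurve_eq hγ (isMIntegralCurve_const (x := q) hq.1) (t := t) h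
    exact congrFun this 0
  filter_upwards [hAq] with y hy
  rcases hy with hy | hy
  · exact hγq.symm.trans ((hX.joined hD hγ 0 t).trans (hAJ _ htA y hy))
  · rw [show y = q from hy]; exact .refl q

/-- If there are no closed orbits, then any two points are joined. -/
theorem IsMorseSmale.joined [ConnectedSpace S] (hMS : IsMorseSmale X)
    (hD : ∀ q, mfderiv (𝓡 2) (𝓡 3) ι q (X q) ∈ 𝓜.D (ι q))
    (htr : ∀ q, X q = 0 → planeTrace (linearization X q) ≠ 0)
    (hno : ¬ ∃ C : Set S, IsClosedOrbit X C) (p q : S) : 𝓜.Joined ι p q := by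
  have : Std.Symm (fun p q : S ↦ 𝓜.Joined ι p q) := ⟨fun _ _ h ↦ h.symm⟩
  refine PreconnectedSpace.induction₂ (fun p q : S ↦ 𝓜.Joined ι p q) (fun x ↦ ?_)
    ⟨fun _ _ _ h h' ↦ h.trans h'⟩ p q
  by_cases hx : IsSaddle X x
  · exact hMS.eventually_joined_saddle hD htr hno hx
  · exact hMS.eventually_joined hD htr hno hx

end Connecting

/-! ### Lipschitz curves tangent to a field move along its trajectories -/

section Reparametrization

variable {E : Type*} [NormedAddCommGroup E] [InnerProductSpace ℝ E]

/-- The mean value inequality for Lipschitz curves, with a bound on the derivative that holds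
almost everywhere. -/
theorem LipschitzOnWith.norm_sub_le_of_ae_hasDerivAt {w : ℝ → E} {K : ℝ≥0} {a b C : ℝ}
    (hab : a ≤ b) (hw : LipschitzOnWith K w (Icc a b))
    (hC : ∀ᵐ t, t ∈ Ioo a b → ∃ v, HasDerivAt w v t ∧ ‖v‖ ≤ C) : ‖w b - w a‖ ≤ C * (b - a) := by
  set e := w b - w a with he
  -- Pairing with the total increment `e` reduces to a scalar Lipschitz function, for which the
  -- fundamental theorem of calculus holds; its increment is `‖e‖ ^ 2`.
  set g : ℝ → ℝ := fun t ↦ ⟪e, w t⟫_ℝ with hg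
  have hgL : LipschitzOnWith (‖e‖₊ * K) g (uIcc a b) := by
    rw [uIcc_of_le hab]
    refine LipschitzOnWith.of_dist_le_mul fun x hx y hy ↦ ?_
    rw [Real.dist_eq, hg, ← inner_sub_right]
    refine (abs_real_inner_le_norm _ _).trans ?_
    rw [NNReal.coe_mul, coe_nnnorm, mul_assoc]
    gcongr
    exact (dist_eq_norm (w x) (w y)).symm.trans_le (hw.dist_le_mul x hx y hy)
  have h1 := hgL.absolutelyContinuousOnInterval.integral_deriv_eq_sub
  have h2 : g b - g a = ‖e‖ ^ 2 := by
    rw [hg]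
    simp only
    rw [← inner_sub_right, ← he, real_inner_self_eq_norm_sq]
  have hne : ∀ᵐ t : ℝ, t ≠ b := by simp [ae_iff, measure_singleton]
  have h3 : ∀ᵐ t, t ∈ uIoc a b → ‖deriv g t‖ ≤ ‖e‖ * C := by
    filter_upwards [hC, hne] with t h hb ht
    rw [uIoc_of_le hab] at ht
    obtain ⟨v, hv, hvC⟩ := h ⟨ht.1, lt_of_le_of_ne ht.2 hb⟩
    have h4 : HasDerivAt g ⟪e, v⟫_ℝ t := by
      have := (hasDerivAt_const t e).inner ℝ hv
      simpa using this
    rw [h4.deriv]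
    exact (abs_real_inner_le_norm _ _).trans (by gcongr)
  have h5 := intervalIntegral.norm_integral_le_of_norm_le_const_ae h3
  rw [h1, h2, Real.norm_eq_abs, abs_of_nonneg (sq_nonneg _), abs_of_nonneg (sub_nonneg.2 hab)] at h5
  -- The sign of `C` is not given: it follows from a time at which the bound holds.
  by_cases h0 : ‖e‖ = 0
  · rw [h0]
    rcases eq_or_lt_of_le hab with rfl | hlt
    · simp
    · have : ∃ᵐ t, t ∈ Ioo a b := by
        intro h
        have h' : volume (Ioo a b) = 0 := by simpa only [not_not, ofPred_mem_eq] using ae_iff.1 h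
        rw [Real.volume_Ioo, ENNReal.ofReal_eq_zero] at h'
        linarith
      obtain ⟨t, ht, h⟩ := (this.and_eventually hC).exists
      obtain ⟨v, -, hv⟩ := h ht
      exact mul_nonneg ((norm_nonneg v).trans hv) (by linarith)
  · have h6 : 0 < ‖e‖ := lt_of_le_of_ne (norm_nonneg _) (Ne.symm h0)
    nlinarith

variable [FiniteDimensional ℝ E] [MeasurableSpace E] [BorelSpace E]

/-- A Lipschitz curve which is almost everywhere tangent to a nonvanishing Lipschitz field `f`
moves along the integral curve of `f`. -/
theorem exists_eq_integralCurve_of_ae_tangent {f : E → E} {B : Set E} {L K : ℝ≥0} {m : ℝ}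
    (hm : 0 < m) (hfL : LipschitzOnWith L f B) (hfm : ∀ y ∈ B, m ≤ ‖f y‖) {u : ℝ → E}
    (hu : LipschitzWith K u) (huB : ∀ t, u t ∈ B) {t₀ t₁ : ℝ} (ht : t₀ < t₁)
    (hud : ∀ᵐ t, t ∈ Ioo t₀ t₁ → ∃ c : ℝ, HasDerivAt u (c • f (u t)) t) {b : ℝ → E} {η : ℝ}
    (hη : 0 < η) (hb0 : b 0 = u t₀)
    (hb : ∀ s ∈ Ioo (-η) η, b s ∈ B ∧ HasDerivAt b (f (b s)) s) :
    ∃ ε > 0, ∀ t ∈ Ico t₀ (t₀ + ε), ∃ s ∈ Ioo (-η) η, b s = u t := by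
  have hfu : Continuous (fun t ↦ f (u t)) := hfL.continuousOn.comp_continuous hu.continuous huB
  -- The proportionality factor, written as an orthogonal projection so as to be measurable and
  -- bounded.
  set c : ℝ → ℝ := fun t ↦ ⟪deriv u t, f (u t)⟫_ℝ / ‖f (u t)‖ ^ 2 with hc
  have hcm : Measurable c :=
    ((measurable_deriv u).inner hfu.measurable).div (hfu.norm.pow 2).measurable
  set κ : ℝ := K / m with hκ
  have hκ0 : 0 ≤ κ := by positivity
  have hcκ : ∀ t, ‖c t‖ ≤ κ := by
    intro t
    have h1 := hfm (u t) (huB t)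
    have h2 : 0 < ‖f (u t)‖ := hm.trans_le h1
    rw [hc, hκ, Real.norm_eq_abs, abs_div, abs_of_nonneg (sq_nonneg ‖f (u t)‖),
      div_le_div_iff₀ (by positivity) hm]
    calc |⟪deriv u t, f (u t)⟫_ℝ| * m ≤ (K * ‖f (u t)‖) * ‖f (u t)‖ := by
          gcongr
          exact (abs_real_inner_le_norm _ _).trans (by
            gcongr; exact norm_deriv_le_of_lipschitz hu)
      _ = _ := by ring
  have hcint : LocallyIntegrable c volume :=
    (locallyIntegrable_const κ).mono hcm.aestronglyMeasurable (Eventually.of_forall fun t ↦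
      (hcκ t).trans (le_abs_self κ))
  have hcii : ∀ x y, IntervalIntegrable c volume x y := fun x y ↦
    (hcint.integrableOn_isCompact isCompact_uIcc).intervalIntegrable
  have hcd : ∀ᵐ t, t ∈ Ioo t₀ t₁ → HasDerivAt u (c t • f (u t)) t := by
    filter_upwards [hud] with t h hmem
    obtain ⟨c', hc'⟩ := h hmem
    have h2 : ‖f (u t)‖ ≠ 0 := (hm.trans_le (hfm (u t) (huB t))).ne'
    have : c t = c' := by
      rw [hc]
      simp only
      rw [hc'.deriv, real_inner_smul_left, real_inner_self_eq_norm_sq]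
      field_simp
    rwa [this]
  -- The change of time: `b ∘ θ` and `u` have the same initial value and both satisfy `y' = c f(y)`
  -- almost everywhere.
  set θ : ℝ → ℝ := fun t ↦ ∫ s in t₀..t, c s with hθ
  have hθ0 : θ t₀ = 0 := intervalIntegral.integral_same
  have hθL : ∀ x y, |θ y - θ x| ≤ κ * |y - x| := by
    intro x y
    rw [hθ]
    simp only
    rw [intervalIntegral.integral_interval_sub_left (hcii _ _) (hcii _ _)]
    exact intervalIntegral.norm_integral_le_of_norm_le_const fun t _ ↦ hcκ t
  -- The three terms keep `t` below `t₁`, keep `θ` inside `(-η, η)` where `b` is controlled, and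
  -- ensure `κ * L * ε < 1`.
  set ε := min ((t₁ - t₀) / 2) (min (η / (2 * (κ + 1))) (1 / (2 * (κ * L + 1)))) with hε
  have hε0 : 0 < ε := by
    refine lt_min (by linarith) (lt_min (by positivity) (by positivity))
  have hεt : t₀ + ε < t₁ := by
    have : ε ≤ (t₁ - t₀) / 2 := min_le_left _ _
    linarith
  have hεη : κ * ε < η := by
    have h1 : ε ≤ η / (2 * (κ + 1)) := (min_le_right _ _).trans (min_le_left _ _)
    rw [le_div_iff₀ (by positivity)] at h1
    nlinarith
  have hεL : κ * L * ε < 1 := by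
    have h1 : ε ≤ 1 / (2 * (κ * L + 1)) := (min_le_right _ _).trans (min_le_right _ _)
    rw [le_div_iff₀ (by positivity)] at h1
    have : 0 ≤ κ * L := by positivity
    nlinarith
  have hθmem : ∀ t ∈ Icc t₀ (t₀ + ε), θ t ∈ Icc (-(κ * ε)) (κ * ε) := by
    intro t h
    have h1 := hθL t₀ t
    rw [hθ0, sub_zero, abs_of_nonneg (sub_nonneg.2 h.1)] at h1
    rw [← abs_le.trans mem_Icc.symm]
    exact h1.trans (by gcongr; linarith [h.2])
  have hsub : Icc (-(κ * ε)) (κ * ε) ⊆ Ioo (-η) η := fun s hs ↦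
    ⟨by linarith [hs.1], by linarith [hs.2]⟩
  have hbc : ContinuousOn (fun s ↦ f (b s)) (Icc (-(κ * ε)) (κ * ε)) :=
    hfL.continuousOn.comp (fun s hs ↦ (hb s (hsub hs)).2.continuousAt.continuousWithinAt)
      fun s hs ↦ (hb s (hsub hs)).1
  obtain ⟨F, hF⟩ := isCompact_Icc.exists_bound_of_continuousOn hbc
  have hF0 : 0 ≤ F := (norm_nonneg _).trans (hF 0 ⟨by simp; positivity, by positivity⟩)
  have hbL : LipschitzOnWith ⟨F, hF0⟩ b (Icc (-(κ * ε)) (κ * ε)) :=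
    (convex_Icc _ _).lipschitzOnWith_of_nnnorm_hasDerivWithin_le
      (fun s hs ↦ (hb s (hsub hs)).2.hasDerivWithinAt) fun s hs ↦ hF s hs
  have hθL' : LipschitzOnWith ⟨κ, hκ0⟩ θ (Icc t₀ (t₀ + ε)) :=
    LipschitzOnWith.of_dist_le_mul fun x _ y _ ↦ hθL y x
  set w : ℝ → E := fun t ↦ u t - b (θ t) with hw
  have hwL : LipschitzOnWith (K + ⟨F, hF0⟩ * ⟨κ, hκ0⟩) w (Icc t₀ (t₀ + ε)) :=
    hu.lipschitzOnWith.sub (hbL.comp hθL' hθmem)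
  have hw0 : w t₀ = 0 := by simp [hw, hθ0, hb0]
  -- Where `‖w‖` is largest, integrating `‖w'‖ ≤ κ * L * ‖w‖` bounds this maximum by a factor less
  -- than one times itself, so `w = 0`.
  obtain ⟨τ, hτ, hmax⟩ := isCompact_Icc.exists_isMaxOn (nonempty_Icc.2 (by linarith : t₀ ≤ t₀ + ε))
    hwL.continuousOn.norm
  have hwτ : ‖w τ - w t₀‖ ≤ κ * (L * ‖w τ‖) * (τ - t₀) := by
    refine LipschitzOnWith.norm_sub_le_of_ae_hasDerivAt hτ.1
      (hwL.mono (Icc_subset_Icc_right hτ.2)) ?_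
    filter_upwards [hcd, _root_.LocallyIntegrable.ae_hasDerivAt_integral hcint] with t h1 h2 hmem
    have htI : t ∈ Icc t₀ (t₀ + ε) := ⟨hmem.1.le, hmem.2.le.trans hτ.2⟩
    have h3 := (hb (θ t) (hsub (hθmem t htI))).2.scomp t (h2 t₀)
    refine ⟨_, (h1 ⟨hmem.1, by linarith [hmem.2, hτ.2]⟩).sub h3, ?_⟩
    rw [← smul_sub, norm_smul]
    refine mul_le_mul (hcκ t) ?_ (norm_nonneg _) hκ0
    refine (hfL.norm_sub_le (huB t) (hb (θ t) (hsub (hθmem t htI))).1).trans ?_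
    gcongr
    exact hmax htI
  rw [hw0, sub_zero] at hwτ
  have hτ0 : ‖w τ‖ = 0 := by
    have h1 : κ * (L * ‖w τ‖) * (τ - t₀) ≤ (κ * L * ε) * ‖w τ‖ := by
      calc κ * (L * ‖w τ‖) * (τ - t₀) ≤ κ * (L * ‖w τ‖) * ε := by gcongr; linarith [hτ.2]
        _ = _ := by ring
    nlinarith [norm_nonneg (w τ)]
  refine ⟨ε, hε0, fun t h ↦ ⟨θ t, hsub (hθmem t ⟨h.1, h.2.le⟩), ?_⟩⟩
  have h1 : ‖w t‖ ≤ ‖w τ‖ := hmax ⟨h.1, h.2.le⟩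
  rw [hτ0] at h1
  exact (sub_eq_zero.1 (norm_le_zero_iff.1 h1)).symm

end Reparametrization

/-! ### Admissible curves cannot leave a closed orbit -/

section ClosedOrbits

variable {S : Type*} [TopologicalSpace S] [ChartedSpace Plane S] [IsManifold (𝓡 2) ∞ S]
  {X : (q : S) → TangentSpace (𝓡 2) q}

theorem IsMIntegralCurve.hasStrictDerivAt_chart (hX : IsSmoothField X) {γ : ℝ → S}
    (hγ : IsMIntegralCurve (I := 𝓡 2) γ X) {q : S} {t : ℝ}
    (hq : γ t ∈ (extChartAt (𝓡 2) q).source) :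
    HasStrictDerivAt (fun s ↦ extChartAt (𝓡 2) q (γ s))
      (coordField X q (extChartAt (𝓡 2) q (γ t))) t := by
  have hmem := hγ.continuous.continuousAt.eventually_mem
    ((isOpen_extChartAt_source (I := 𝓡 2) q).mem_nhds hq)
  refine hasStrictDerivAt_of_hasDerivAt_of_continuousAt
    (hmem.mono fun s hs ↦ hγ.hasDerivAt_chart hs) ?_
  exact ContinuousAt.comp (g := coordField X q)
    (hX.contDiffAt_coordField ((extChartAt (𝓡 2) q).map_source hq)).continuousAt
    (hγ.hasDerivAt_chart hq).continuousAt

/-- A trajectory does not fill a surface. -/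
theorem IsSmoothField.range_ne_univ (hX : IsSmoothField X) {γ : ℝ → S}
    (hγ : IsMIntegralCurve (I := 𝓡 2) γ X) : range γ ≠ univ := by
  intro h
  set p := γ 0
  set φ := extChartAt (𝓡 2) p with hφ
  have h1 : φ.target ⊆ (fun s ↦ φ (γ s)) '' (γ ⁻¹' φ.source) := by
    intro y hy
    obtain ⟨s, hs⟩ : φ.symm y ∈ range γ := by rw [h]; trivial
    refine ⟨s, ?_, ?_⟩
    · rw [mem_preimage, hs]; exact φ.map_target hy
    · simp only
      rw [hs, φ.right_inv hy]
  -- A locally Lipschitz image of a subset of the line has Hausdorff dimension at most one, while an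
  -- open subset of the plane has dimension two.
  have h2 : dimH ((fun s ↦ φ (γ s)) '' (γ ⁻¹' φ.source)) ≤ 1 := by
    refine (dimH_image_le_of_locally_lipschitzOn fun s hs ↦ ?_).trans
      ((dimH_mono (subset_univ _)).trans Real.dimH_univ.le)
    obtain ⟨K, u, hu, hK⟩ :=
      (hγ.hasStrictDerivAt_chart hX hs).hasStrictFDerivAt.exists_lipschitzOnWith
    exact ⟨K, u, mem_nhdsWithin_of_mem_nhds hu, hK⟩
  have h3 : dimH φ.target = 2 := by
    have := Real.dimH_of_mem_nhds ((isOpen_extChartAt_target (I := 𝓡 2) p).mem_nhds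
      (mem_extChartAt_target p))
    rw [this, finrank_euclideanSpace_fin]
    rfl
  have h4 := (h3.symm.le.trans (dimH_mono h1)).trans h2
  exact absurd h4 (by norm_num)

variable {M : Type*} [TopologicalSpace M] [ChartedSpace Space M] [IsManifold (𝓡 3) ∞ M]
  {ι : S → M} {𝓜 : ContactSubRiemannian M}

/-- Where `X` does not vanish, the velocity of an admissible curve is a multiple of `X`. -/
theorem ContactSubRiemannian.IsCharacteristicVectorField.exists_hasDerivAt_chart
    (hX : 𝓜.IsCharacteristicVectorField ι X) {γ : ℝ → S} {t : ℝ} (h : 𝓜.IsHorizontalAt ι γ t)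
    (h0 : X (γ t) ≠ 0) {q : S} (hq : γ t ∈ (extChartAt (𝓡 2) q).source) :
    ∃ c : ℝ, HasDerivAt (fun s ↦ extChartAt (𝓡 2) q (γ s))
      (c • coordField X q (extChartAt (𝓡 2) q (γ t))) t := by
  have h1 : velocity γ t ∈ 𝓜.traceAt ι (γ t) := h.2
  rw [hX.span_eq _ fun h ↦ h0 (hX.eq_zero _ h)] at h1
  obtain ⟨c, hc⟩ := Submodule.mem_span_singleton.1 h1
  refine ⟨c, ?_⟩
  have h2 := chartDiff_velocity h.1 hq
  have h3 : chartDiff (E := Plane) q (γ t) (velocity γ t) =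
      c • coordField X q (extChartAt (𝓡 2) q (γ t)) := by
    rw [coordField_extChartAt X hq, ← hc]
    exact (chartDiff (E := Plane) q (γ t)).map_smul c _
  rwa [h3] at h2

/-- Admissible curves move along the trajectories, away from the zeros of `X`. -/
theorem ContactSubRiemannian.IsCharacteristicVectorField.eventually_mem_range
    (hX : 𝓜.IsCharacteristicVectorField ι X) {γ : ℝ → S} {T : ℝ} (hγ : 𝓜.IsAdmissible ι γ T)
    {β : ℝ → S} (hβ : IsMIntegralCurve (I := 𝓡 2) β X) (hβ0 : ∀ s, X (β s) ≠ 0) {t₀ : ℝ}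
    (ht₀ : t₀ ∈ Ico 0 T) (hmem : γ t₀ ∈ range β) : ∀ᶠ t in 𝓝[>] t₀, γ t ∈ range β := by
  have hXs : IsSmoothField X := hX.smooth
  obtain ⟨s₀, hs₀⟩ := hmem
  obtain ⟨hT, hL, hH⟩ := isAdmissible_iff.1 hγ
  obtain ⟨hc, u, hu, K, hK⟩ := hL t₀ ⟨ht₀.1, ht₀.2.le⟩
  set p := γ t₀ with hp
  set φ := extChartAt (𝓡 2) p with hφ
  have hf0 : coordField X p (φ p) ≠ 0 := by
    rw [coordField_extChartAt X (mem_extChartAt_source p)]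
    have hXp : X p ≠ 0 := by rw [← hs₀]; exact hβ0 s₀
    exact fun h ↦ hXp ((chartDiff_eq_zero_iff (mem_extChartAt_source p) _).1 h)
  have hfs := hXs.contDiffAt_coordField (mem_extChartAt_target (I := 𝓡 2) p)
  obtain ⟨L, V, hV, hVL⟩ := (hfs.of_le (m := 1) (by simp)).exists_lipschitzOnWith
  set m := ‖coordField X p (φ p)‖ / 2 with hm
  have hm0 : 0 < m := half_pos (norm_pos_iff.2 hf0)
  -- A neighbourhood on which the coordinate field is Lipschitz and bounded away from zero.
  set B := V ∩ φ.target ∩ {y | m ≤ ‖coordField X p y‖} with hB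
  have hBn : B ∈ 𝓝 (φ p) := inter_mem (inter_mem hV (extChartAt_target_mem_nhds p))
    ((hfs.continuousAt.norm.eventually_const_lt (half_lt_self (norm_pos_iff.2 hf0))).mono
      fun _ h ↦ h.le)
  -- a time interval on which the curve is Lipschitz in the chart
  have h1 : ∀ᶠ t in 𝓝[Icc 0 T] t₀, γ t ∈ φ.source ∧ φ (γ t) ∈ B :=
    (hc.eventually_mem (extChartAt_source_mem_nhds p)).and
      ((ContinuousAt.comp_continuousWithinAt (g := φ) (continuousAt_extChartAt p) hc).eventually_mem
        hBn)
  obtain ⟨δ, hδ, hδs⟩ := Metric.mem_nhdsWithin_iff.1 (inter_mem hu h1)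
  set t₁ := min T (t₀ + δ / 2) with ht₁
  have h01 : t₀ < t₁ := lt_min ht₀.2 (by linarith)
  have hI : Icc t₀ t₁ ⊆ Icc 0 T := Icc_subset_Icc ht₀.1 (min_le_left _ _)
  have hIu : ∀ t ∈ Icc t₀ t₁, t ∈ u ∧ γ t ∈ φ.source ∧ φ (γ t) ∈ B := by
    intro t ht
    refine hδs ⟨?_, hI ht⟩
    have : t ≤ t₀ + δ / 2 := ht.2.trans (min_le_right _ _)
    rw [Metric.mem_ball, Real.dist_eq, abs_of_nonneg (by linarith [ht.1])]
    linarith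
  -- The curve is frozen outside `[t₀, t₁]`, which makes it Lipschitz on the whole line.
  set w : ℝ → Plane := fun t ↦ φ (γ (projIcc t₀ t₁ h01.le t)) with hw
  have hweq : ∀ t ∈ Icc t₀ t₁, w t = φ (γ t) := fun t ht ↦ by
    rw [hw]; simp only; rw [projIcc_of_mem h01.le ht]
  have hwL : LipschitzWith K w := by
    refine LipschitzWith.of_dist_le_mul fun x y ↦ ?_
    refine (hK.dist_le_mul _ (hIu _ (projIcc t₀ t₁ h01.le x).2).1 _
      (hIu _ (projIcc t₀ t₁ h01.le y).2).1).trans ?_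
    gcongr
    have := (LipschitzWith.projIcc h01.le).dist_le_mul x y
    rwa [NNReal.coe_one, one_mul] at this
  have hwB : ∀ t, w t ∈ B := fun t ↦ (hIu _ (projIcc t₀ t₁ h01.le t).2).2.2
  have hwd : ∀ᵐ t, t ∈ Ioo t₀ t₁ → ∃ c : ℝ, HasDerivAt w (c • coordField X p (w t)) t := by
    filter_upwards [hH] with t h ht
    have ht' := Ioo_subset_Icc_self ht
    have h2 := hIu t ht'
    have h3 : X (γ t) ≠ 0 := by
      intro h0
      have h4 : m ≤ ‖coordField X p (φ (γ t))‖ := h2.2.2.2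
      rw [coordField_extChartAt X h2.2.1, (chartDiff_eq_zero_iff h2.2.1 _).2 h0, norm_zero] at h4
      linarith
    obtain ⟨c, hc⟩ := hX.exists_hasDerivAt_chart
      (h ⟨ht₀.1.trans_lt ht.1, ht.2.trans_le (min_le_left _ _)⟩) h3 h2.2.1
    refine ⟨c, ?_⟩
    rw [hweq t ht']
    refine hc.congr_of_eventuallyEq ?_
    filter_upwards [Icc_mem_nhds ht.1 ht.2] with s hs using hweq s hs
  -- the trajectory in the chart
  have hbc : ContinuousAt (fun s ↦ β (s + s₀)) 0 :=
    (hβ.comp_add s₀).continuous.continuousAt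
  have hb00 : β (0 + s₀) = p := by rw [zero_add, hs₀]
  have h2 : ∀ᶠ s in 𝓝 (0 : ℝ), β (s + s₀) ∈ φ.source ∧ φ (β (s + s₀)) ∈ B := by
    refine (hbc.eventually_mem ?_).and ((ContinuousAt.comp (g := φ) ?_ hbc).eventually_mem ?_)
    · rw [hb00]; exact extChartAt_source_mem_nhds p
    · rw [hb00]; exact continuousAt_extChartAt p
    · rw [Function.comp_apply, hb00]; exact hBn
  obtain ⟨η, hη, hηs⟩ := Metric.eventually_nhds_iff_ball.1 h2
  have hη' : ∀ s ∈ Ioo (-η) η, β (s + s₀) ∈ φ.source ∧ φ (β (s + s₀)) ∈ B := fun s hs ↦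
    hηs s (by rw [Metric.mem_ball, Real.dist_eq, sub_zero, abs_lt]; exact hs)
  obtain ⟨ε, hε, h3⟩ := exists_eq_integralCurve_of_ae_tangent hm0
    (hVL.mono (inter_subset_left.trans inter_subset_left)) (fun y hy ↦ hy.2) hwL hwB h01 hwd
    (b := fun s ↦ φ (β (s + s₀))) hη (by rw [hb00, hweq t₀ ⟨le_rfl, h01.le⟩])
    fun s hs ↦ ⟨(hη' s hs).2, (hβ.comp_add s₀).hasDerivAt_chart (hη' s hs).1⟩
  filter_upwards [Ioo_mem_nhdsGT (show t₀ < min t₁ (t₀ + ε) from lt_min h01 (by linarith))]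
    with t ht
  have htI : t ∈ Icc t₀ t₁ := ⟨ht.1.le, ht.2.le.trans (min_le_left _ _)⟩
  obtain ⟨s, hs, h4⟩ := h3 t ⟨ht.1.le, ht.2.trans_le (min_le_right _ _)⟩
  rw [hweq t htI] at h4
  exact ⟨s + s₀, φ.injOn (hη' s hs).1 (hIu t htI).2.1 h4⟩

/-- Admissible curves cannot leave a closed orbit. -/
theorem IsClosedOrbit.mem_of_joined [T2Space S] (hX : 𝓜.IsCharacteristicVectorField ι X)
    {C : Set S} (hC : IsClosedOrbit X C) {p q : S} (hp : p ∈ C) (h : 𝓜.Joined ι p q) : q ∈ C := by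
  obtain ⟨β, P, ⟨hβ, hβ0, hP, hper⟩, rfl⟩ := hC
  obtain ⟨γ, T, hγ, rfl, rfl⟩ := h
  have hcl : IsClosed (range β) := (hper.compact_of_continuous hP.ne' hβ.continuous).isClosed
  -- The set of times spent on the orbit is closed, since the orbit is compact, and open to the
  -- right; it contains `0`, so it is all of `[0, T]`.
  refine IsClosed.Icc_subset_of_forall_mem_nhdsWithin (s := γ ⁻¹' range β) ?_ hp (fun t ht ↦ ?_)
    (right_mem_Icc.2 hγ.1.le)
  · rw [inter_comm]
    exact hγ.2.1.1.preimage_isClosed_of_isClosed isClosed_Icc hcl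
  · exact hX.eventually_mem_range hγ hβ hβ0 ht.2 ht.1

end ClosedOrbits

end

theorem mainTheorem5
    {M : Type*} [TopologicalSpace M] [ChartedSpace Space M] [IsManifold (𝓡 3) ∞ M]
    [T2Space M] [SecondCountableTopology M]
    (𝓜 : ContactSubRiemannian M) (hco : 𝓜.CoOrientable)
    {S : Type*} [TopologicalSpace S] [ChartedSpace Plane S] [IsManifold (𝓡 2) ∞ S]
    [T2Space S] [CompactSpace S] [ConnectedSpace S] (hS : IsOrientableSurface S)
    (ι : S → M) (hι : IsSmoothEmbedding (𝓡 2) (𝓡 3) ∞ ι)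
    (X : (q : S) → TangentSpace (𝓡 2) q) (hX : 𝓜.IsCharacteristicVectorField ι X)
    (hMS : IsMorseSmale X) :
    𝓜.InducedDistFinite ι ↔ ¬ ∃ C : Set S, IsClosedOrbit X C := by
  have hιs : ContMDiff (𝓡 2) (𝓡 3) ∞ ι := hι.contMDiff
  have hXs : IsSmoothField X := hMS.smooth
  constructor
  · rintro hfin ⟨C, hC⟩
    obtain ⟨γ, T, hγ, rfl⟩ := id hC
    -- If all distances were finite, the closed orbit would contain every point joined to it, that
    -- is, all of `S`.
    refine hXs.range_ne_univ hγ.1 (eq_univ_of_forall fun q ↦ ?_)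
    exact hC.mem_of_joined hX (mem_range_self 0)
      ((ContactSubRiemannian.inducedDist_lt_top_iff hιs).1 (hfin (γ 0) q))
  · intro hno p q
    refine (ContactSubRiemannian.inducedDist_lt_top_iff hιs).2
      (hMS.joined hX.mfderiv_mem (fun q hq ↦ ?_) hno p q)
    exact hX.planeTrace_ne_zero hco hιs hq (hMS.nondegenerate_criticalPoints q hq).2
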